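/- \textbf{Theorem.} All logarithms are to base $2$. The model is the word RAM: a machine with $w$-bit words, $w=\Theta(\log n)$ with a sufficiently large constant factor, whose programs are fixed finite lists of instructions (constants, addition, subtraction, multiplication, division with remainder, bitwise operations and shifts on words, conditional and unconditional jumps, and indirect loads and stores), each instruction taking one unit of time. Fix a constant $d$. There is a constant $K$ such that for every $L$ there are four programs \textsc{Init}, \textsc{Insert}, \textsc{Update}, \textsc{Query} and a constant $C$ (all depending only on $d$ and $L$) with the following property. Let $n\ge 2$, $\log n\le m\le n$, $0\le v\le\log n$, let $\mathcal U=\{0,\dots,U-1\}$ be a universe of keys with $U\le n^{d}$, and let $K\log n\le w\le L\log n$. Then, with a memory of at most $mv+Cm$ bits (a whole number of $w$-bit words), the programs form an insertion-only data structure for up to $m$ keys from $\mathcal U$ with $v$-bit values: \begin{itemize} \item \textsc{Init}$(n,m,v,U,w)$ is run once, on a memory filled with uniformly random bits (the only randomness), and always halts. The resulting memory is the initial, empty structure. \item \textsc{Insert}$(k,y)$: given a new key $k$ and a value $y$ (allowed while fewer than $m$ keys have been inserted), stores the value $y$ for $k$ and returns an offset, an integer $p_k\ge 0$, to the user. \item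 \textsc{Update}$(k,p_k,y)$: given an existing key $k$ and its offset $p_k$, changes the value of $k$ to $y$. \item \textsc{Query}$(k,p_k)$: given an existing key $k$ and its offset $p_k$, returns the current value of $k$. \end{itemize} Only the memory is kept from one operation to the next; keys and offsets are supplied by the user. For every sequence of such operations, fixed independently of the random bits, every operation halts and every query is answered correctly for every outcome of the random bits, and each single operation takes expected time at most $C$. Moreover, after every such sequence of operations, the set $X$ of inserted keys satisfies $$\mathbb E\Bigl[\sum_{k\in X}\log(1+p_k)\Bigr]\le C m \qquad\text{and}\qquad \mathbb E\bigl[\#\{k\in X: p_k>\log^{100} n\}\bigr]\le \frac{C\,m}{\log^{95} n}.$$ -/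

import Mathlib

open scoped BigOperators

/-! ### The word RAM -/

namespace WordRAM

/-- Two-argument operations on `w`-bit words. Arithmetic is modulo `2 ^ w`, `div` and `mod` are those
of unsigned integers, `shl` and `shr` shift the first argument by the number of positions given by
the second one. -/
inductive BinOp where
  | add | sub | mul | div | mod | and | or | xor | shl | shr

/-- The word computed by an operation. -/
def BinOp.eval {w : ℕ} : BinOp → BitVec w → BitVec w → BitVec w
  | .add, a, b => a + b
  | .sub, a, b => a - b
  | .mul, a, b => a * b
  | .div, a, b => a / b
  | .mod, a, b => a % b
  | .and, a, b => a &&& b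
  | .or, a, b => a ||| b
  | .xor, a, b => a ^^^ b
  | .shl, a, b => a <<< b.toNat
  | .shr, a, b => a >>> b.toNat

/-- Instructions. The operands `dst`, `a`, `b`, `src`, `addr` are names of registers, and `target`
is a position in the program.
* `const dst c`: put the number `c` into `dst`;
* `op o dst a b`: put the result of `o` on the contents of `a` and `b` into `dst`;
* `load dst addr`: put the memory word, whose address is in `addr`, into `dst`;
* `store addr src`: put the content of `src` into the memory word whose address is in `addr`;
* `jmp target`: continue at `target`;
* `jeq a b target`, `jlt a b target`: continue at `target` if the content of `a` is equal to,
  resp. (as an unsigned integer) smaller than, the content of `b`. -/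
inductive Instr where
  | const (dst : ℕ) (c : ℕ)
  | op (o : BinOp) (dst a b : ℕ)
  | load (dst addr : ℕ)
  | store (addr src : ℕ)
  | jmp (target : ℕ)
  | jeq (a b target : ℕ)
  | jlt (a b target : ℕ)

/-- A program is a finite list of instructions. It halts when the program counter leaves the
list. -/
abbrev Program := List Instr

/-- The content of a memory of `S` words of `w` bits. -/
abbrev Memory (w S : ℕ) := Fin S → BitVec w

/-- A configuration of the machine: program counter, registers, and memory. Addresses of registers
are fixed in the program, so that a program uses only a bounded number of registers. -/
structure Config (w S : ℕ) where
  pc : ℕ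
  reg : ℕ → BitVec w
  mem : Memory w S

/-- The word at an address; there is no memory (and nothing but zeros is read) beyond the `S`
words. -/
def readMem {w S : ℕ} (μ : Memory w S) (a : BitVec w) : BitVec w :=
  if h : a.toNat < S then μ ⟨a.toNat, h⟩ else 0

/-- Write a word at an address; nothing can be written beyond the `S` words. -/
def writeMem {w S : ℕ} (μ : Memory w S) (a x : BitVec w) : Memory w S :=
  fun i => if i.val = a.toNat then x else μ i

/-- The effect of a single instruction. -/
def Instr.exec {w S : ℕ} (s : Config w S) : Instr → Config w S
  | .const dst c =>
      { s with pc := s.pc + 1, reg := Function.update s.reg dst (BitVec.ofNat w c) }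
  | .op o dst a b =>
      { s with pc := s.pc + 1, reg := Function.update s.reg dst (o.eval (s.reg a) (s.reg b)) }
  | .load dst addr =>
      { s with pc := s.pc + 1, reg := Function.update s.reg dst (readMem s.mem (s.reg addr)) }
  | .store addr src =>
      { s with pc := s.pc + 1, mem := writeMem s.mem (s.reg addr) (s.reg src) }
  | .jmp target => { s with pc := target }
  | .jeq a b target => { s with pc := if s.reg a = s.reg b then target else s.pc + 1 }
  | .jlt a b target =>
      { s with pc := if (s.reg a).toNat < (s.reg b).toNat then target else s.pc + 1 }

/-- One step of the computation; a configuration in which the program has halted is kept. -/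
def step {w S : ℕ} (P : Program) (s : Config w S) : Config w S :=
  match P[s.pc]? with
  | none => s
  | some i => i.exec s

/-- The program has halted within `t` steps. -/
def HaltedAt {w S : ℕ} (P : Program) (s : Config w S) (t : ℕ) : Prop :=
  P.length ≤ ((step P)^[t] s).pc

/-- The program halts when started in the configuration `s`. -/
def Halts {w S : ℕ} (P : Program) (s : Config w S) : Prop := ∃ t, HaltedAt P s t

/-- The running time: the number of executed instructions. It is meaningful only together with
`Halts P s`. -/
noncomputable def time {w S : ℕ} (P : Program) (s : Config w S) : ℕ := sInf {t | HaltedAt P s t}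

/-- The final configuration. It is meaningful only together with `Halts P s`. -/
noncomputable def final {w S : ℕ} (P : Program) (s : Config w S) : Config w S :=
  (step P)^[time P s] s

/-- The configuration in which a program is started: memory `μ`, the arguments in the registers
`0, 1, 2, …`, and zero in all other registers. -/
def start {w S : ℕ} (μ : Memory w S) (args : List ℕ) : Config w S where
  pc := 0
  reg := fun i => BitVec.ofNat w (args.getD i 0)
  mem := μ

end WordRAM

/-! ### Insertion-only structures whose insertions return offsets -/

namespace OffsetTable

open WordRAM

/-- The code of an insertion-only data structure with offsets: one program for the creation of the
structure, and one for each operation. -/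
structure Code where
  init : Program
  insert : Program
  update : Program
  query : Program

/-- An operation that the user requests; keys are the elements of `{0, …, U - 1}` and values are
`v`-bit numbers. -/
inductive Op (U v : ℕ) where
  | insert (k : Fin U) (y : Fin (2 ^ v))
  | update (k : Fin U) (y : Fin (2 ^ v))
  | query (k : Fin U)

variable {U v w S : ℕ}

/-- The map from keys to values that a sequence of operations is meant to produce. A sequence of
operations is written as a list with the **most recent operation first**. -/
def contents : List (Op U v) → Fin U → Option (Fin (2 ^ v))
  | [] => fun _ => none
  | .insert k y :: h => Function.update (contents h) k (some y)
  | .update k y :: h => Function.update (contents h) k (some y)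
  | .query _ :: h => contents h

/-- The set of the keys that were inserted. -/
def keys (h : List (Op U v)) : Finset (Fin U) := {k | (contents h k).isSome}

/-- The sequences of operations that the user may request (most recent operation first): at most
`m` keys are inserted, each of them once, and only existing keys are updated or queried. -/
def Legal (m : ℕ) : List (Op U v) → Prop
  | [] => True
  | .insert k _ :: h => Legal m h ∧ k ∉ keys h ∧ (keys h).card < m
  | .update k _ :: h => Legal m h ∧ k ∈ keys h
  | .query k :: h => Legal m h ∧ k ∈ keys h

/-- The memory of the data structure, together with the offsets that the user has received. The
offsets are kept by the user: they are no part of the memory, and the programs see the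
offset of a key only if the user passes it as an argument. -/
structure Session (U w S : ℕ) where
  mem : Memory w S
  offset : Fin U → BitVec w

/-- The program that carries out an operation. -/
def Code.program (D : Code) : Op U v → Program
  | .insert _ _ => D.insert
  | .update _ _ => D.update
  | .query _ => D.query

/-- The arguments of an operation: `(k, y)` for an insertion, `(k, p_k, y)` for an update, and
`(k, p_k)` for a query, where `p_k` is the offset that the insertion of `k` returned. -/
def Session.args (σ : Session U w S) : Op U v → List ℕ
  | .insert k y => [k.val, y.val]
  | .update k y => [k.val, (σ.offset k).toNat, y.val]
  | .query k => [k.val, (σ.offset k).toNat]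

/-- The configuration in which the program for an operation is started. Apart from the arguments,
only the memory is passed on from one operation to the next. -/
def Session.start (σ : Session U w S) (o : Op U v) : Config w S :=
  WordRAM.start σ.mem (σ.args o)

/-- The word that an operation returns: the content of register `0` at its end. -/
noncomputable def Session.answer (D : Code) (σ : Session U w S) (o : Op U v) : BitVec w :=
  (final (D.program o) (σ.start o)).reg 0

/-- The session after an operation. An insertion returns the offset of the key. -/
noncomputable def Session.perform (D : Code) (σ : Session U w S) (o : Op U v) : Session U w S where
  mem := (final (D.program o) (σ.start o)).mem
  offset := match o with
    | .insert k _ => Function.update σ.offset k (σ.answer D o)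
    | .update _ _ => σ.offset
    | .query _ => σ.offset

/-- The configuration in which the creation of the structure is started: the arguments are the
parameters, and the memory holds the random words `seed`, the only source of randomness. -/
def initStart (n m v U : ℕ) (seed : Memory w S) : Config w S :=
  WordRAM.start seed [n, m, v, U, w]

/-- The session after a sequence of operations (most recent operation first). -/
noncomputable def session (D : Code) (n m : ℕ) (seed : Memory w S) :
    List (Op U v) → Session U w S
  | [] => { mem := (final D.init (initStart n m v U seed)).mem, offset := fun _ => 0 }
  | o :: h => (session D n m seed h).perform D o

/-- The offset `p_k` of a key after a sequence of operations. -/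
noncomputable def offset (D : Code) (n m : ℕ) (seed : Memory w S) (h : List (Op U v))
    (k : Fin U) : ℕ :=
  ((session D n m seed h).offset k).toNat

end OffsetTable

/-!
The structure is linear probing on a circle of `M = m + ⌊m / w⌋ + 1` slots: a key `k` is stored in
the first free slot at or after its home `h(k)`, and the offset `p_k` is the distance to that slot.
With the key and the offset at hand, an update or a query computes the slot `(h(k) + p_k) % M` and
needs neither keys nor offsets in the memory, so that the values take `M * v ≤ m * v + O(m)` bits. Only
insertions have to know which slots are free. The other `O(m)` bits are a bit for every node of a
heap-shaped tree of degree `f ≈ √w` over the slots, which tells whether there is a free slot below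
the node (`Shape`, `Shape.Bits`).

*Time.* An insertion ascends from the leaf of the home until there is a free slot below one of the `f`
nodes that start at the current one, descends to the first free slot (`Shape.Search`), and clears bits on the
way up from it (`Shape.Pending`). The bits of `f` neighbouring nodes fit into a word, and word
operations find the first one that is set (`runBlock_lowCode`). If the insertion ascends
`i + O(1)` levels, then the home lies on an arc of `f ^ i` occupied slots (`Shape.Search.arc`,
`Shape.arc_of_anc`), and then, by the usual argument for linear probing, on an arc of `s ≥ f ^ i`
slots that at least `s` keys have as their homes (`Shape.Arc.overfull`, `Overfull`).

*Hashing.* The hash function is a polynomial of degree `2` modulo `2 ^ w` whose coefficients are the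
first three words of the random memory; its upper half is reduced modulo `M`. Translating the
coefficients by integer multiples of Lagrange polynomials shows that the upper halves are three-wise
independent (`seedTop_indep`). Conditioned on the home of `k`, the other homes are thus pairwise
independent, and Chebyshev's inequality, applied to arcs whose ends are rounded to multiples of about
`ε * l`, shows that the home of `k` lies on an overfull arc of length at least `l` with
probability `O(1 / (ε ^ 4 * l))`, if a fraction `ε` of the slots is free (`Indep.prob_overfull_le`).

*Sums.* Always `ε ≥ 1 / (w + 1)` (`Par.Good.free_fraction`), so that the probabilities for `l = f ^ i`
add up to `O(1)` (`Par.Good.expect_scales`), and `p_k > log ^ 100 n` has probability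
`O(w ^ 4 / log ^ 100 n)` (`Par.Good.expect_card_offset`). The scales `l = 2 ^ i` bound the expectation
of `log (1 + p_k)` by `4 * log (1 / ε) + O(1)`; for the key that is inserted after `t` others,
`1 / ε = M / (M - t)`, and the sum of `log (M / (M - t))` is `O(M)`, since `M ^ M / M! ≤ e ^ M`
(`sum_logb_le`).

*Programs.* The programs are written in a small structured language (`Cmd`) that is compiled to
the machine; `Runs` is its total-correctness judgement with time bounds.
-/


/-! ### Structured programs -/

namespace WordRAM

/-- The operations on words, on their values as natural numbers. -/
def BinOp.natEval (w : ℕ) : BinOp → ℕ → ℕ → ℕ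
  | .add, a, b => (a + b) % 2 ^ w
  | .sub, a, b => (2 ^ w - b + a) % 2 ^ w
  | .mul, a, b => a * b % 2 ^ w
  | .div, a, b => a / b
  | .mod, a, b => a % b
  | .and, a, b => a &&& b
  | .or, a, b => a ||| b
  | .xor, a, b => a ^^^ b
  | .shl, a, b => (a <<< b) % 2 ^ w
  | .shr, a, b => a >>> b

theorem BinOp.toNat_eval {w : ℕ} (o : BinOp) (a b : BitVec w) :
    (o.eval a b).toNat = o.natEval w a.toNat b.toNat := by
  cases o <;> simp [BinOp.eval, BinOp.natEval]

/-- Registers and memory with their contents as natural numbers, and without a program counter.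
Memory cells beyond the size of the memory hold zero. -/
@[ext]
structure NatState where
  r : ℕ → ℕ
  μ : ℕ → ℕ

/-- The registers and the memory of a configuration. -/
def Config.nat {w S : ℕ} (s : Config w S) : NatState where
  r i := (s.reg i).toNat
  μ a := if h : a < S then (s.mem ⟨a, h⟩).toNat else 0

/-- The instructions other than jumps. -/
def Instr.straight : Instr → Bool
  | .jmp _ => false
  | .jeq _ _ _ => false
  | .jlt _ _ _ => false
  | _ => true

/-- The effect of an instruction that is not a jump. -/
def Instr.natExec (w S : ℕ) (s : NatState) : Instr → NatState
  | .const dst c => { s with r := Function.update s.r dst (c % 2 ^ w) }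
  | .op o dst a b => { s with r := Function.update s.r dst (o.natEval w (s.r a) (s.r b)) }
  | .load dst addr => { s with r := Function.update s.r dst (s.μ (s.r addr)) }
  | .store addr src => { s with μ := fun i => if i = s.r addr ∧ i < S then s.r src else s.μ i }
  | _ => s

theorem Instr.nat_exec {w S : ℕ} (i : Instr) (hi : i.straight = true) (s : Config w S) :
    (i.exec s).nat = i.natExec w S s.nat ∧ (i.exec s).pc = s.pc + 1 := by
  cases i with
  | const dst c =>
    refine ⟨?_, rfl⟩
    ext j
    · by_cases h : j = dst
      · subst h; simp [Config.nat, Instr.exec, Instr.natExec]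
      · simp [Config.nat, Instr.exec, Instr.natExec, Function.update_of_ne h]
    · rfl
  | op o dst a b =>
    refine ⟨?_, rfl⟩
    ext j
    · by_cases h : j = dst
      · subst h; simp [Config.nat, Instr.exec, Instr.natExec, BinOp.toNat_eval]
      · simp [Config.nat, Instr.exec, Instr.natExec, Function.update_of_ne h]
    · rfl
  | load dst addr =>
    refine ⟨?_, rfl⟩
    ext j
    · by_cases h : j = dst
      · subst h
        simp only [Config.nat, Instr.exec, Instr.natExec, Function.update_self, readMem]
        split_ifs <;> simp
      · simp [Config.nat, Instr.exec, Instr.natExec, Function.update_of_ne h]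
    · rfl
  | store addr src =>
    refine ⟨?_, rfl⟩
    ext j
    · rfl
    · by_cases h : j < S
      · by_cases h2 : j = (s.reg addr).toNat
        · subst h2; simp [Config.nat, Instr.exec, Instr.natExec, writeMem, h]
        · simp [Config.nat, Instr.exec, Instr.natExec, writeMem, h, h2]
      · simp [Config.nat, Instr.exec, Instr.natExec, h]
  | jmp _ => simp [Instr.straight] at hi
  | jeq _ _ _ => simp [Instr.straight] at hi
  | jlt _ _ _ => simp [Instr.straight] at hi

/-- Structured programs: straight-line code, composition, and loops. The loop `whl lt a b c` repeats
`c` as long as the content of register `a` is smaller than (for `lt = true`), resp. equal to (for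
`lt = false`), that of register `b`. -/
inductive Cmd where
  | blk (l : List Instr)
  | seq (c d : Cmd)
  | whl (lt : Bool) (a b : ℕ) (c : Cmd)

/-- The number of instructions of the compiled program. -/
def Cmd.size : Cmd → ℕ
  | .blk l => l.length
  | .seq c d => c.size + d.size
  | .whl _ _ _ c => c.size + 3

/-- The instructions of a structured program that is placed at position `o`. -/
def Cmd.compile : ℕ → Cmd → Program
  | _, .blk l => l
  | o, .seq c d => c.compile o ++ d.compile (o + c.size)
  | o, .whl lt a b c =>
      (if lt then Instr.jlt a b (o + 2) else Instr.jeq a b (o + 2)) ::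
        Instr.jmp (o + c.size + 3) :: (c.compile (o + 2) ++ [Instr.jmp o])

theorem Cmd.length_compile (c : Cmd) : ∀ o, (c.compile o).length = c.size := by
  induction c with
  | blk l => intro o; rfl
  | seq c d hc hd => intro o; simp [Cmd.compile, Cmd.size, hc, hd]
  | whl lt a b c hc => intro o; simp [Cmd.compile, Cmd.size, hc]

/-- The condition of a loop. -/
def loopTest (lt : Bool) (x y : ℕ) : Prop := if lt then x < y else x = y

/-- The effect of straight-line code. -/
def runBlock (w S : ℕ) (l : List Instr) (s : NatState) : NatState :=
  l.foldl (Instr.natExec w S) s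

/-- `Exec w S c s s' t`: started in `s`, the structured program `c` ends in `s'` after `t`
instructions. -/
inductive Exec (w S : ℕ) : Cmd → NatState → NatState → ℕ → Prop
  | blk (l : List Instr) (s : NatState) (h : l.all Instr.straight = true) :
      Exec w S (.blk l) s (runBlock w S l s) l.length
  | seq {c d s s' s'' t t'} (h : Exec w S c s s' t) (h' : Exec w S d s' s'' t') :
      Exec w S (.seq c d) s s'' (t + t')
  | done {lt a b c s} (h : ¬ loopTest lt (s.r a) (s.r b)) : Exec w S (.whl lt a b c) s s 2
  | loop {lt a b c s s' s'' t t'} (h : loopTest lt (s.r a) (s.r b)) (hc : Exec w S c s s' t)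
      (hl : Exec w S (.whl lt a b c) s' s'' t') : Exec w S (.whl lt a b c) s s'' (t + 2 + t')

theorem step_of_getElem? {w S : ℕ} {P : Program} {s : Config w S} {i : Instr}
    (h : P[s.pc]? = some i) : step P s = i.exec s := by
  simp [step, h]

theorem runBlock_steps {w S : ℕ} (l : List Instr) (hl : l.all Instr.straight = true) :
    ∀ (pre post : Program) (s : Config w S), s.pc = pre.length →
      ((step (pre ++ l ++ post))^[l.length] s).pc = pre.length + l.length ∧
      ((step (pre ++ l ++ post))^[l.length] s).nat = runBlock w S l s.nat := by
  induction l with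
  | nil => intro pre post s hs; simp [hs, runBlock]
  | cons i l ih =>
    intro pre post s hs
    simp only [List.all_cons, Bool.and_eq_true] at hl
    have h1 : step (pre ++ (i :: l) ++ post) s = i.exec s := by
      apply step_of_getElem?
      simp [hs]
    obtain ⟨h2, h3⟩ := i.nat_exec hl.1 s
    have := ih hl.2 (pre ++ [i]) post (i.exec s) (by simp [h3, hs])
    simp only [List.length_cons, Function.iterate_succ, Function.comp_apply, h1]
    simp only [List.append_assoc, List.length_append, List.nil_append,
      List.length_singleton, List.cons_append] at this ⊢
    refine ⟨by rw [this.1]; omega, ?_⟩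
    rw [this.2, h2]
    rfl

/-- The compiled program does what the structured program says. -/
theorem Exec.steps {w S : ℕ} {c : Cmd} {s s' : NatState} {t : ℕ} (h : Exec w S c s s' t) :
    ∀ (pre post : Program) (σ : Config w S), σ.pc = pre.length → σ.nat = s →
      ((step (pre ++ c.compile pre.length ++ post))^[t] σ).pc = pre.length + c.size ∧
      ((step (pre ++ c.compile pre.length ++ post))^[t] σ).nat = s' := by
  induction h with
  | blk l s hl =>
    intro pre post σ hpc hs
    subst hs
    exact runBlock_steps l hl pre post σ hpc
  | @seq c d s s' s'' t t' _ _ ih ih' =>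
    intro pre post σ hpc hs
    have h1 := ih pre (d.compile (pre.length + c.size) ++ post) σ hpc hs
    have h2 := ih' (pre ++ c.compile pre.length) post _
      (by simpa [Cmd.length_compile] using h1.1) h1.2
    rw [add_comm t t', Function.iterate_add_apply]
    simp only [Cmd.compile, Cmd.size, List.append_assoc, List.length_append,
      Cmd.length_compile] at h1 h2 ⊢
    exact ⟨by rw [h2.1]; omega, h2.2⟩
  | @done lt a b c s h =>
    intro pre post σ hpc hs
    subst hs
    set P := pre ++ (Cmd.whl lt a b c).compile pre.length ++ post with hP
    have h1 : step P σ = { σ with pc := σ.pc + 1 } := by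
      cases lt
      · rw [step_of_getElem? (i := Instr.jeq a b (pre.length + 2)) (by simp [hP, hpc, Cmd.compile])]
        have : σ.reg a ≠ σ.reg b := fun h' => h (by simp [loopTest, Config.nat, h'])
        simp [Instr.exec, this]
      · rw [step_of_getElem? (i := Instr.jlt a b (pre.length + 2)) (by simp [hP, hpc, Cmd.compile])]
        have : ¬ (σ.reg a).toNat < (σ.reg b).toNat := fun h' =>
          h (by simpa [loopTest, Config.nat] using h')
        simp [Instr.exec, this]
    have h2 : step P (step P σ) = { σ with pc := pre.length + c.size + 3 } := by
      rw [h1, step_of_getElem? (i := Instr.jmp (pre.length + c.size + 3))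
        (by simp [hP, hpc, Cmd.compile])]
      simp [Instr.exec]
    simp only [Function.iterate_succ, Function.comp_apply, Function.iterate_zero, id, h2]
    exact ⟨by simp [Cmd.size]; omega, rfl⟩
  | @loop lt a b c s s' s'' t t' h _ _ ih ih' =>
    intro pre post σ hpc hs
    subst hs
    set P := pre ++ (Cmd.whl lt a b c).compile pre.length ++ post with hP
    have h1 : step P σ = { σ with pc := pre.length + 2 } := by
      cases lt
      · rw [step_of_getElem? (i := Instr.jeq a b (pre.length + 2)) (by simp [hP, hpc, Cmd.compile])]
        have : σ.reg a = σ.reg b := BitVec.eq_of_toNat_eq (by simpa [loopTest, Config.nat] using h)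
        simp [Instr.exec, this]
      · rw [step_of_getElem? (i := Instr.jlt a b (pre.length + 2)) (by simp [hP, hpc, Cmd.compile])]
        have : (σ.reg a).toNat < (σ.reg b).toNat := by simpa [loopTest, Config.nat] using h
        simp [Instr.exec, this]
    have h2 := ih (pre ++ [if lt then Instr.jlt a b (pre.length + 2)
        else Instr.jeq a b (pre.length + 2), Instr.jmp (pre.length + c.size + 3)])
      (Instr.jmp pre.length :: post) (step P σ) (by simp [h1]) (by rw [h1]; rfl)
    have hP2 : (pre ++ [if lt then Instr.jlt a b (pre.length + 2)
        else Instr.jeq a b (pre.length + 2), Instr.jmp (pre.length + c.size + 3)]) ++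
        c.compile (pre ++ [if lt then Instr.jlt a b (pre.length + 2)
        else Instr.jeq a b (pre.length + 2),
          Instr.jmp (pre.length + c.size + 3)]).length ++ (Instr.jmp pre.length :: post) = P := by
      simp [hP, Cmd.compile]
    rw [hP2] at h2
    set τ := (step P)^[t] (step P σ) with hτ
    have h3 : step P τ = { τ with pc := pre.length } := by
      rw [step_of_getElem? (i := Instr.jmp pre.length)]
      · rfl
      · rw [h2.1, ← hP2]
        rw [List.getElem?_append_right (by simp [Cmd.length_compile]; omega)]
        simp only [List.length_append, Cmd.length_compile, Nat.sub_self]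
        rfl
    have h4 := ih' pre post (step P τ) (by simp [h3]) (by rw [h3]; exact h2.2)
    rw [← hP] at h4
    have h5 : (step P)^[t + 2 + t'] σ = (step P)^[t'] (step P τ) := by
      rw [hτ, ← Function.iterate_succ_apply' (step P) t, ← Function.iterate_succ_apply (step P),
        ← Function.iterate_add_apply]
      congr 1
      omega
    rw [h5]
    exact h4

theorem step_of_halted {w S : ℕ} {P : Program} {s : Config w S} (h : P.length ≤ s.pc) :
    step P s = s := by
  simp [step, h]

theorem Exec.final {w S : ℕ} {c : Cmd} {σ : Config w S} {s' : NatState} {t : ℕ}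
    (h : Exec w S c σ.nat s' t) (hpc : σ.pc = 0) :
    Halts (c.compile 0) σ ∧ time (c.compile 0) σ ≤ t ∧ (final (c.compile 0) σ).nat = s' := by
  have h1 := h.steps [] [] σ hpc rfl
  simp only [List.nil_append, List.append_nil, List.length_nil, zero_add] at h1
  have ht : HaltedAt (c.compile 0) σ t := by
    simp [HaltedAt, h1.1, Cmd.length_compile]
  have hle : time (c.compile 0) σ ≤ t := Nat.sInf_le ht
  refine ⟨⟨t, ht⟩, hle, ?_⟩
  have h2 : HaltedAt (c.compile 0) σ (time (c.compile 0) σ) :=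
    Nat.sInf_mem (s := {t | HaltedAt (c.compile 0) σ t}) ⟨t, ht⟩
  obtain ⟨e, rfl⟩ := Nat.exists_eq_add_of_le hle
  rw [← h1.2, add_comm, Function.iterate_add_apply]
  have : ∀ e, (step (c.compile 0))^[e] (WordRAM.final (c.compile 0) σ)
      = WordRAM.final (c.compile 0) σ := by
    intro e
    exact Function.iterate_fixed (step_of_halted h2) e
  exact congrArg Config.nat (this _).symm

/-- Started in `s`, the program `c` ends after at most `T` instructions, in a state that
satisfies `Q`. -/
def Runs (w S : ℕ) (c : Cmd) (s : NatState) (T : ℕ) (Q : NatState → Prop) : Prop :=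
  ∃ s' t, Exec w S c s s' t ∧ t ≤ T ∧ Q s'

theorem Runs.blk {w S : ℕ} {l : List Instr} {s : NatState} {Q : NatState → Prop}
    (h : l.all Instr.straight = true) (hQ : Q (runBlock w S l s)) :
    Runs w S (.blk l) s l.length Q :=
  ⟨_, _, .blk l s h, le_rfl, hQ⟩

theorem Runs.mono {w S : ℕ} {c : Cmd} {s : NatState} {T T' : ℕ} {Q Q' : NatState → Prop}
    (h : Runs w S c s T Q) (hT : T ≤ T') (hQ : ∀ s, Q s → Q' s) : Runs w S c s T' Q' := by
  obtain ⟨s', t, he, ht, hq⟩ := h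
  exact ⟨s', t, he, ht.trans hT, hQ _ hq⟩

/-- A loop whose body maintains an invariant `I k`, where `k` counts the iterations done so far, and
that is left at the latest after `B` iterations. -/
theorem Runs.whl {w S : ℕ} {lt : Bool} {a b : ℕ} {c : Cmd} {T : ℕ} (B : ℕ)
    (I : ℕ → NatState → Prop) {Q : NatState → Prop}
    (hbody : ∀ k s, I k s → loopTest lt (s.r a) (s.r b) → k < B ∧ Runs w S c s T (I (k + 1)))
    (hQ : ∀ k s, I k s → ¬ loopTest lt (s.r a) (s.r b) → Q s) (s : NatState) (h0 : I 0 s) :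
    Runs w S (.whl lt a b c) s (B * (T + 2) + 2) Q := by
  suffices H : ∀ d k s, B ≤ k + d → I k s →
      Runs w S (.whl lt a b c) s (d * (T + 2) + 2) Q from H B 0 s (by omega) h0
  intro d
  induction d with
  | zero =>
    intro k s hk hI
    by_cases ht : loopTest lt (s.r a) (s.r b)
    · exact absurd (hbody k s hI ht).1 (by omega)
    · exact ⟨s, 2, .done ht, by omega, hQ k s hI ht⟩
  | succ d ih =>
    intro k s hk hI
    by_cases ht : loopTest lt (s.r a) (s.r b)
    · obtain ⟨s', t, he, htT, hI'⟩ := (hbody k s hI ht).2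
      obtain ⟨s'', t', he', ht', hq⟩ := ih (k + 1) s' (by omega) hI'
      exact ⟨s'', _, .loop ht he he', by rw [Nat.succ_mul]; omega, hq⟩
    · exact ⟨s, 2, .done ht, by omega, hQ k s hI ht⟩

/-- The register that an instruction changes (none for stores and jumps). -/
def Instr.dst : Instr → Option ℕ
  | .const d _ => some d
  | .op _ d _ _ => some d
  | .load d _ => some d
  | _ => none

theorem runBlock_cons (w S : ℕ) (i : Instr) (l : List Instr) (s : NatState) :
    runBlock w S (i :: l) s = runBlock w S l (i.natExec w S s) := rfl

theorem runBlock_append (w S : ℕ) (l l' : List Instr) (s : NatState) :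
    runBlock w S (l ++ l') s = runBlock w S l' (runBlock w S l s) := by
  simp [runBlock]

theorem natExec_frame (w S : ℕ) (i : Instr) (j : ℕ) (s : NatState) (h : i.dst ≠ some j) :
    (i.natExec w S s).r j = s.r j := by
  cases i <;> simp_all [Instr.natExec, Instr.dst, Function.update_apply] <;> omega

theorem runBlock_frame (w S : ℕ) (l : List Instr) (j : ℕ) :
    ∀ s, (∀ i ∈ l, i.dst ≠ some j) → (runBlock w S l s).r j = s.r j := by
  induction l with
  | nil => intro s _; rfl
  | cons i l ih =>
    intro s h
    rw [runBlock_cons, ih _ fun i' hi' => h i' (by simp [hi']),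
      natExec_frame _ _ _ _ _ (h i (by simp))]

/-- All registers and memory cells hold words. -/
def NatState.Bdd (w : ℕ) (s : NatState) : Prop := (∀ i, s.r i < 2 ^ w) ∧ ∀ a, s.μ a < 2 ^ w

theorem Config.nat_bdd {w S : ℕ} (σ : Config w S) : σ.nat.Bdd w := by
  refine ⟨fun i => (σ.reg i).isLt, fun a => ?_⟩
  simp only [Config.nat]
  split_ifs
  · exact BitVec.isLt _
  · exact Nat.two_pow_pos w

theorem BinOp.natEval_lt {w : ℕ} (o : BinOp) {a b : ℕ} (ha : a < 2 ^ w) (hb : b < 2 ^ w) :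
    o.natEval w a b < 2 ^ w := by
  have := o.toNat_eval (BitVec.ofNat w a) (BitVec.ofNat w b)
  rw [BitVec.toNat_ofNat, BitVec.toNat_ofNat, Nat.mod_eq_of_lt ha, Nat.mod_eq_of_lt hb] at this
  rw [← this]
  exact BitVec.isLt _

theorem NatState.Bdd.natExec {w : ℕ} {s : NatState} (h : s.Bdd w) (S : ℕ) (i : Instr) :
    (i.natExec w S s).Bdd w := by
  have hupd : ∀ d x, x < 2 ^ w → ∀ j, Function.update s.r d x j < 2 ^ w := by
    intro d x hx j
    by_cases hj : j = d
    · subst hj; simpa using hx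
    · rw [Function.update_of_ne hj]; exact h.1 j
  cases i with
  | const d c => exact ⟨hupd _ _ (Nat.mod_lt _ (Nat.two_pow_pos w)), h.2⟩
  | op o d a b => exact ⟨hupd _ _ (o.natEval_lt (h.1 a) (h.1 b)), h.2⟩
  | load d a => exact ⟨hupd _ _ (h.2 _), h.2⟩
  | store a b =>
    refine ⟨h.1, fun j => ?_⟩
    simp only [Instr.natExec]
    split_ifs
    · exact h.1 b
    · exact h.2 j
  | jmp _ => exact h
  | jeq _ _ _ => exact h
  | jlt _ _ _ => exact h

theorem NatState.Bdd.runBlock {w : ℕ} {s : NatState} (h : s.Bdd w) (S : ℕ) (l : List Instr) :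
    (runBlock w S l s).Bdd w := by
  induction l generalizing s with
  | nil => exact h
  | cons i l ih => exact ih (h.natExec S i)

end WordRAM

/-! ### Bit fields in the memory -/

namespace WordRAM

/-- The memory as an array of bits: `w` of them in each word. -/
def bitAt (w : ℕ) (μ : ℕ → ℕ) (p : ℕ) : Bool := (μ (p / w)).testBit (p % w)

/-- The number that is written in the `g` bits from position `A` on. -/
def field (w : ℕ) (μ : ℕ → ℕ) (A g : ℕ) : ℕ :=
  ((μ (A / w) >>> (A % w)) ||| ((μ (A / w + 1) <<< (w - A % w)) % 2 ^ w)) &&& (2 ^ g - 1)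

theorem field_lt (w : ℕ) (μ : ℕ → ℕ) (A g : ℕ) : field w μ A g < 2 ^ g :=
  lt_of_le_of_lt Nat.and_le_right (Nat.sub_lt (Nat.two_pow_pos g) one_pos)

theorem add_div_mod_cases {w A j : ℕ} (hj : j < w) :
    (A % w + j < w ∧ (A + j) / w = A / w ∧ (A + j) % w = A % w + j) ∨
    (w ≤ A % w + j ∧ (A + j) / w = A / w + 1 ∧ (A + j) % w = A % w + j - w) := by
  have hw : 0 < w := by omega
  have hA := Nat.div_add_mod A w
  have hr := Nat.mod_lt A hw
  rcases lt_or_ge (A % w + j) w with h | h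
  · left
    have h' : A + j = w * (A / w) + (A % w + j) := by omega
    refine ⟨h, ?_, ?_⟩
    · rw [h', Nat.mul_add_div hw, Nat.div_eq_of_lt h, add_zero]
    · rw [h', Nat.mul_add_mod, Nat.mod_eq_of_lt h]
  · right
    have h' : A + j = w * (A / w + 1) + (A % w + j - w) := by rw [Nat.mul_add]; omega
    refine ⟨h, ?_, ?_⟩
    · rw [h', Nat.mul_add_div hw, Nat.div_eq_of_lt (show A % w + j - w < w by omega), add_zero]
    · rw [h', Nat.mul_add_mod, Nat.mod_eq_of_lt (by omega)]

theorem testBit_field {w : ℕ} {μ : ℕ → ℕ} (hμ : ∀ a, μ a < 2 ^ w) {A g : ℕ} (hg : g ≤ w) (j : ℕ) :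
    (field w μ A g).testBit j = (decide (j < g) && bitAt w μ (A + j)) := by
  unfold field bitAt
  rw [Nat.testBit_and, Nat.testBit_two_pow_sub_one, Bool.and_comm]
  by_cases hj : j < g
  · have hjw : j < w := by omega
    simp only [hj, decide_true, Bool.true_and]
    rw [Nat.testBit_or, Nat.testBit_shiftRight, Nat.testBit_mod_two_pow, Nat.testBit_shiftLeft]
    have hr := Nat.mod_lt A (show 0 < w by omega)
    rcases add_div_mod_cases (A := A) hjw with ⟨h1, h2, h3⟩ | ⟨h1, h2, h3⟩
    · rw [h2, h3]
      have : ¬ w - A % w ≤ j := by omega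
      simp [this]
    · rw [h2, h3, Nat.testBit_lt_two_pow
        (lt_of_lt_of_le (hμ _) (Nat.pow_le_pow_right two_pos h1))]
      have h4 : w - A % w ≤ j := by omega
      have h5 : j - (w - A % w) = A % w + j - w := by omega
      simp [h4, h5, hjw]
  · simp [hj]

/-- A word with the bits of a mask `m` replaced. -/
def patch (x m y : ℕ) : ℕ := ((x ||| m) ^^^ m) ||| y

theorem testBit_patch (x m y j : ℕ) :
    (patch x m y).testBit j = ((x.testBit j && !m.testBit j) || y.testBit j) := by
  unfold patch
  rw [Nat.testBit_or, Nat.testBit_xor, Nat.testBit_or]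
  cases x.testBit j <;> cases m.testBit j <;> rfl

/-- The memory after writing `y` into the `g` bits from position `A` on. -/
def setField (w : ℕ) (μ : ℕ → ℕ) (A g y : ℕ) : ℕ → ℕ := fun i =>
  if i = A / w + 1 then patch (μ i) ((2 ^ g - 1) >>> (w - A % w)) (y >>> (w - A % w))
  else if i = A / w then
    patch (μ i) (((2 ^ g - 1) <<< (A % w)) % 2 ^ w) ((y <<< (A % w)) % 2 ^ w)
  else μ i

theorem bitAt_setField {w : ℕ} {μ : ℕ → ℕ} {A g y : ℕ} (hg : g ≤ w)
    (hw : 0 < w) (hy : y < 2 ^ g) (p : ℕ) :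
    bitAt w (setField w μ A g y) p =
      if A ≤ p ∧ p < A + g then y.testBit (p - A) else bitAt w μ p := by
  have hyg : ∀ j, g ≤ j → y.testBit j = false := fun j hj =>
    Nat.testBit_lt_two_pow (lt_of_lt_of_le hy (Nat.pow_le_pow_right two_pos hj))
  have hA := Nat.div_add_mod A w
  have hp := Nat.div_add_mod p w
  have hAr := Nat.mod_lt A hw
  have hpr := Nat.mod_lt p hw
  unfold bitAt setField
  by_cases h1 : p / w = A / w + 1
  · have hpA : p = A + (w - A % w) + p % w := by
      rw [h1, Nat.mul_add] at hp; omega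
    rw [if_pos h1, testBit_patch, Nat.testBit_shiftRight, Nat.testBit_shiftRight,
      Nat.testBit_two_pow_sub_one]
    have e : w - A % w + p % w = p - A := by omega
    rw [e]
    by_cases h2 : p - A < g
    · rw [if_pos (by omega)]; simp [h2]
    · rw [if_neg (by omega)]; simp [h2, hyg _ (not_lt.1 h2)]
  · rw [if_neg h1]
    by_cases h3 : p / w = A / w
    · rw [if_pos h3, testBit_patch, Nat.testBit_mod_two_pow, Nat.testBit_mod_two_pow,
        Nat.testBit_shiftLeft, Nat.testBit_shiftLeft, Nat.testBit_two_pow_sub_one]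
      rw [h3] at hp
      by_cases h4 : A ≤ p
      · have e : p % w - A % w = p - A := by omega
        have e2 : A % w ≤ p % w := by omega
        rw [e]
        by_cases h2 : p - A < g
        · rw [if_pos (by omega)]; simp [h2, hpr, e2]
        · rw [if_neg (by omega)]; simp [h2, hyg _ (not_lt.1 h2)]
      · have e2 : ¬ A % w ≤ p % w := by omega
        rw [if_neg (by omega)]; simp [e2]
    · rw [if_neg h3, if_neg]
      rintro ⟨h4, h5⟩
      have h6 : A / w ≤ p / w := Nat.div_le_div_right h4
      have h7 : w * (A / w + 2) ≤ w * (p / w) := Nat.mul_le_mul_left w (by omega)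
      have h8 : w * (A / w + 2) = w * (A / w) + 2 * w := by ring
      omega

theorem setField_of_lt {w : ℕ} {μ : ℕ → ℕ} {A g y i : ℕ} (h : i < A / w) :
    setField w μ A g y i = μ i := by
  unfold setField
  rw [if_neg (by omega), if_neg (by omega)]

theorem field_congr {w : ℕ} {μ μ' : ℕ → ℕ} (hμ : ∀ a, μ a < 2 ^ w) (hμ' : ∀ a, μ' a < 2 ^ w)
    {A A' g : ℕ} (hg : g ≤ w) (h : ∀ j < g, bitAt w μ (A + j) = bitAt w μ' (A' + j)) :
    field w μ A g = field w μ' A' g := by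
  refine Nat.eq_of_testBit_eq fun j => ?_
  rw [testBit_field hμ hg, testBit_field hμ' hg]
  by_cases hj : j < g
  · simp [hj, h j hj]
  · simp [hj]

theorem field_setField_self {w : ℕ} {μ μ' : ℕ → ℕ} (hμ' : ∀ a, μ' a < 2 ^ w)
    {A g y : ℕ} (hg : g ≤ w) (hw : 0 < w) (hy : y < 2 ^ g) (h : μ' = setField w μ A g y) :
    field w μ' A g = y := by
  refine Nat.eq_of_testBit_eq fun j => ?_
  rw [testBit_field hμ' hg]
  by_cases hj : j < g
  · rw [h, bitAt_setField hg hw hy, if_pos ⟨by omega, by omega⟩]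
    simp [hj]
  · simp only [hj, decide_false, Bool.false_and]
    exact (Nat.testBit_lt_two_pow
      (lt_of_lt_of_le hy (Nat.pow_le_pow_right two_pos (not_lt.1 hj)))).symm

/-- Code that reads the field at the bit address in register `50`, with a mask of ones in register
`mask` and the word length in register `13`; the result is put into register `52`. -/
def readCode (mask : ℕ) : List Instr :=
  [.op .div 53 50 13, .op .mod 54 50 13, .load 55 53, .op .shr 55 55 54, .const 56 1,
    .op .add 53 53 56, .load 57 53, .op .sub 58 13 54, .op .shl 57 57 58, .op .or 55 55 57,
    .op .and 52 55 mask]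

/-- Code that writes the number in register `59` into the field at the bit address in register
`50`. -/
def writeCode (mask : ℕ) : List Instr :=
  [.op .div 53 50 13, .op .mod 54 50 13, .op .shl 55 mask 54, .op .shl 56 59 54, .load 57 53,
    .op .or 57 57 55, .op .xor 57 57 55, .op .or 57 57 56, .store 53 57, .const 56 1,
    .op .add 53 53 56, .op .sub 58 13 54, .op .shr 55 mask 58, .op .shr 56 59 58, .load 57 53,
    .op .or 57 57 55, .op .xor 57 57 55, .op .or 57 57 56, .store 53 57]

theorem wordIndex_lt {w A : ℕ} (hw1 : 1 < w) (hA : A < 2 ^ w) : A / w + 1 < 2 ^ w := by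
  have h1 : A / w ≤ A / 2 := Nat.div_le_div_left hw1 two_pos
  have h2 : 2 ^ 2 ≤ 2 ^ w := Nat.pow_le_pow_right two_pos hw1
  omega

theorem shiftComplement {w A : ℕ} (hw1 : 1 < w) : (2 ^ w - A % w + w) % 2 ^ w = w - A % w := by
  have hr := Nat.mod_lt A (show 0 < w by omega)
  have h2 : w < 2 ^ w := Nat.lt_two_pow_self
  have : 2 ^ w - A % w + w = 2 ^ w + (w - A % w) := by omega
  rw [this, Nat.add_mod_left, Nat.mod_eq_of_lt (by omega)]

theorem runBlock_readCode {w S : ℕ} {s : NatState} {mask g : ℕ} (hmask : mask < 50)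
    (hw : s.r 13 = w) (hw1 : 1 < w) (hg : s.r mask = 2 ^ g - 1) (hA : s.r 50 < 2 ^ w) :
    (runBlock w S (readCode mask) s).r 52 = field w s.μ (s.r 50) g ∧
    (runBlock w S (readCode mask) s).μ = s.μ ∧
    ∀ i < 50, (runBlock w S (readCode mask) s).r i = s.r i := by
  refine ⟨?_, rfl, fun i hi => runBlock_frame _ _ _ _ _ ?_⟩
  · simp only [runBlock, readCode, Instr.natExec, BinOp.natEval, Function.update_apply,
      List.foldl_cons, List.foldl_nil, Nat.reduceEqDiff, if_true, if_false, hw,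
      show mask ≠ 53 by omega, show mask ≠ 54 by omega, show mask ≠ 55 by omega,
      show mask ≠ 56 by omega, show mask ≠ 57 by omega, show mask ≠ 58 by omega, hg]
    rw [Nat.mod_eq_of_lt (a := 1) (by have := Nat.lt_two_pow_self (n := w); omega),
      Nat.mod_eq_of_lt (wordIndex_lt hw1 hA), shiftComplement hw1]
    rfl
  · simp [readCode, Instr.dst]; omega

theorem runBlock_writeCode {w S : ℕ} {s : NatState} {mask g : ℕ} (hmask : mask < 50)
    (hw : s.r 13 = w) (hw1 : 1 < w) (hg : s.r mask = 2 ^ g - 1) (hA : s.r 50 < 2 ^ w)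
    (hS : s.r 50 / w + 1 < S) :
    (runBlock w S (writeCode mask) s).μ = setField w s.μ (s.r 50) g (s.r 59) ∧
    ∀ i < 50, (runBlock w S (writeCode mask) s).r i = s.r i := by
  refine ⟨?_, fun i hi => runBlock_frame _ _ _ _ _ ?_⟩
  · simp only [runBlock, writeCode, Instr.natExec, BinOp.natEval, Function.update_apply,
      List.foldl_cons, List.foldl_nil, Nat.reduceEqDiff, if_true, if_false, hw,
      show mask ≠ 53 by omega, show mask ≠ 54 by omega, show mask ≠ 55 by omega,
      show mask ≠ 56 by omega, show mask ≠ 57 by omega, show mask ≠ 58 by omega, hg]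
    rw [Nat.mod_eq_of_lt (a := 1) (by have := Nat.lt_two_pow_self (n := w); omega),
      Nat.mod_eq_of_lt (wordIndex_lt hw1 hA), shiftComplement hw1]
    funext i
    unfold setField patch
    by_cases h1 : i = s.r 50 / w + 1
    · simp [h1, hS]
    · by_cases h2 : i = s.r 50 / w
      · simp [h2, show s.r 50 / w < S by omega]
      · simp [h1, h2]
  · simp [writeCode, Instr.dst]; omega

/-! ### The lowest set bit of a word -/

theorem testBit_sum_shift {g c : ℕ} (hc : c < 2 ^ g) (k q : ℕ) :
    (∑ j ∈ Finset.range k, 2 ^ (g * j) * c).testBit q =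
      (decide (q / g < k) && c.testBit (q % g)) := by
  have hlt : ∀ k, ∑ j ∈ Finset.range k, 2 ^ (g * j) * c < 2 ^ (g * k) := by
    intro k
    induction k with
    | zero => simp
    | succ k ih =>
      rw [Finset.sum_range_succ, Nat.mul_succ, pow_add]
      have : 2 ^ (g * k) * (c + 1) ≤ 2 ^ (g * k) * 2 ^ g := Nat.mul_le_mul_left _ hc
      rw [Nat.mul_succ] at this
      omega
  induction k with
  | zero => simp
  | succ k ih =>
    rw [Finset.sum_range_succ, add_comm, Nat.testBit_two_pow_mul_add _ (hlt k), ih]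
    rcases Nat.eq_zero_or_pos g with rfl | hg
    · obtain rfl : c = 0 := by simpa using hc
      simp
    by_cases h : q < g * k
    · have : q / g < k := Nat.div_lt_of_lt_mul h
      simp [h, this, Nat.lt_succ_of_lt this]
    · rw [if_neg h]
      have hk : k ≤ q / g := (Nat.le_div_iff_mul_le hg).2 (by rw [mul_comm]; omega)
      by_cases hk' : q / g = k
      · have : q - g * k = q % g := by
          have := Nat.div_add_mod q g
          rw [hk'] at this; omega
        simp [hk', this]
      · have h1 : g * (k + 1) ≤ q := by
          rw [mul_comm]; exact (Nat.le_div_iff_mul_le hg).1 (by omega)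
        rw [Nat.mul_succ] at h1
        rw [Nat.testBit_lt_two_pow
          (lt_of_lt_of_le hc (Nat.pow_le_pow_right two_pos (show g ≤ q - g * k by omega)))]
        simp; omega

theorem sum_shift_eq_div {g : ℕ} (hg : 0 < g) (k : ℕ) :
    ∑ j ∈ Finset.range k, 2 ^ (g * j) * 1 = (2 ^ (g * k) - 1) / (2 ^ g - 1) := by
  have h1 : 2 ≤ 2 ^ g := Nat.pow_le_pow_right two_pos (show 1 ≤ g from hg) |>.trans' (by simp)
  have := Nat.geomSum_eq h1 k
  simp only [mul_one, pow_mul]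
  exact this

/-- Multiplying by `R` makes `f` copies of the `f`-bit number `2 ^ i - 1`, at distance `f`; the mask
keeps the `j`-th bit of the `j`-th copy. Hence `i` ones at distance `f + 1` remain, which are counted
by the remainder modulo `2 ^ (f + 1) - 1`. -/
theorem ones_count {f i : ℕ} (hf : 0 < f) (hi : i ≤ f) :
    (((2 ^ i - 1) * ((2 ^ (f * f) - 1) / (2 ^ f - 1))) &&&
      ((2 ^ ((f + 1) * f) - 1) / (2 ^ (f + 1) - 1))) % (2 ^ (f + 1) - 1) = i := by
  rw [← sum_shift_eq_div hf, ← sum_shift_eq_div (Nat.succ_pos f)]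
  have hlt : 2 ^ i - 1 < 2 ^ f := by
    have := Nat.pow_le_pow_right two_pos hi
    have := Nat.two_pow_pos i
    omega
  have h1 : (2 ^ i - 1) * ∑ j ∈ Finset.range f, 2 ^ (f * j) * 1
      = ∑ j ∈ Finset.range f, 2 ^ (f * j) * (2 ^ i - 1) := by
    rw [Finset.mul_sum]; refine Finset.sum_congr rfl fun j _ => by ring
  have h2 : (∑ j ∈ Finset.range f, 2 ^ (f * j) * (2 ^ i - 1)) &&&
      (∑ j ∈ Finset.range f, 2 ^ ((f + 1) * j) * 1) = ∑ j ∈ Finset.range i, 2 ^ ((f + 1) * j) * 1 := by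
    refine Nat.eq_of_testBit_eq fun q => ?_
    rw [Nat.testBit_and, testBit_sum_shift hlt, testBit_sum_shift (Nat.one_lt_two_pow (by omega)),
      testBit_sum_shift (Nat.one_lt_two_pow (by omega)), Nat.testBit_two_pow_sub_one]
    by_cases hq : q % (f + 1) = 0
    · obtain ⟨j, rfl⟩ := Nat.dvd_of_mod_eq_zero hq
      rw [Nat.mul_div_cancel_left _ (Nat.succ_pos f)]
      by_cases hj : j < f
      · have e1 : (f + 1) * j / f = j := by
          rw [show (f + 1) * j = f * j + j by ring, Nat.mul_add_div hf, Nat.div_eq_of_lt hj, add_zero]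
        have e2 : (f + 1) * j % f = j := by
          rw [show (f + 1) * j = f * j + j by ring, Nat.mul_add_mod, Nat.mod_eq_of_lt hj]
        simp [e1, e2, hj]
      · have : ¬ j < i := by omega
        simp [hj, this]
    · have : Nat.testBit 1 (q % (f + 1)) = false := by
        rw [← Nat.pow_zero 2, Nat.testBit_two_pow_of_ne (Ne.symm hq)]
      simp [this]
  rw [h1, h2]
  have h3 : ∀ k, (∑ j ∈ Finset.range k, 2 ^ ((f + 1) * j) * 1) ≡ k [MOD 2 ^ (f + 1) - 1] := by
    intro k
    induction k with
    | zero => simp [Nat.ModEq]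
    | succ k ih =>
      rw [Finset.sum_range_succ]
      refine ih.add ?_
      rw [mul_one, pow_mul]
      have h4 : 2 ^ (f + 1) ≡ 1 [MOD 2 ^ (f + 1) - 1] := by
        refine ((Nat.modEq_iff_dvd' Nat.one_le_two_pow).2 (dvd_refl _)).symm
      simpa using h4.pow k
  have h5 := h3 i
  rw [Nat.ModEq] at h5
  rw [h5, Nat.mod_eq_of_lt]
  have h6 : f < 2 ^ f := Nat.lt_two_pow_self
  rw [pow_succ]
  omega

/-- The position of the lowest set bit of `z ≠ 0`. -/
theorem xor_pred {z : ℕ} (hz : z ≠ 0) :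
    ∃ i, z.testBit i = true ∧ (∀ j < i, z.testBit j = false) ∧ z ^^^ (z - 1) = 2 ^ (i + 1) - 1 := by
  obtain ⟨i, q, hq, rfl⟩ := Nat.exists_eq_two_pow_mul_odd hz
  obtain ⟨r, rfl⟩ := hq
  have hp := Nat.two_pow_pos i
  have e1 : 2 ^ i * (2 * r + 1) = 2 ^ (i + 1) * r + 2 ^ i := by ring
  have e2 : 2 ^ i * (2 * r + 1) - 1 = 2 ^ (i + 1) * r + (2 ^ i - 1) := by rw [e1]; omega
  have hl : 2 ^ i < 2 ^ (i + 1) := by rw [pow_succ]; omega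
  refine ⟨i, ?_, fun j hj => ?_, Nat.eq_of_testBit_eq fun j => ?_⟩
  · rw [e1, Nat.testBit_two_pow_mul_add _ hl]; simp
  · rw [e1, Nat.testBit_two_pow_mul_add _ hl, if_pos (by omega),
      Nat.testBit_two_pow_of_ne (by omega)]
  · rw [Nat.testBit_xor, e2, e1, Nat.testBit_two_pow_mul_add _ hl,
      Nat.testBit_two_pow_mul_add _ (by omega), Nat.testBit_two_pow_sub_one,
      Nat.testBit_two_pow_sub_one]
    by_cases h : j < i + 1
    · by_cases h2 : j = i
      · subst h2; simp
      · rw [if_pos h, if_pos h, Nat.testBit_two_pow_of_ne (by omega)]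
        simp [h, show j < i by omega]
    · simp [h]

/-- Code that puts into register `60` one plus the position of the lowest set bit of register `52`;
the constants of `ones_count` are in the registers `22`, `23`, `24`. -/
def lowCode : List Instr :=
  [.const 56 1, .op .sub 57 52 56, .op .xor 57 52 57, .op .mul 57 57 22, .op .and 57 57 23,
    .op .mod 60 57 24]

theorem runBlock_lowCode {w S f : ℕ} {s : NatState} (hf : 0 < f) (hw : f * f < w)
    (hz : s.r 52 ≠ 0) (hzf : s.r 52 < 2 ^ f)
    (hR : s.r 22 = (2 ^ (f * f) - 1) / (2 ^ f - 1))
    (hM : s.r 23 = (2 ^ ((f + 1) * f) - 1) / (2 ^ (f + 1) - 1)) (hB : s.r 24 = 2 ^ (f + 1) - 1) :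
    (∃ i < f, (s.r 52).testBit i = true ∧ (∀ j < i, (s.r 52).testBit j = false) ∧
      (runBlock w S lowCode s).r 60 = i + 1) ∧
    (runBlock w S lowCode s).μ = s.μ ∧
    ∀ i < 50, (runBlock w S lowCode s).r i = s.r i := by
  refine ⟨?_, rfl, fun i hi => runBlock_frame _ _ _ _ _ ?_⟩
  · obtain ⟨i, hi1, hi2, hi3⟩ := xor_pred hz
    have hif : i < f := by
      by_contra h
      rw [Nat.testBit_lt_two_pow
        (lt_of_lt_of_le hzf (Nat.pow_le_pow_right two_pos (not_lt.1 h)))] at hi1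
      exact absurd hi1 (by simp)
    refine ⟨i, hif, hi1, hi2, ?_⟩
    have hfw : f < w := lt_of_le_of_lt (Nat.le_mul_self f) hw
    have h2w : 2 ^ f < 2 ^ w := Nat.pow_lt_pow_right one_lt_two hfw
    have h1 : (2 ^ w - 1 % 2 ^ w + s.r 52) % 2 ^ w = s.r 52 - 1 := by
      rw [Nat.mod_eq_of_lt (a := 1) (by omega)]
      have : 2 ^ w - 1 + s.r 52 = 2 ^ w + (s.r 52 - 1) := by omega
      rw [this, Nat.add_mod_left, Nat.mod_eq_of_lt (by omega)]
    have h2 : (2 ^ (i + 1) - 1) * ((2 ^ (f * f) - 1) / (2 ^ f - 1)) < 2 ^ w := by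
      have h3 : 2 ^ (i + 1) ≤ 2 ^ f := Nat.pow_le_pow_right two_pos hif
      calc _ ≤ (2 ^ f - 1) * ((2 ^ (f * f) - 1) / (2 ^ f - 1)) := Nat.mul_le_mul_right _ (by omega)
        _ ≤ 2 ^ (f * f) - 1 := Nat.mul_div_le _ _
        _ < 2 ^ w := by
          have := Nat.pow_lt_pow_right one_lt_two hw
          omega
    simp only [runBlock, lowCode, Instr.natExec, BinOp.natEval, Function.update_apply,
      List.foldl_cons, List.foldl_nil, Nat.reduceEqDiff, if_true, if_false, h1, hi3, hR, hM, hB]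
    rw [Nat.mod_eq_of_lt h2]
    exact ones_count hf hif
  · simp [lowCode, Instr.dst]; omega

end WordRAM

/-! ### A heap-shaped search tree over a circle of slots -/

namespace OffsetTable

/-- The shape of the search tree: an `f`-ary heap with `N` inner nodes and `M` leaves. The nodes are
numbered as in a heap, and the node `c + 1` is denoted by `c`, so that the root has no
name, the children of `c` are the numbers from `f * (c + 1)` to `f * (c + 1) + f - 1`, and the leaves
are the numbers from `N - 1` to `N + M - 2`. The leaf `c` stands for the slot `c + 1 - N`. -/
structure Shape (f N M : ℕ) : Prop where
  four_le : 4 ≤ f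
  one_le : 1 ≤ N
  two_le : 2 ≤ M
  le_mul : N + M - 1 ≤ f * N
  mul_lt : f * (N - 1) < N + M - 1

/-- The slot of the leftmost leaf below a node. -/
def first (f N c : ℕ) : ℕ := if h : c + 1 < N ∧ 0 < f then first f N (f * (c + 1)) else c + 1 - N
termination_by N - c
decreasing_by
  have : c + 1 ≤ f * (c + 1) := Nat.le_mul_of_pos_left _ h.2
  omega

/-- The number of leaves below a node; `E` is the number of all nodes except the root. -/
def cnt (f N E c : ℕ) : ℕ :=
  if h : c + 1 < N ∧ 0 < f then
    ∑ i ∈ Finset.range f, if f * (c + 1) + i < E then cnt f N E (f * (c + 1) + i) else 0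
  else 1
termination_by N - c
decreasing_by
  have : c + 1 ≤ f * (c + 1) := Nat.le_mul_of_pos_left _ h.2
  omega

theorem first_inner {f N c : ℕ} (hf : 0 < f) (hc : c + 1 < N) :
    first f N c = first f N (f * (c + 1)) := by
  rw [first, dif_pos ⟨hc, hf⟩]

theorem first_leaf {f N c : ℕ} (hc : N ≤ c + 1) : first f N c = c + 1 - N := by
  rw [first, dif_neg (by omega)]

theorem cnt_inner {f N E c : ℕ} (hf : 0 < f) (hc : c + 1 < N) :
    cnt f N E c = ∑ x ∈ Finset.Ico (f * (c + 1)) (min (f * (c + 1) + f) E), cnt f N E x := by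
  rw [cnt, dif_pos ⟨hc, hf⟩, ← Finset.sum_filter]
  refine Finset.sum_bij' (fun i _ => f * (c + 1) + i) (fun x _ => x - f * (c + 1)) ?_ ?_ ?_ ?_ ?_
  · intro i hi; simp at hi ⊢; omega
  · intro x hx; simp at hx ⊢; omega
  · intro i hi; simp
  · intro x hx; simp at hx ⊢; omega
  · intro i hi; rfl

theorem cnt_leaf {f N E c : ℕ} (hc : N ≤ c + 1) : cnt f N E c = 1 := by
  rw [cnt, dif_neg (by omega)]

namespace Shape

variable {f N M : ℕ}

theorem child_lt (H : Shape f N M) {c : ℕ} (hc : c < N) : f * c < N + M - 1 :=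
  lt_of_le_of_lt (Nat.mul_le_mul_left f (by omega)) H.mul_lt

theorem div_lt (H : Shape f N M) {c : ℕ} (hc : c < N + M - 1) : c / f < N :=
  Nat.div_lt_of_lt_mul (lt_of_lt_of_le hc H.le_mul)

/-- In the order of the circle, the node that comes after the children of a node is
followed by the same leaves as the next node of the heap. -/
theorem first_next (H : Shape f N M) {i : ℕ} (hi : i < N) :
    first f N i ≡ first f N (min (f * i + f) (N + M - 1)) [MOD M] := by
  have hf := H.four_le
  have hM := H.two_le
  by_cases h : i + 1 < N
  · have h1 := H.child_lt h
    rw [first_inner (by omega) h, min_eq_left (by rw [Nat.mul_succ] at h1; omega), Nat.mul_succ]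
  · obtain rfl : N = i + 1 := by omega
    have h1 := H.le_mul
    rw [Nat.mul_succ] at h1
    rw [min_eq_right h1, first_leaf le_rfl, first_leaf (by omega)]
    have : i + 1 + M - 1 + 1 - (i + 1) = M := by omega
    rw [this, Nat.sub_self]
    simp [Nat.ModEq]

theorem first_add_sum {a : ℕ}
    (h : ∀ x, a ≤ x → x < N + M - 1 →
      first f N x + cnt f N (N + M - 1) x ≡ first f N (x + 1) [MOD M]) :
    ∀ e, a ≤ e → e ≤ N + M - 1 →
      first f N a + ∑ x ∈ Finset.Ico a e, cnt f N (N + M - 1) x ≡ first f N e [MOD M] := by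
  intro e hae
  induction e, hae using Nat.le_induction with
  | base => intro _; simp [Nat.ModEq]
  | succ e hae ih =>
    intro he
    rw [Finset.sum_Ico_succ_top hae, ← add_assoc]
    exact ((ih (by omega)).add_right _).trans (h e hae (by omega))

theorem first_add_cnt (H : Shape f N M) (c : ℕ) (hc : c < N + M - 1) :
    first f N c + cnt f N (N + M - 1) c ≡ first f N (c + 1) [MOD M] := by
  induction hk : N + M - c using Nat.strong_induction_on generalizing c with
  | _ k ih =>
    have hf := H.four_le
    by_cases h : c + 1 < N
    · have h1 : c + 1 ≤ f * (c + 1) := Nat.le_mul_of_pos_left _ (by omega)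
      have h2 := H.child_lt h
      rw [first_inner (by omega) h, cnt_inner (by omega) h]
      refine (first_add_sum (fun x hx hx' => ih _ ?_ x hx' rfl) _ ?_ (min_le_right _ _)).trans
        (H.first_next h).symm
      · omega
      · exact le_min (by omega) h2.le
    · rw [first_leaf (by omega), first_leaf (by omega), cnt_leaf (by omega)]
      have : c + 1 - N + 1 = c + 1 + 1 - N := by omega
      rw [this]

/-- Some leaf below the node stands for a slot with the property `F`. -/
def Has (f N M : ℕ) (F : ℕ → Prop) (c : ℕ) : Prop :=
  ∃ r < cnt f N (N + M - 1) c, F ((first f N c + r) % M)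

theorem exists_Ico (H : Shape f N M) (F : ℕ → Prop) {a e : ℕ} (hae : a ≤ e) (he : e ≤ N + M - 1) :
    (∃ r < ∑ x ∈ Finset.Ico a e, cnt f N (N + M - 1) x, F ((first f N a + r) % M)) ↔
      ∃ x, a ≤ x ∧ x < e ∧ Has f N M F x := by
  induction e, hae using Nat.le_induction with
  | base => simp; intro x h1 h2; omega
  | succ e hae ih =>
    have ih := ih (by omega)
    have hs := first_add_sum (fun x _ => H.first_add_cnt x) e hae (by omega)
    rw [Finset.sum_Ico_succ_top hae]
    set s := ∑ x ∈ Finset.Ico a e, cnt f N (N + M - 1) x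
    have key : ∀ r, (first f N a + (s + r)) % M = (first f N e + r) % M := fun r => by
      rw [← add_assoc]; exact hs.add_right r
    constructor
    · rintro ⟨r, hr, hF⟩
      by_cases hrs : r < s
      · obtain ⟨x, h1, h2, h3⟩ := ih.1 ⟨r, hrs, hF⟩
        exact ⟨x, h1, by omega, h3⟩
      · refine ⟨e, hae, by omega, r - s, by omega, ?_⟩
        rw [← key, Nat.add_sub_cancel' (not_lt.1 hrs)]
        exact hF
    · rintro ⟨x, h1, h2, h3⟩
      by_cases hx : x < e
      · obtain ⟨r, hr, hF⟩ := ih.2 ⟨x, h1, hx, h3⟩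
        exact ⟨r, by omega, hF⟩
      · obtain rfl : x = e := by omega
        obtain ⟨r, hr, hF⟩ := h3
        exact ⟨s + r, by omega, by rw [key]; exact hF⟩

theorem has_inner (H : Shape f N M) (F : ℕ → Prop) {c : ℕ} (hc : c + 1 < N) :
    Has f N M F c ↔
      ∃ x, f * (c + 1) ≤ x ∧ x < f * (c + 1) + f ∧ x < N + M - 1 ∧ Has f N M F x := by
  have hf := H.four_le
  have h2 := H.child_lt hc
  have := H.exists_Ico F (a := f * (c + 1)) (e := min (f * (c + 1) + f) (N + M - 1))
    (le_min (by omega) h2.le) (min_le_right _ _)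
  rw [← cnt_inner (by omega) hc, ← first_inner (by omega) hc] at this
  unfold Has at this ⊢
  rw [this]
  simp only [lt_min_iff, and_assoc]

theorem has_leaf (F : ℕ → Prop) {c : ℕ} (hc : N ≤ c + 1)
    (hc' : c < N + M - 1) : Has f N M F c ↔ F (c + 1 - N) := by
  unfold Has
  rw [cnt_leaf hc, first_leaf hc]
  simp [Nat.mod_eq_of_lt (show c + 1 - N < M by omega)]

theorem has_parent (H : Shape f N M) {F : ℕ → Prop} {x : ℕ} (hx : x < N + M - 1) (hfx : f ≤ x)
    (h : Has f N M F x) : Has f N M F (x / f - 1) := by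
  have hf := H.four_le
  have h1 : 1 ≤ x / f := (Nat.one_le_div_iff (by omega)).2 hfx
  have h2 := H.div_lt hx
  have h3 := Nat.div_add_mod x f
  have h4 := Nat.mod_lt x (show 0 < f by omega)
  rw [H.has_inner F (by omega), show x / f - 1 + 1 = x / f by omega]
  exact ⟨x, by omega, by omega, hx, h⟩

/-- If some slot has the property `F`, then some child of the root has such a leaf. -/
theorem exists_root (H : Shape f N M) {F : ℕ → Prop} (x : ℕ) (hx : x < N + M - 1)
    (h : Has f N M F x) : ∃ y < f, y < N + M - 1 ∧ Has f N M F y := by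
  induction x using Nat.strong_induction_on with
  | _ x ih =>
    by_cases hfx : f ≤ x
    · have h5 : x / f ≤ x := Nat.div_le_self x f
      exact ih (x / f - 1) (by have := H.four_le; omega) (by omega) (H.has_parent hx hfx h)
    · exact ⟨x, by omega, hx, h⟩

theorem exists_root_of_slot (H : Shape f N M) {F : ℕ → Prop} {s : ℕ} (hs : s < M) (h : F s) :
    ∃ y < f, y < N + M - 1 ∧ Has f N M F y := by
  have := H.one_le
  refine H.exists_root (s + N - 1) (by omega) ((has_leaf F (by omega) (by omega)).2 ?_)
  rwa [show s + N - 1 + 1 - N = s by omega]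

theorem cnt_pos (H : Shape f N M) (c : ℕ) : 0 < cnt f N (N + M - 1) c := by
  induction hk : N - c using Nat.strong_induction_on generalizing c with
  | _ k ih =>
    have hf := H.four_le
    by_cases h : c + 1 < N
    · have h1 : c + 1 ≤ f * (c + 1) := Nat.le_mul_of_pos_left _ (by omega)
      have h2 := H.child_lt h
      rw [cnt_inner (by omega) h]
      exact lt_of_lt_of_le (ih (N - f * (c + 1)) (by omega) (f * (c + 1)) rfl)
        (Finset.single_le_sum (f := cnt f N (N + M - 1)) (fun _ _ => Nat.zero_le _)
          (by simp; omega))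
    · rw [cnt_leaf (by omega)]; exact one_pos

theorem pow_le_cnt (H : Shape f N M) (k : ℕ) :
    ∀ y, f ^ k * (y + 3) ≤ N + M - 1 → f ^ k ≤ cnt f N (N + M - 1) y := by
  have hf := H.four_le
  induction k with
  | zero => intro y _; rw [pow_zero]; exact H.cnt_pos y
  | succ k ih =>
    intro y hy
    have hfk : 0 < f ^ k := Nat.pow_pos (by omega)
    have e : f ^ (k + 1) * (y + 3) = f ^ k * (f * y + 3 * f) := by ring
    have h1 : f * y + 3 * f ≤ N + M - 1 := (Nat.le_mul_of_pos_left _ hfk).trans (e ▸ hy)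
    have h2 : y + 3 ≤ N := by
      refine le_of_mul_le_mul_left (a := f) ?_ (by omega)
      have := H.le_mul
      rw [Nat.mul_add]; omega
    rw [cnt_inner (by omega) (by omega), min_eq_left (by rw [Nat.mul_succ]; omega)]
    calc f ^ (k + 1) = ∑ x ∈ Finset.Ico (f * (y + 1)) (f * (y + 1) + f), f ^ k := by
          simp [pow_succ, mul_comm]
      _ ≤ _ := Finset.sum_le_sum fun x hx => ih x ?_
    simp only [Finset.mem_Ico, Nat.mul_add] at hx
    rw [e] at hy
    exact (Nat.mul_le_mul_left _ (by omega)).trans hy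

/-! #### Searching -/

/-- The state of a search for the first slot with the property `F` on the circle from `h` on: the
first `P` slots do not have it, and the leaves below `c` come next. -/
structure Search (f N M : ℕ) (F : ℕ → Prop) (h c P : ℕ) : Prop where
  lt : c < N + M - 1
  first_eq : first f N c ≡ h + P [MOD M]
  none : ∀ r < P, ¬ F ((h + r) % M)

theorem search_start (H : Shape f N M) (F : ℕ → Prop) {h : ℕ} (hh : h < M) :
    Search f N M F h (N + h - 1) 0 := by
  have := H.one_le
  refine ⟨by omega, ?_, by simp⟩
  rw [first_leaf (by omega), show N + h - 1 + 1 - N = h by omega]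
  rfl

theorem Search.advance (H : Shape f N M) {F : ℕ → Prop} {h c P e : ℕ}
    (hs : Search f N M F h c P) (hce : c ≤ e) (he : e ≤ N + M - 1)
    (hn : ∀ x, c ≤ x → x < e → ¬ Has f N M F x) :
    first f N e ≡ h + (P + ∑ x ∈ Finset.Ico c e, cnt f N (N + M - 1) x) [MOD M] ∧
    ∀ r < P + ∑ x ∈ Finset.Ico c e, cnt f N (N + M - 1) x, ¬ F ((h + r) % M) := by
  have h1 := first_add_sum (fun x _ => H.first_add_cnt x) e hce he
  refine ⟨?_, fun r hr hF => ?_⟩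
  · rw [← add_assoc]
    exact h1.symm.trans (hs.first_eq.add_right _)
  · by_cases hrP : r < P
    · exact hs.none r hrP hF
    · have h2 := H.exists_Ico F hce he
      obtain ⟨x, hx1, hx2, hx3⟩ := h2.1 ⟨r - P, by omega, by
        have : (first f N c + (r - P)) % M = (h + P + (r - P)) % M := hs.first_eq.add_right _
        rwa [this, add_assoc, Nat.add_sub_cancel' (not_lt.1 hrP)]⟩
      exact hn x hx1 hx2 hx3

theorem Search.up (H : Shape f N M) {F : ℕ → Prop} {h c P : ℕ} (hs : Search f N M F h c P)
    (hn : ∀ x, c ≤ x → x < c + f → x < N + M - 1 → ¬ Has f N M F x) :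
    ∃ P', Search f N M F h (c / f) P' := by
  have hf := H.four_le
  have h3 := Nat.div_add_mod c f
  have h4 := Nat.mod_lt c (show 0 < f by omega)
  have h5 := hs.lt
  have h6 := H.div_lt h5
  obtain ⟨h1, h2⟩ := hs.advance H (e := min (f * (c / f) + f) (N + M - 1))
    (le_min (by omega) h5.le) (min_le_right _ _)
    (fun x hx hx' => by
      rw [lt_min_iff] at hx'
      exact hn x hx (by omega) hx'.2)
  exact ⟨_, lt_of_le_of_lt (Nat.div_le_self _ _) h5, (H.first_next h6).trans h1, h2⟩

theorem Search.right (H : Shape f N M) {F : ℕ → Prop} {h c P i : ℕ} (hs : Search f N M F h c P)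
    (hi : c + i < N + M - 1) (hn : ∀ x, c ≤ x → x < c + i → ¬ Has f N M F x) :
    ∃ P', Search f N M F h (c + i) P' := by
  obtain ⟨h1, h2⟩ := hs.advance H (e := c + i) (by omega) hi.le hn
  exact ⟨_, hi, h1, h2⟩

theorem Search.down (H : Shape f N M) {F : ℕ → Prop} {h c P : ℕ} (hs : Search f N M F h c P)
    (hc : c + 1 < N) : Search f N M F h (f * (c + 1)) P :=
  ⟨H.child_lt hc, by rw [← first_inner (by have := H.four_le; omega) hc]; exact hs.first_eq, hs.none⟩

theorem Search.finish {F : ℕ → Prop} {h c P : ℕ} (hs : Search f N M F h c P)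
    (hc : N ≤ c + 1) (hF : Has f N M F c) : (h + P) % M = c + 1 - N ∧ F ((h + P) % M) := by
  have h1 : (h + P) % M = c + 1 - N := by
    have := hs.lt
    rw [← hs.first_eq, first_leaf hc, Nat.mod_eq_of_lt (by omega)]
  rw [h1]
  exact ⟨rfl, (has_leaf F hc hs.lt).1 hF⟩

/-- There is an arc of at least `l` slots that contains `h` and has no slot with the property
`F`. -/
def Arc (M : ℕ) (F : ℕ → Prop) (h l : ℕ) : Prop :=
  ∃ x u l', l ≤ l' ∧ u < l' ∧ (x + u) % M = h ∧ ∀ r < l', ¬ F ((x + r) % M)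

theorem Arc.anti {F : ℕ → Prop} {h l l' : ℕ} (ha : Arc M F h l) (hl : l' ≤ l) :
    Arc M F h l' := by
  obtain ⟨x, u, k, h1, h2⟩ := ha
  exact ⟨x, u, k, by omega, h2⟩

theorem Arc.mono {F F' : ℕ → Prop} {h l : ℕ} (ha : Arc M F h l) (hF : ∀ s, F' s → F s) :
    Arc M F' h l := by
  obtain ⟨x, u, k, h1, h2, h3, h4⟩ := ha
  exact ⟨x, u, k, h1, h2, h3, fun r hr h' => h4 r hr (hF _ h')⟩

/-- A long search ascends only over long arcs. -/
theorem Search.arc (H : Shape f N M) {F : ℕ → Prop} {h c P k : ℕ} (hh : h < M)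
    (hs : Search f N M F h c P) (hc : c = (N + h - 1) / f ^ (k + 1))
    (hn : ∀ x, c ≤ x → x < c + f → x < N + M - 1 → ¬ Has f N M F x)
    (hex : ∃ s < M, F s) : Arc M F h (f ^ k) := by
  have hf := H.four_le
  have hN := H.one_le
  have hc0 : 0 < c := by
    by_contra h0
    obtain ⟨s, hsM, hFs⟩ := hex
    obtain ⟨y, hy, hy', hy''⟩ := H.exists_root_of_slot hsM hFs
    exact hn y (by omega) (by omega) hy' hy''
  have h1 : f ^ k ≤ cnt f N (N + M - 1) c := by
    refine H.pow_le_cnt k c ?_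
    calc f ^ k * (c + 3) ≤ f ^ k * (f * c) := Nat.mul_le_mul_left _ (by nlinarith)
      _ = f ^ (k + 1) * c := by ring
      _ ≤ N + h - 1 := by rw [hc]; exact Nat.mul_div_le _ _
      _ ≤ N + M - 1 := by omega
  obtain ⟨_, h2⟩ := hs.advance H (e := c + 1) (by omega) hs.lt
    (fun x hx hx' => hn x hx (by omega) (by have := hs.lt; omega))
  simp only [Nat.Ico_succ_singleton, Finset.sum_singleton] at h2
  exact ⟨h, 0, P + cnt f N (N + M - 1) c, by omega, by have := H.cnt_pos c; omega,
    by simpa using Nat.mod_eq_of_lt hh, h2⟩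

/-! #### Updating -/

/-- The ancestors of a node (the node included, the root not). -/
inductive Anc (f : ℕ) : ℕ → ℕ → Prop
  | refl (c : ℕ) : Anc f c c
  | up {c x : ℕ} (hc : f ≤ c) (h : Anc f (c / f - 1) x) : Anc f c x

theorem Anc.le {c x : ℕ} (h : Anc f c x) : x ≤ c := by
  induction h with
  | refl => exact le_rfl
  | @up c x hc _ ih => exact ih.trans ((Nat.sub_le _ _).trans (Nat.div_le_self _ _))

theorem Anc.parent {c x : ℕ} (h : Anc f c x) (hx : f ≤ x) : Anc f c (x / f - 1) := by
  induction h with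
  | refl => exact .up hx (.refl _)
  | up hc _ ih => exact .up hc (ih hx)

theorem Anc.has (H : Shape f N M) {F : ℕ → Prop} {c x : ℕ} (h : Anc f c x) (hc : c < N + M - 1)
    (hF : Has f N M F c) : Has f N M F x := by
  induction h with
  | refl => exact hF
  | @up c x hfc _ ih =>
    have := Nat.div_le_self c f
    exact ih (by omega) (H.has_parent hc hfc hF)

theorem anc_of_has (H : Shape f N M) {s : ℕ} (x : ℕ) (hx : x < N + M - 1)
    (h : Has f N M (· = s) x) : Anc f (s + N - 1) x := by
  induction hk : N + M - x using Nat.strong_induction_on generalizing x with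
  | _ k ih =>
    have hf := H.four_le
    by_cases hc : x + 1 < N
    · obtain ⟨y, h1, h2, h3, h4⟩ := (H.has_inner _ hc).1 h
      have h5 : x + 1 ≤ f * (x + 1) := Nat.le_mul_of_pos_left _ (by omega)
      have h6 : y / f = x + 1 := by
        have : y = f * (x + 1) + (y - f * (x + 1)) := by omega
        rw [this, Nat.mul_add_div (by omega), Nat.div_eq_of_lt (by omega), add_zero]
      have h7 := (ih _ (by omega) y h3 h4 rfl).parent (by nlinarith)
      rwa [h6] at h7
    · have := (has_leaf _ (by omega) hx).1 h
      obtain rfl : x = s + N - 1 := by omega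
      exact .refl _

/-- The bits of the tree, when the slots with the property `F` are the free ones. -/
def Bits (f N M : ℕ) (F : ℕ → Prop) (b : ℕ → Bool) : Prop :=
  ∀ x, b x = true ↔ x < N + M - 1 ∧ Has f N M F x

/-- The bits while a slot is being occupied: those of the ancestors of `c` are still set. -/
def Pending (f N M : ℕ) (F : ℕ → Prop) (c : ℕ) (b : ℕ → Bool) : Prop :=
  ∀ x, b x = true ↔ x < N + M - 1 ∧ (Has f N M F x ∨ Anc f c x)

theorem Bits.pending (H : Shape f N M) {F F' : ℕ → Prop} {s : ℕ} {b : ℕ → Bool} (hs : s < M)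
    (hF : ∀ t, F t ↔ F' t ∨ t = s) (hb : Bits f N M F b) :
    Pending f N M F' (s + N - 1) b := by
  have hN := H.one_le
  intro x
  rw [hb x]
  refine and_congr_right fun hx => ?_
  constructor
  · rintro ⟨r, hr, h⟩
    rcases (hF _).1 h with h | h
    · exact Or.inl ⟨r, hr, h⟩
    · exact Or.inr (H.anc_of_has x hx ⟨r, hr, h⟩)
  · rintro (⟨r, hr, h⟩ | h)
    · exact ⟨r, hr, (hF _).2 (Or.inl h)⟩
    · refine h.has H (by omega) ((has_leaf F (by omega) (by omega)).2 ?_)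
      rw [show s + N - 1 + 1 - N = s by omega]
      exact (hF s).2 (Or.inr rfl)

/-- After the bit of a full node `c` is cleared, either its parent is full as well, and the
update continues with it, or all bits are correct. -/
theorem Pending.clear (H : Shape f N M) {F : ℕ → Prop} {c : ℕ} {b b' : ℕ → Bool}
    (hb : Pending f N M F c b) (hc : c < N + M - 1) (hfull : ¬ Has f N M F c)
    (hb' : ∀ x, b' x = if x = c then false else b x) (hex : ∃ s < M, F s) :
    ((∀ i < f, b' (f * (c / f) + i) = false) → f ≤ c ∧ ¬ Has f N M F (c / f - 1) ∧
      Pending f N M F (c / f - 1) b') ∧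
    ((∃ i < f, b' (f * (c / f) + i) = true) → Bits f N M F b') := by
  have hf := H.four_le
  have hdiv := Nat.div_add_mod c f
  have hmod := Nat.mod_lt c (show 0 < f by omega)
  have hcf := H.div_lt hc
  have hdc : f ≤ c → c / f - 1 < c := fun h => by have := Nat.div_le_self c f; omega
  have key : ∀ x, b' x = true ↔ x < N + M - 1 ∧
      (Has f N M F x ∨ (f ≤ c ∧ Anc f (c / f - 1) x)) := by
    intro x
    rw [hb']
    split_ifs with hx
    · subst hx
      simp only [false_iff, not_and, not_or]
      refine fun _ => ⟨hfull, fun hfx ha => ?_⟩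
      have := ha.le
      have := hdc hfx
      omega
    · rw [hb x]
      refine and_congr_right fun _ => or_congr_right ⟨fun h => ?_, fun h => .up h.1 h.2⟩
      cases h with
      | refl => exact absurd rfl hx
      | up h1 h2 => exact ⟨h1, h2⟩
  have hsib : ∀ i, b' (f * (c / f) + i) = true ↔
      f * (c / f) + i < N + M - 1 ∧ Has f N M F (f * (c / f) + i) := by
    intro i
    rw [key]
    refine and_congr_right fun _ => or_iff_left ?_
    rintro ⟨h1, h2⟩
    have h3 := h2.le
    have h4 : 1 ≤ c / f := (Nat.one_le_div_iff (by omega)).2 h1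
    have h5 : c / f ≤ f * (c / f) := Nat.le_mul_of_pos_left _ (by omega)
    omega
  constructor
  · intro h
    have hfc : f ≤ c := by
      by_contra hfc
      obtain ⟨s, hsM, hFs⟩ := hex
      obtain ⟨y, hy, hy', hy''⟩ := H.exists_root_of_slot hsM hFs
      have h0 : c / f = 0 := Nat.div_eq_of_lt (by omega)
      have h1 := h y hy
      have h2 := (hsib y).2
      simp only [h0, mul_zero, zero_add] at h1 h2
      rw [h2 ⟨hy', hy''⟩] at h1
      exact absurd h1 (by simp)
    have h1 : 1 ≤ c / f := (Nat.one_le_div_iff (by omega)).2 hfc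
    refine ⟨hfc, fun hp => ?_, fun x => ?_⟩
    · rw [H.has_inner F (by omega), show c / f - 1 + 1 = c / f by omega] at hp
      obtain ⟨x, h2, h3, h4, h5⟩ := hp
      have h6 := h (x - f * (c / f)) (by omega)
      have h7 := hsib (x - f * (c / f))
      rw [Nat.add_sub_cancel' h2] at h6 h7
      rw [h7.2 ⟨h4, h5⟩] at h6
      exact absurd h6 (by simp)
    · rw [key]; simp [hfc]
  · rintro ⟨i, hi, h⟩ x
    rw [hsib] at h
    rw [key]
    refine and_congr_right fun hx => or_iff_left_of_imp ?_
    rintro ⟨h1, h2⟩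
    have h4 : 1 ≤ c / f := (Nat.one_le_div_iff (by omega)).2 h1
    have h5 := H.has_parent h.1 (le_add_of_le_of_nonneg (Nat.le_mul_of_pos_right f h4) (by omega))
      h.2
    have h6 : (f * (c / f) + i) / f = c / f := by
      rw [Nat.mul_add_div (by omega), Nat.div_eq_of_lt hi, add_zero]
    rw [h6] at h5
    exact h2.has H (by omega) h5

/-- A full node at height `k` whose leaves contain the slot at which a search ended lies on a long
arc without free slots. -/
theorem arc_of_anc (H : Shape f N M) {F : ℕ → Prop} {h P c k : ℕ} (hh : h < M)
    (hfull : ¬ Has f N M F c) (hP : ∀ r ≤ P, ¬ F ((h + r) % M))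
    (hs : Has f N M (· = (h + P) % M) c)
    (hck : f ^ (k + 1) * (c + 1) ≤ N + M - 1) : Arc M F h (f ^ k) := by
  have hf := H.four_le
  have h1 : f ^ k ≤ cnt f N (N + M - 1) c := by
    refine H.pow_le_cnt k c (le_trans ?_ hck)
    rw [pow_succ, mul_assoc]
    exact Nat.mul_le_mul_left _ (by nlinarith)
  obtain ⟨r, hr, he⟩ := hs
  have hM := H.two_le
  by_cases hrP : P ≤ r
  · refine ⟨first f N c, r - P, cnt f N (N + M - 1) c, h1, by omega, ?_, fun i hi hF =>
      hfull ⟨i, hi, hF⟩⟩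
    have : (first f N c + (r - P)) + P ≡ h + P [MOD M] := by
      rw [add_assoc, Nat.sub_add_cancel hrP]; exact he
    have := Nat.ModEq.add_right_cancel' P this
    rw [this, Nat.mod_eq_of_lt hh]
  · refine ⟨h, 0, P + (cnt f N (N + M - 1) c - r), by omega, by omega,
      by simpa using Nat.mod_eq_of_lt hh, fun i hi hF => ?_⟩
    by_cases hiP : i ≤ P
    · exact hP i hiP hF
    · refine hfull ⟨r + (i - P), by omega, ?_⟩
      have : first f N c + r + (i - P) ≡ h + P + (i - P) [MOD M] := Nat.ModEq.add_right _ he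
      rw [← add_assoc, this, add_assoc, Nat.add_sub_cancel' (by omega)]
      exact hF

end Shape

end OffsetTable

/-! ### Linear probing -/

namespace OffsetTable

/-- The distance on the circle of `M` slots from `h` to the first slot outside of `O`. -/
noncomputable def disp (M h : ℕ) (O : Finset ℕ) : ℕ := sInf {p | (h + p) % M ∉ O}

/-- The occupied slots after the insertion of a list of keys (the last one first). -/
noncomputable def occ {κ : Type*} (M : ℕ) (home : κ → ℕ) : List κ → Finset ℕ
  | [] => ∅
  | k :: ks => insert ((home k + disp M (home k) (occ M home ks)) % M) (occ M home ks)

theorem disp_eq {M h P : ℕ} {O : Finset ℕ} (hP : (h + P) % M ∉ O)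
    (hlt : ∀ r < P, (h + r) % M ∈ O) : disp M h O = P :=
  le_antisymm (Nat.sInf_le hP) (le_csInf ⟨P, hP⟩ fun r hr => by
    by_contra h'
    exact hr (hlt r (by omega)))

theorem exists_shift {M : ℕ} (h s : ℕ) (hs : s < M) : ∃ p < M, (h + p) % M = s := by
  have hM : 0 < M := by omega
  refine ⟨(s + (M - h % M)) % M, Nat.mod_lt _ hM, ?_⟩
  have h1 := Nat.mod_lt h hM
  rw [Nat.add_mod_mod, ← Nat.mod_add_mod,
    show h % M + (s + (M - h % M)) = s + M by omega, Nat.add_mod_right, Nat.mod_eq_of_lt hs]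

theorem disp_spec {M h : ℕ} {O : Finset ℕ} (hO : ∃ s < M, s ∉ O) :
    disp M h O < M ∧ (h + disp M h O) % M ∉ O ∧ ∀ r < disp M h O, (h + r) % M ∈ O := by
  obtain ⟨s, hs, hsO⟩ := hO
  obtain ⟨p, hp, he⟩ := exists_shift h s hs
  have hmem : p ∈ {p | (h + p) % M ∉ O} := by simpa [he] using hsO
  refine ⟨lt_of_le_of_lt (Nat.sInf_le hmem) hp, Nat.sInf_mem ⟨p, hmem⟩, fun r hr => ?_⟩
  by_contra h'
  exact absurd (Nat.sInf_le (s := {p | (h + p) % M ∉ O}) h') (not_le.2 hr)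

variable {κ : Type*} {M : ℕ} {home : κ → ℕ}

theorem card_occ_le (ks : List κ) : (occ M home ks).card ≤ ks.length := by
  induction ks with
  | nil => simp [occ]
  | cons k ks ih => exact (Finset.card_insert_le _ _).trans (by simpa using ih)

theorem exists_free {ks : List κ} (hks : ks.length < M) : ∃ s < M, s ∉ occ M home ks := by
  by_contra! h
  have : Finset.range M ⊆ occ M home ks := fun s hs => h s (Finset.mem_range.1 hs)
  have := (Finset.card_le_card this).trans (card_occ_le ks)
  rw [Finset.card_range] at this
  omega

/-- Each occupied slot belongs to a key of its own, and all slots between the home of the key and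
its slot are occupied. -/
theorem exists_owner [Nonempty κ] {ks : List κ} (hnd : ks.Nodup) (hks : ks.length ≤ M) :
    ∃ g : ℕ → κ, Set.InjOn g (occ M home ks) ∧ ∀ s ∈ occ M home ks, g s ∈ ks ∧
      ∃ p, (home (g s) + p) % M = s ∧ ∀ r ≤ p, (home (g s) + r) % M ∈ occ M home ks := by
  classical
  induction ks with
  | nil => exact ⟨fun _ => Classical.arbitrary κ, by simp [occ], by simp [occ]⟩
  | cons k ks ih =>
    obtain ⟨hk, hnd⟩ := List.nodup_cons.1 hnd
    rw [List.length_cons] at hks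
    obtain ⟨g, hg, hp⟩ := ih hnd (by omega)
    obtain ⟨-, h2, h3⟩ := disp_spec (h := home k) (exists_free (home := home) (ks := ks) (M := M) hks)
    set O := occ M home ks
    set t := (home k + disp M (home k) O) % M with ht
    have hne : ∀ s ∈ O, s ≠ t := fun s hs he => h2 (he ▸ hs)
    refine ⟨Function.update g t k, ?_, ?_⟩
    · intro s hs s' hs' he
      rw [occ, Finset.coe_insert, Set.mem_insert_iff] at hs hs'
      rcases hs with rfl | hs <;> rcases hs' with rfl | hs'
      · rfl
      · rw [Function.update_self, Function.update_of_ne (hne _ hs')] at he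
        exact absurd (he ▸ (hp _ hs').1) hk
      · rw [Function.update_self, Function.update_of_ne (hne _ hs)] at he
        exact absurd (he ▸ (hp _ hs).1) hk
      · rw [Function.update_of_ne (hne _ hs), Function.update_of_ne (hne _ hs')] at he
        exact hg hs hs' he
    · intro s hs
      rw [occ, Finset.mem_insert] at hs
      rcases hs with rfl | hs
      · rw [Function.update_self]
        refine ⟨by simp, disp M (home k) O, ht.symm, fun r hr => ?_⟩
        rw [occ, Finset.mem_insert]
        rcases hr.lt_or_eq with hr | rfl
        · exact Or.inr (h3 r hr)
        · exact Or.inl rfl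
      · rw [Function.update_of_ne (hne _ hs)]
        obtain ⟨h4, p, h5, h6⟩ := hp s hs
        exact ⟨by simp [h4], p, h5, fun r hr => Finset.mem_insert_of_mem (h6 r hr)⟩

/-- A full arc extends to the left to a maximal one, and all keys in the latter have their homes in
it: thus some arc around `h`, not shorter than the given one, is the home of at least as many keys
as it has slots. -/
theorem Shape.Arc.overfull [Nonempty κ] [DecidableEq κ] {ks : List κ} (hnd : ks.Nodup)
    (hks : ks.length < M) {h l : ℕ} (hh : h < M) (harc : Shape.Arc M (· ∉ occ M home ks) h l) :
    ∃ u s, l ≤ s ∧ u < s ∧ s < M ∧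
      s ≤ (ks.toFinset.filter fun k => (home k + (M - h) + u) % M < s).card := by
  classical
  have hM : 0 < M := by omega
  set O := occ M home ks with hO
  obtain ⟨x', u, l', hl, hu, hxu, hfull⟩ := harc
  simp only [not_not] at hfull
  obtain ⟨x, hx, hxx⟩ : ∃ x < M, x ≡ x' [MOD M] := ⟨x' % M, Nat.mod_lt _ hM, Nat.mod_mod _ _⟩
  have hfull : ∀ r < l', (x + r) % M ∈ O := fun r hr => by
    have := hfull r hr
    rwa [← (hxx.add_right r : (x + r) % M = (x' + r) % M)] at this
  have hxu : (x + u) % M = h := by rw [← hxu]; exact hxx.add_right u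
  have hex : ∃ j, j < M ∧ (x + M - 1 - j) % M ∉ O := by
    obtain ⟨s, hs, hsO⟩ := exists_free (home := home) hks
    by_cases hsx : s < x
    · refine ⟨x - 1 - s, by omega, ?_⟩
      rw [show x + M - 1 - (x - 1 - s) = s + M by omega, Nat.add_mod_right, Nat.mod_eq_of_lt hs]
      exact hsO
    · refine ⟨x + M - 1 - s, by omega, ?_⟩
      rw [show x + M - 1 - (x + M - 1 - s) = s by omega, Nat.mod_eq_of_lt hs]
      exact hsO
  obtain ⟨hjM, hjO⟩ := Nat.find_spec hex
  have hjmin : ∀ i < Nat.find hex, (x + M - 1 - i) % M ∈ O := fun i hi => by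
    have := Nat.find_min hex hi
    rw [not_and, not_not] at this
    exact this (by omega)
  set j := Nat.find hex with hj
  set y := x + M - j with hy
  have hyfull : ∀ r < j + l', (y + r) % M ∈ O := by
    intro r hr
    by_cases hrj : r < j
    · have := hjmin (j - 1 - r) (by omega)
      rwa [show x + M - 1 - (j - 1 - r) = y + r by omega] at this
    · have := hfull (r - j) (by omega)
      rwa [show y + r = x + (r - j) + M by omega, Nat.add_mod_right]
  have hyfree : (y - 1) % M ∉ O := by rwa [show y - 1 = x + M - 1 - j by omega]
  have hlen : j + l' < M := by
    by_contra hlen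
    have := hyfull (M - 1) (by omega)
    rw [show y + (M - 1) = y - 1 + M by omega, Nat.add_mod_right] at this
    exact hyfree this
  refine ⟨j + u, j + l', by omega, by omega, hlen, ?_⟩
  obtain ⟨g, hg, hp⟩ := exists_owner (home := home) hnd hks.le
  have hinj : Set.InjOn (fun r => g ((y + r) % M)) (Finset.range (j + l')) := by
    intro r hr r' hr' he
    simp only [Finset.coe_range, Set.mem_Iio] at hr hr'
    have h1 : y + r ≡ y + r' [MOD M] := hg (hyfull r hr) (hyfull r' hr') he
    have h2 := Nat.ModEq.add_left_cancel' y h1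
    rwa [Nat.ModEq, Nat.mod_eq_of_lt (by omega), Nat.mod_eq_of_lt (by omega)] at h2
  have hcard := Finset.card_image_of_injOn hinj
  rw [Finset.card_range] at hcard
  refine hcard.symm.le.trans (Finset.card_le_card fun k hk => ?_)
  obtain ⟨r, hr, rfl⟩ := Finset.mem_image.1 hk
  rw [Finset.mem_range] at hr
  obtain ⟨h1, p, h2, h3⟩ := hp _ (hyfull r hr)
  set k := g ((y + r) % M)
  rw [Finset.mem_filter, List.mem_toFinset]
  refine ⟨h1, ?_⟩
  have hpr : p ≤ r := by
    by_contra hpr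
    apply hyfree
    have h4 : home k + (p - r - 1) + (r + 1) ≡ y - 1 + (r + 1) [MOD M] := by
      rw [show home k + (p - r - 1) + (r + 1) = home k + p by omega,
        show y - 1 + (r + 1) = y + r by omega]
      exact h2
    have h5 := Nat.ModEq.add_right_cancel' _ h4
    rw [← (h5 : _ % M = _ % M)]
    exact h3 _ (by omega)
  -- modulo `M`, the number `y + (j + u)` is `h`, and the home of `k` is `y + (r - p)`
  have h6 : home k + (M - h) + (j + u) ≡ r - p [MOD M] := by
    have h7 : home k ≡ y + (r - p) [MOD M] := by
      refine Nat.ModEq.add_right_cancel' p ?_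
      rw [show y + (r - p) + p = y + r by omega]
      exact h2
    have h8 : y + (j + u) ≡ h [MOD M] := by
      rw [show y + (j + u) = x + u + M by omega]
      rw [Nat.ModEq, Nat.add_mod_right, hxu, Nat.mod_eq_of_lt hh]
    calc home k + (M - h) + (j + u) ≡ y + (r - p) + (M - h) + (j + u) [MOD M] :=
          (h7.add_right _).add_right _
      _ = (y + (j + u)) + (r - p + (M - h)) := by ring
      _ ≡ h + (r - p + (M - h)) [MOD M] := h8.add_right _
      _ = r - p + M := by omega
      _ ≡ r - p [MOD M] := by simp [Nat.ModEq]
  rw [h6, Nat.mod_eq_of_lt (by omega)]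
  omega

end OffsetTable

/-! ### Probabilities of overfull arcs -/

namespace OffsetTable

/-- The probability of an event on a finite uniform probability space. -/
noncomputable def prob {Ω : Type*} [Fintype Ω] (p : Ω → Prop) : ℝ :=
  open scoped Classical in 𝔼 ω, if p ω then (1 : ℝ) else 0

section
variable {Ω : Type*} [Fintype Ω]

theorem prob_le_expect {p : Ω → Prop} {f : Ω → ℝ} (h0 : ∀ ω, 0 ≤ f ω) (h : ∀ ω, p ω → 1 ≤ f ω) :
    prob p ≤ 𝔼 ω, f ω := by
  classical
  refine Finset.expect_le_expect fun ω _ => ?_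
  split_ifs with hp
  · exact h ω hp
  · exact h0 ω

theorem prob_nonneg (p : Ω → Prop) : 0 ≤ prob p :=
  Finset.expect_nonneg fun ω _ => by split_ifs <;> norm_num

theorem prob_mono {p q : Ω → Prop} (h : ∀ ω, p ω → q ω) : prob p ≤ prob q := by
  classical
  refine prob_le_expect (fun ω => ?_) fun ω hp => ?_
  · split_ifs <;> norm_num
  · rw [if_pos (h ω hp)]

theorem prob_le_one (p : Ω → Prop) : prob p ≤ 1 := by
  classical
  rcases isEmpty_or_nonempty Ω with h | h
  · simp [prob]
  · refine (Finset.expect_le_expect (g := fun _ => (1 : ℝ)) fun ω _ => ?_).trans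
      (Finset.expect_const Finset.univ_nonempty 1).le
    split_ifs <;> norm_num

theorem prob_exists_le {ι : Type*} (s : Finset ι) (p : ι → Ω → Prop) :
    prob (fun ω => ∃ i ∈ s, p i ω) ≤ ∑ i ∈ s, prob (p i) := by
  classical
  unfold prob
  rw [← Finset.expect_sum_comm]
  refine prob_le_expect (fun ω => Finset.sum_nonneg fun i _ => by split_ifs <;> norm_num) ?_
  rintro ω ⟨i, hi, hp⟩
  refine le_trans ?_ (Finset.single_le_sum (f := fun i => if p i ω then (1 : ℝ) else 0)
    (fun j _ => by split_ifs <;> norm_num) hi)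
  simp [hp]

/-- Random functions whose values at any two, and at any three, distinct arguments are
independent and uniform on `{0, …, Q - 1}`. -/
structure Indep {κ : Type*} (T : Ω → κ → ℕ) (Q : ℕ) : Prop where
  pair : ∀ x y, x ≠ y → ∀ F : ℕ → ℕ → ℝ,
    𝔼 ω, F (T ω x) (T ω y) = 𝔼 a ∈ Finset.range Q, 𝔼 b ∈ Finset.range Q, F a b
  triple : ∀ x y z, x ≠ y → x ≠ z → y ≠ z → ∀ F : ℕ → ℕ → ℕ → ℝ,
    𝔼 ω, F (T ω x) (T ω y) (T ω z) =
      𝔼 a ∈ Finset.range Q, 𝔼 b ∈ Finset.range Q, 𝔼 c ∈ Finset.range Q, F a b c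

theorem card_mod_lt_le {M Q e s : ℕ} :
    ((Finset.range Q).filter fun b => (b % M + e) % M < s).card ≤ s * (Q / M + 1) := by
  rw [← Finset.card_range s, ← Finset.card_range (Q / M + 1), ← Finset.card_product,
    Finset.card_range]
  refine Finset.card_le_card_of_injOn (fun b => ((b % M + e) % M, b / M)) ?_ ?_
  · intro b hb
    simp only [Finset.coe_filter, Finset.mem_range, Set.mem_ofPred_eq] at hb
    simp only [Finset.coe_product, Finset.coe_range, Set.mem_prod, Set.mem_Iio]
    exact ⟨hb.2, Nat.lt_succ_of_le (Nat.div_le_div_right hb.1.le)⟩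
  · intro b _ b' _ h
    simp only [Prod.mk.injEq] at h
    have h1 : b % M ≡ b' % M [MOD M] := Nat.ModEq.add_right_cancel' e h.1
    rw [Nat.ModEq, Nat.mod_mod, Nat.mod_mod] at h1
    rw [← Nat.div_add_mod b M, ← Nat.div_add_mod b' M, h1, h.2]

/-- The number of the keys of `A` whose home lies on the arc of `s` slots that begins `u` slots
before the home of `k`. -/
def arcCount {κ : Type*} (M : ℕ) (home : κ → ℕ) (k : κ) (A : Finset κ) (u s : ℕ) : ℕ :=
  (A.filter fun x => (home x + (M - home k) + u) % M < s).card

/-- Chebyshev's inequality for the number of homes on an arc around the home of `k`. -/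
theorem Indep.chebyshev {κ : Type*} [DecidableEq κ] {T : Ω → κ → ℕ} {Q M : ℕ} (hT : Indep T Q)
    (hM : 0 < M) (hQ : 0 < Q) {k : κ} {A : Finset κ} (hk : k ∉ A) (u s : ℕ) {r : ℝ}
    (hr : A.card * (s * (1 / M + 1 / Q) : ℝ) < r) :
    prob (fun ω => r ≤ arcCount M (fun x => T ω x % M) k A u s) ≤
      A.card * (s * (1 / M + 1 / Q)) / (r - A.card * (s * (1 / M + 1 / Q))) ^ 2 := by
  classical
  set q' : ℝ := s * (1 / M + 1 / Q) with hq'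
  set W : ℕ → ℕ → ℝ := fun a b => if (b % M + (M - a % M) + u) % M < s then 1 else 0 with hW
  set q : ℕ → ℝ := fun a => 𝔼 b ∈ Finset.range Q, W a b with hq
  have hW2 : ∀ a b, W a b ^ 2 = W a b := fun a b => by simp only [hW]; split_ifs <;> norm_num
  have hne : (Finset.range Q).Nonempty := ⟨0, by simpa using hQ⟩
  have hMr : (0 : ℝ) < M := by exact_mod_cast hM
  have hQr : (0 : ℝ) < Q := by exact_mod_cast hQ
  have hqle : ∀ a, q a ≤ q' := by
    intro a
    have h1 := card_mod_lt_le (M := M) (Q := Q) (e := M - a % M + u) (s := s)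
    simp only [← add_assoc] at h1
    have h2 : ((Q / M : ℕ) : ℝ) ≤ Q / M := Nat.cast_div_le
    simp only [hq, hW, Finset.expect_eq_sum_div_card, Finset.card_range]
    rw [div_le_iff₀ hQr, Finset.sum_boole]
    calc _ ≤ ((s * (Q / M + 1) : ℕ) : ℝ) := by exact_mod_cast h1
      _ ≤ s * (Q / M + 1) := by push_cast; gcongr
      _ = q' * Q := by rw [hq']; field_simp
  have hqnn : ∀ a, 0 ≤ q a := fun a => Finset.expect_nonneg fun b _ => by
    simp only [hW]; split_ifs <;> norm_num
  have hq'nn : 0 ≤ q' := (hqnn 0).trans (hqle 0)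
  have hvar : 𝔼 ω, (∑ x ∈ A, (W (T ω k) (T ω x) - q (T ω k))) ^ 2 ≤ A.card * q' := by
    simp only [sq, Finset.sum_mul_sum]
    rw [Finset.expect_sum_comm]
    simp only [Finset.expect_sum_comm]
    have hrow : ∀ x ∈ A, ∑ y ∈ A, 𝔼 ω, (W (T ω k) (T ω x) - q (T ω k)) *
        (W (T ω k) (T ω y) - q (T ω k)) ≤ q' := by
      intro x hx
      have hkx : k ≠ x := fun h => hk (h ▸ hx)
      rw [Finset.sum_eq_single_of_mem x hx]
      · rw [hT.pair k x hkx fun a b => (W a b - q a) * (W a b - q a)]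
        refine Finset.expect_le hne fun a _ => ?_
        have h1 : ∀ b, (W a b - q a) * (W a b - q a) = (1 - 2 * q a) * W a b + q a * q a :=
          fun b => by linear_combination hW2 a b
        simp only [h1]
        rw [Finset.expect_add_distrib, ← Finset.mul_expect, Finset.expect_const hne]
        have h2 : 𝔼 b ∈ Finset.range Q, W a b = q a := rfl
        rw [h2]
        nlinarith [hqle a, hqnn a]
      · intro y hy hyx
        have hky : k ≠ y := fun h => hk (h ▸ hy)
        rw [hT.triple k x y hkx hky hyx.symm fun a b c => (W a b - q a) * (W a c - q a)]
        refine Finset.expect_eq_zero fun a _ => ?_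
        have h1 : 𝔼 c ∈ Finset.range Q, (W a c - q a) = 0 := by
          rw [Finset.expect_sub_distrib, Finset.expect_const hne]
          exact sub_self _
        refine Finset.expect_eq_zero fun b _ => ?_
        rw [← Finset.mul_expect, h1, mul_zero]
    calc _ ≤ ∑ x ∈ A, q' := Finset.sum_le_sum hrow
      _ = A.card * q' := by simp
  have hD : 0 < r - A.card * q' := by linarith
  refine (prob_le_expect (f := fun ω => (∑ x ∈ A, (W (T ω k) (T ω x) - q (T ω k))) ^ 2 /
    (r - A.card * q') ^ 2) (fun ω => by positivity) fun ω hω => ?_).trans ?_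
  · rw [one_le_div (by positivity)]
    refine pow_le_pow_left₀ hD.le ?_ 2
    have h1 : ∑ x ∈ A, W (T ω k) (T ω x) = arcCount M (fun x => T ω x % M) k A u s := by
      simp only [hW, arcCount, Finset.sum_boole]
    rw [Finset.sum_sub_distrib, h1, Finset.sum_const, nsmul_eq_mul]
    have := mul_le_mul_of_nonneg_left (hqle (T ω k)) (Nat.cast_nonneg (α := ℝ) A.card)
    linarith
  · rw [← Finset.expect_div]
    gcongr

/-- Some arc of at least `l` slots around the home of `k` is the home of at least as many keys of
`A` and `k` as it has slots. -/
def Overfull {κ : Type*} [DecidableEq κ] (M : ℕ) (home : κ → ℕ) (k : κ) (A : Finset κ) (l : ℕ) :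
    Prop :=
  ∃ u s, l ≤ s ∧ u < s ∧ s < M ∧ s ≤ arcCount M home k (insert k A) u s

/-- An arc whose length is between `2 ^ j` and `2 ^ (j + 1)` grows only by little if both of its ends,
as seen from the home of `k`, are moved outwards to multiples of a number `g`. -/
theorem arcCount_round {κ : Type*} [DecidableEq κ] {M : ℕ} {home : κ → ℕ} {k : κ} {A : Finset κ}
    {u s g : ℕ} (hus : u < s) (hg : 0 < g)
    (h : s ≤ arcCount M home k (insert k A) u s) :
    ∃ a b, 1 ≤ a ∧ 1 ≤ b ∧ s < a * g + b * g ∧ a * g + b * g ≤ s + 2 * g ∧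
      a ≤ s / g + 1 ∧ b ≤ s / g + 1 ∧
      s ≤ arcCount M home k A (a * g) (a * g + b * g) + 1 := by
  have h1 := Nat.div_add_mod u g
  have h2 := Nat.mod_lt u hg
  have h3 := Nat.div_add_mod (s - u) g
  have h4 := Nat.mod_lt (s - u) hg
  have h5 : (u / g + 1) * g = g * (u / g) + g := by ring
  have h6 : ((s - u) / g + 1) * g = g * ((s - u) / g) + g := by ring
  refine ⟨u / g + 1, (s - u) / g + 1, Nat.succ_pos _, Nat.succ_pos _, by omega, by omega, ?_, ?_,
    ?_⟩
  · exact Nat.succ_le_succ (Nat.div_le_div_right hus.le)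
  · exact Nat.succ_le_succ (Nat.div_le_div_right (Nat.sub_le _ _))
  refine h.trans (le_trans ?_ (Finset.card_insert_le k _))
  refine Finset.card_le_card fun x hx => ?_
  rw [Finset.mem_filter, Finset.mem_insert] at hx
  rw [Finset.mem_insert, Finset.mem_filter]
  refine hx.1.imp_right fun hxA => ⟨hxA, ?_⟩
  set d := home x + (M - home k) + u with hd
  have h7 : home x + (M - home k) + (u / g + 1) * g = d + ((u / g + 1) * g - u) := by omega
  rw [h7, ← Nat.mod_add_mod]
  refine lt_of_le_of_lt (Nat.mod_le _ _) ?_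
  have := hx.2
  omega

theorem Indep.scale {κ : Type*} [DecidableEq κ] {T : Ω → κ → ℕ} {Q M : ℕ} (hT : Indep T Q)
    (hM : 0 < M) (hQ : 0 < Q) {k : κ} {A : Finset κ} (hk : k ∉ A) {ε : ℝ} (hε : 0 < ε)
    (hε1 : ε ≤ 1) (hA : A.card * (1 / M + 1 / Q : ℝ) ≤ 1 - ε) {j : ℕ} (hj : 8 ≤ ε * 2 ^ j) :
    prob (fun ω => ∃ u s, 2 ^ j ≤ s ∧ s < 2 ^ (j + 1) ∧ u < s ∧
      s ≤ arcCount M (fun x => T ω x % M) k (insert k A) u s) ≤ 40000 / (ε ^ 4 * 2 ^ j) := by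
  classical
  set g : ℕ := ⌊ε * 2 ^ j / 8⌋₊ with hg
  have hg1 : 1 ≤ g := Nat.le_floor (by push_cast; linarith)
  have hgr1 : (1 : ℝ) ≤ g := by exact_mod_cast hg1
  have hgle : (g : ℝ) ≤ ε * 2 ^ j / 8 := Nat.floor_le (by positivity)
  have hgge : ε * 2 ^ j / 16 ≤ g := by
    have := Nat.lt_floor_add_one (ε * 2 ^ j / 8)
    rw [← hg] at this
    linarith
  have hpow : (0 : ℝ) < 2 ^ j := by positivity
  set B : ℕ := ⌊33 / ε⌋₊ with hB
  have hBle : (B : ℝ) ≤ 33 / ε := Nat.floor_le (by positivity)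
  set I : Finset (ℕ × ℕ) := (Finset.Icc 1 B ×ˢ Finset.Icc 1 B).filter fun p =>
    2 ^ j ≤ p.1 * g + p.2 * g ∧ p.1 * g + p.2 * g ≤ 2 ^ (j + 1) + 2 * g with hI
  have hsub : prob (fun ω => ∃ u s, 2 ^ j ≤ s ∧ s < 2 ^ (j + 1) ∧ u < s ∧
      s ≤ arcCount M (fun x => T ω x % M) k (insert k A) u s) ≤
      prob (fun ω => ∃ p ∈ I, (((p.1 * g + p.2 * g : ℕ) : ℝ) - 3 * g) ≤
        arcCount M (fun x => T ω x % M) k A (p.1 * g) (p.1 * g + p.2 * g)) := by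
    refine prob_mono ?_
    rintro ω ⟨u, s, h1, h2, h3, h4⟩
    obtain ⟨a, b, ha, hb, h5, h6, h7, h8, h9⟩ := arcCount_round h3 hg1 h4
    have hsg : s / g + 1 ≤ B := by
      refine Nat.le_floor ?_
      have hs : (s : ℝ) ≤ 2 ^ (j + 1) := by exact_mod_cast h2.le
      have e1 : ((s / g : ℕ) : ℝ) ≤ s / g := Nat.cast_div_le
      have e2 : (s : ℝ) / g ≤ 32 / ε := by
        rw [div_le_div_iff₀ (by linarith) hε]
        rw [pow_succ] at hs
        nlinarith
      have e3 : 1 ≤ 1 / ε := by rw [le_div_iff₀ hε]; linarith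
      have e4 : 33 / ε = 32 / ε + 1 / ε := by ring
      push_cast
      linarith
    refine ⟨(a, b), ?_, ?_⟩
    · simp only [hI, Finset.mem_filter, Finset.mem_product, Finset.mem_Icc]
      exact ⟨⟨⟨ha, by omega⟩, hb, by omega⟩, by omega, by omega⟩
    · have h6' : ((a * g + b * g : ℕ) : ℝ) ≤ s + 2 * g := by exact_mod_cast h6
      have h9' : (s : ℝ) ≤ arcCount M (fun x => T ω x % M) k A (a * g) (a * g + b * g) + 1 := by
        exact_mod_cast h9
      show ((a * g + b * g : ℕ) : ℝ) - 3 * g ≤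
        arcCount M (fun x => T ω x % M) k A (a * g) (a * g + b * g)
      linarith
  refine hsub.trans ((prob_exists_le I _).trans ?_)
  have hterm : ∀ p ∈ I, prob (fun ω => (((p.1 * g + p.2 * g : ℕ) : ℝ) - 3 * g) ≤
      arcCount M (fun x => T ω x % M) k A (p.1 * g) (p.1 * g + p.2 * g)) ≤
      36 / (ε ^ 2 * 2 ^ j) := by
    rintro ⟨a, b⟩ hp
    simp only [hI, Finset.mem_filter] at hp
    obtain ⟨-, h1, h2⟩ := hp
    set s' := a * g + b * g
    have h1' : (2 : ℝ) ^ j ≤ s' := by exact_mod_cast h1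
    have h2' : (s' : ℝ) ≤ 2 ^ (j + 1) + 2 * g := by exact_mod_cast h2
    have hmean : A.card * (s' * (1 / M + 1 / Q) : ℝ) ≤ s' * (1 - ε) := by
      have := mul_le_mul_of_nonneg_left hA (Nat.cast_nonneg (α := ℝ) s')
      linarith
    have hD : ε * 2 ^ j / 2 ≤ (s' : ℝ) - 3 * g - A.card * (s' * (1 / M + 1 / Q) : ℝ) := by
      have := mul_le_mul_of_nonneg_left h1' hε.le
      linarith
    have hDpos : 0 < ε * 2 ^ j / 2 := by positivity
    refine (hT.chebyshev hM hQ hk (a * g) s' (r := (s' : ℝ) - 3 * g) (by linarith)).trans ?_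
    have hs9 : A.card * (s' * (1 / M + 1 / Q) : ℝ) ≤ 9 * 2 ^ j := by
      have e1 : (s' : ℝ) * (1 - ε) ≤ s' := by nlinarith
      have e2 : ε * 2 ^ j ≤ 2 ^ j := by nlinarith
      rw [pow_succ] at h2'
      linarith
    calc _ ≤ 9 * 2 ^ j / (ε * 2 ^ j / 2) ^ 2 := by gcongr
      _ = 36 / (ε ^ 2 * 2 ^ j) := by field_simp; norm_num
  have hcard : (I.card : ℝ) ≤ (33 / ε) ^ 2 := by
    have h1 : I.card ≤ B * B := by
      refine (Finset.card_filter_le _ _).trans ?_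
      simp
    calc (I.card : ℝ) ≤ ((B * B : ℕ) : ℝ) := by exact_mod_cast h1
      _ = (B : ℝ) ^ 2 := by push_cast; ring
      _ ≤ _ := by gcongr
  calc _ ≤ ∑ p ∈ I, 36 / (ε ^ 2 * 2 ^ j) := Finset.sum_le_sum hterm
    _ = I.card * (36 / (ε ^ 2 * 2 ^ j)) := by simp
    _ ≤ (33 / ε) ^ 2 * (36 / (ε ^ 2 * 2 ^ j)) := by gcongr
    _ = 39204 / (ε ^ 4 * 2 ^ j) := by field_simp; norm_num
    _ ≤ 40000 / (ε ^ 4 * 2 ^ j) := by gcongr; norm_num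

theorem sum_inv_two_pow_le (i n : ℕ) : ∑ j ∈ Finset.Ico i n, (1 : ℝ) / 2 ^ j ≤ 2 / 2 ^ i := by
  rcases le_or_gt i n with h | h
  · suffices H : ∑ j ∈ Finset.Ico i n, (1 : ℝ) / 2 ^ j = 2 / 2 ^ i - 2 / 2 ^ n by
      rw [H]; linarith [show (0 : ℝ) < 2 / 2 ^ n by positivity]
    induction n, h using Nat.le_induction with
    | base => simp
    | succ n h ih => rw [Finset.sum_Ico_succ_top h, ih, pow_succ]; field_simp; ring
  · rw [Finset.Ico_eq_empty (by omega), Finset.sum_empty]; positivity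

/-- The tail bound for the length of the overfull arcs around the home of a key. -/
theorem Indep.prob_overfull_le {κ : Type*} [DecidableEq κ] {T : Ω → κ → ℕ} {Q M : ℕ}
    (hT : Indep T Q) {k : κ} {A : Finset κ} (hk : k ∉ A) (hAM : A.card < M)
    (hQ : 2 * M ^ 2 ≤ Q) {l : ℕ} (hl : 1 ≤ l) :
    prob (fun ω => Overfull M (fun x => T ω x % M) k A l) ≤
      2560000 / (((M - A.card : ℝ) / M) ^ 4 * l) := by
  have hM : 0 < M := by omega
  have hQ0 : 0 < Q := lt_of_lt_of_le (by positivity) hQ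
  have hMr : (0 : ℝ) < M := by exact_mod_cast hM
  have hQr : (0 : ℝ) < Q := by exact_mod_cast hQ0
  have hlr : (1 : ℝ) ≤ l := by exact_mod_cast hl
  have hgap : (1 : ℝ) ≤ M - A.card := by
    have : ((A.card + 1 : ℕ) : ℝ) ≤ M := by exact_mod_cast hAM
    push_cast at this; linarith
  set ε : ℝ := (M - A.card : ℝ) / M / 2 with hε
  have hε0 : 0 < ε := by positivity
  have hε1 : ε ≤ 1 := by
    have : (M - A.card : ℝ) / M ≤ 1 := by
      rw [div_le_one hMr]; linarith [Nat.cast_nonneg (α := ℝ) A.card]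
    rw [hε]; linarith
  have hA : A.card * (1 / M + 1 / Q : ℝ) ≤ 1 - ε := by
    have h1 : (A.card : ℝ) / Q ≤ 1 / (2 * M) := by
      rw [div_le_div_iff₀ hQr (by positivity)]
      have h2 : (2 * M ^ 2 : ℝ) ≤ Q := by exact_mod_cast hQ
      nlinarith
    have h3 : 1 / (2 * M : ℝ) ≤ ε := by
      rw [hε, div_div, mul_comm (M : ℝ) 2]; gcongr
    have h4 : (A.card : ℝ) * (1 / M) = 1 - 2 * ε := by rw [hε]; field_simp; ring
    have h5 : (A.card : ℝ) * (1 / Q) = A.card / Q := by ring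
    rw [mul_add, h4, h5]
    linarith
  have hgoal : 2560000 / (((M - A.card : ℝ) / M) ^ 4 * l) = 160000 / (ε ^ 4 * l) := by
    rw [hε]; field_simp; norm_num
  rw [hgoal]
  by_cases hsmall : ε * l < 16
  · refine (prob_le_one _).trans ?_
    rw [le_div_iff₀ (by positivity), one_mul]
    have : ε ^ 3 ≤ 1 := pow_le_one₀ hε0.le hε1
    have : ε ^ 4 * l = ε ^ 3 * (ε * l) := by ring
    rw [this]
    nlinarith [pow_pos hε0 3, mul_pos hε0 (show (0 : ℝ) < l by linarith)]
  rw [not_lt] at hsmall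
  set i := Nat.log 2 l with hi
  have hi1 : 2 ^ i ≤ l := Nat.pow_log_le_self 2 (by omega)
  have hi2 : l < 2 ^ (i + 1) := Nat.lt_pow_succ_log_self one_lt_two l
  have hi2' : (l : ℝ) ≤ 2 ^ i * 2 := by
    rw [← pow_succ]; exact_mod_cast hi2.le
  have hsub : prob (fun ω => Overfull M (fun x => T ω x % M) k A l) ≤
      prob (fun ω => ∃ j ∈ Finset.Ico i M, ∃ u s, 2 ^ j ≤ s ∧ s < 2 ^ (j + 1) ∧ u < s ∧
      s ≤ arcCount M (fun x => T ω x % M) k (insert k A) u s) := by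
    refine prob_mono ?_
    rintro ω ⟨u, s, h1, h2, h3, h4⟩
    refine ⟨Nat.log 2 s, ?_, u, s, Nat.pow_log_le_self 2 (by omega),
      Nat.lt_pow_succ_log_self one_lt_two s, h2, h4⟩
    rw [Finset.mem_Ico]
    exact ⟨Nat.log_mono_right h1, lt_of_le_of_lt (Nat.log_le_self 2 s) h3⟩
  refine hsub.trans ((prob_exists_le _ _).trans ?_)
  calc _ ≤ ∑ j ∈ Finset.Ico i M, 40000 / ε ^ 4 * (1 / 2 ^ j) := by
        refine Finset.sum_le_sum fun j hj => ?_
        have hij : (2 : ℝ) ^ i ≤ 2 ^ j := pow_le_pow_right₀ (by norm_num) (Finset.mem_Ico.1 hj).1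
        refine (hT.scale hM hQ0 hk hε0 hε1 hA (j := j) ?_).trans (le_of_eq (by field_simp))
        have := mul_le_mul_of_nonneg_left hij hε0.le
        have := mul_le_mul_of_nonneg_left hi2' hε0.le
        linarith
    _ = 40000 / ε ^ 4 * ∑ j ∈ Finset.Ico i M, (1 : ℝ) / 2 ^ j := by rw [Finset.mul_sum]
    _ ≤ 40000 / ε ^ 4 * (2 / 2 ^ i) := by gcongr; exact sum_inv_two_pow_le i M
    _ = 80000 / (ε ^ 4 * 2 ^ i) := by field_simp; norm_num
    _ ≤ 160000 / (ε ^ 4 * l) := by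
        rw [div_le_div_iff₀ (by positivity) (by positivity)]
        have := mul_le_mul_of_nonneg_left hi2' (pow_nonneg hε0.le 4)
        linarith

end

end OffsetTable

/-! ### The hash function -/

namespace OffsetTable

open WordRAM

/-- The upper half of the word `a * x ^ 2 + b * x + c`. -/
def hashTop (w a b c x : ℕ) : ℕ :=
  ((((a * x % 2 ^ w + b) % 2 ^ w * x) % 2 ^ w + c) % 2 ^ w) >>> (w / 2)

theorem hashTop_eq (w a b c x : ℕ) :
    hashTop w a b c x = (a * x ^ 2 + b * x + c) % 2 ^ w / 2 ^ (w / 2) := by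
  rw [hashTop, Nat.shiftRight_eq_div_pow]
  congr 1
  have h1 : (a * x % 2 ^ w + b) % 2 ^ w ≡ a * x + b [MOD 2 ^ w] :=
    (Nat.mod_modEq _ _).trans ((Nat.mod_modEq _ _).add_right b)
  have h2 : ((a * x % 2 ^ w + b) % 2 ^ w * x) % 2 ^ w ≡ (a * x + b) * x [MOD 2 ^ w] :=
    (Nat.mod_modEq _ _).trans (h1.mul_right x)
  have h3 := h2.add_right c
  rw [Nat.ModEq] at h3
  rw [h3]
  congr 1
  ring

theorem two_pow_split (w : ℕ) : 2 ^ w = 2 ^ (w / 2) * 2 ^ (w - w / 2) := by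
  rw [← pow_add]; congr 1; omega

theorem hashTop_shift {w a b c a' b' c' x α : ℕ}
    (h : (a' * x ^ 2 + b' * x + c') ≡ (a * x ^ 2 + b * x + c) + α * 2 ^ (w / 2) [MOD 2 ^ w]) :
    hashTop w a' b' c' x = (hashTop w a b c x + α) % 2 ^ (w - w / 2) := by
  rw [hashTop_eq, hashTop_eq, h]
  set n := a * x ^ 2 + b * x + c
  rw [← Nat.mod_add_mod]
  set m := n % 2 ^ w
  rw [two_pow_split w, Nat.mod_mul_right_div_self, Nat.add_mul_div_right _ _ (Nat.two_pow_pos _)]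

/-- The power of two in a number `d` with `0 < |d| ≤ 2 ^ s` divides `2 ^ s`, and the rest of `d` is
invertible modulo a power of two. -/
theorem exists_mul_eq_two_pow {w s : ℕ} (d : ℤ) (hd : d ≠ 0) (hds : d.natAbs ≤ 2 ^ s) :
    ∃ r : ZMod (2 ^ w), (d : ZMod (2 ^ w)) * r = 2 ^ s := by
  set g := Int.gcd d ((2 ^ w : ℕ) : ℤ) with hg
  have h1 : g ∣ 2 ^ w := by
    have := Int.gcd_dvd_right d ((2 ^ w : ℕ) : ℤ)
    exact_mod_cast this
  obtain ⟨e, -, he⟩ := (Nat.dvd_prime_pow Nat.prime_two).1 h1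
  have h2 : g ≤ d.natAbs := Nat.le_of_dvd (Int.natAbs_pos.2 hd) (Int.gcd_dvd_natAbs_left _ _)
  have h3 : e ≤ s := by
    have : 2 ^ e ≤ 2 ^ s := by rw [← he]; exact h2.trans hds
    exact (Nat.pow_le_pow_iff_right one_lt_two).1 this
  have h4 := Int.gcd_eq_gcd_ab d ((2 ^ w : ℕ) : ℤ)
  rw [← hg, he] at h4
  have h5 := congrArg (Int.cast : ℤ → ZMod (2 ^ w)) h4
  simp only [Int.cast_add, Int.cast_mul, Int.cast_natCast, ZMod.natCast_self, zero_mul,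
    add_zero] at h5
  refine ⟨(Int.gcdA d ((2 ^ w : ℕ) : ℤ) : ZMod (2 ^ w)) * 2 ^ (s - e), ?_⟩
  rw [← mul_assoc, ← h5]
  push_cast
  rw [← pow_add, Nat.add_sub_cancel' h3]

/-- Lagrange interpolation: the values of the quadratic polynomial at three keys can be shifted by
arbitrary multiples of `2 ^ (w / 2)`. -/
theorem exists_interpolation {w B x y z : ℕ} (hB : B * B ≤ 2 ^ (w / 2)) (hx : x < B) (hy : y < B)
    (hz : z < B) (hxy : x ≠ y) (hxz : x ≠ z) (hyz : y ≠ z) (α β γ : ℕ) :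
    ∃ a b c : ℕ, (a * x ^ 2 + b * x + c) ≡ α * 2 ^ (w / 2) [MOD 2 ^ w] ∧
      (a * y ^ 2 + b * y + c) ≡ β * 2 ^ (w / 2) [MOD 2 ^ w] ∧
      (a * z ^ 2 + b * z + c) ≡ γ * 2 ^ (w / 2) [MOD 2 ^ w] := by
  have key : ∀ x y z : ℕ, x < B → y < B → z < B → x ≠ y → x ≠ z →
      ∃ r : ZMod (2 ^ w), ((x : ZMod (2 ^ w)) - y) * ((x : ZMod (2 ^ w)) - z) * r = 2 ^ (w / 2) := by
    intro x y z hx hy hz hxy hxz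
    obtain ⟨r, hr⟩ := exists_mul_eq_two_pow (w := w) (s := w / 2) (((x : ℤ) - y) * ((x : ℤ) - z))
      (mul_ne_zero (by omega) (by omega)) (by
        rw [Int.natAbs_mul]
        exact (Nat.mul_le_mul (by omega) (by omega)).trans hB)
    refine ⟨r, ?_⟩
    rw [← hr]
    push_cast
    ring
  obtain ⟨p, hp⟩ := key x y z hx hy hz hxy hxz
  obtain ⟨q, hq⟩ := key y x z hy hx hz hxy.symm hyz
  obtain ⟨r, hr⟩ := key z x y hz hx hy hxz.symm hyz.symm
  have hne : NeZero (2 ^ w) := ⟨(Nat.two_pow_pos w).ne'⟩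
  refine ⟨(α * p + β * q + γ * r : ZMod (2 ^ w)).val,
    (-(α * p * (y + z) + β * q * (x + z) + γ * r * (x + y)) : ZMod (2 ^ w)).val,
    (α * p * y * z + β * q * x * z + γ * r * x * y : ZMod (2 ^ w)).val, ?_, ?_, ?_⟩ <;>
  · rw [← ZMod.natCast_eq_natCast_iff]
    push_cast
    simp only [ZMod.natCast_val, ZMod.cast_id', id]
    first
    | linear_combination (α : ZMod (2 ^ w)) * hp
    | linear_combination (β : ZMod (2 ^ w)) * hq
    | linear_combination (γ : ZMod (2 ^ w)) * hr

theorem expect_rotate {Q t : ℕ} (G : ℕ → ℝ) :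
    𝔼 a ∈ Finset.range Q, G ((t + a) % Q) = 𝔼 a ∈ Finset.range Q, G a := by
  rcases Nat.eq_zero_or_pos Q with rfl | hQ
  · simp
  refine Finset.expect_nbij (fun a => (t + a) % Q) ?_ ?_ ?_ ?_
  · intro a _; simp; exact Nat.mod_lt _ hQ
  · intro a _; rfl
  · intro a ha b hb h
    simp only [Finset.coe_range, Set.mem_Iio] at ha hb
    have h2 := Nat.ModEq.add_left_cancel' t (show t + a ≡ t + b [MOD Q] from h)
    rwa [Nat.ModEq, Nat.mod_eq_of_lt ha, Nat.mod_eq_of_lt hb] at h2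
  · intro b hb
    simp only [Finset.coe_range, Set.mem_Iio] at hb
    obtain ⟨p, hp, he⟩ := exists_shift t b hb
    exact ⟨p, by simpa using hp, he⟩

theorem expect_comm_triple {Ω : Type*} [Fintype Ω] (s : Finset ℕ) (G : Ω → ℕ → ℕ → ℕ → ℝ) :
    𝔼 a ∈ s, 𝔼 b ∈ s, 𝔼 c ∈ s, 𝔼 ω, G ω a b c = 𝔼 ω, 𝔼 a ∈ s, 𝔼 b ∈ s, 𝔼 c ∈ s, G ω a b c :=
  (Finset.expect_congr rfl fun _ _ => (Finset.expect_congr rfl fun _ _ =>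
    Finset.expect_comm _ _ _).trans (Finset.expect_comm _ _ _)).trans (Finset.expect_comm _ _ _)

/-- The upper half of the hash value of `x`, whose coefficients are the first three words of a
random memory. -/
def seedTop {w S : ℕ} (hS : 3 ≤ S) (seed : Memory w S) (x : ℕ) : ℕ :=
  hashTop w (seed ⟨0, by omega⟩).toNat (seed ⟨1, by omega⟩).toNat (seed ⟨2, by omega⟩).toNat x

theorem seedTop_triple {w S B : ℕ} (hS : 3 ≤ S) (hB : B * B ≤ 2 ^ (w / 2)) {x y z : ℕ} (hx : x < B)
    (hy : y < B) (hz : z < B) (hxy : x ≠ y) (hxz : x ≠ z) (hyz : y ≠ z) (F : ℕ → ℕ → ℕ → ℝ) :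
    𝔼 seed : Memory w S, F (seedTop hS seed x) (seedTop hS seed y) (seedTop hS seed z) =
      𝔼 a ∈ Finset.range (2 ^ (w - w / 2)), 𝔼 b ∈ Finset.range (2 ^ (w - w / 2)),
        𝔼 c ∈ Finset.range (2 ^ (w - w / 2)), F a b c := by
  set Q := 2 ^ (w - w / 2) with hQ
  have hQ0 : 0 < Q := Nat.two_pow_pos _
  have hne : (Finset.range Q).Nonempty := ⟨0, by simpa using hQ0⟩
  have hshift : ∀ α β γ : ℕ,
      𝔼 seed : Memory w S, F (seedTop hS seed x) (seedTop hS seed y) (seedTop hS seed z) =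
      𝔼 seed : Memory w S, F ((seedTop hS seed x + α) % Q) ((seedTop hS seed y + β) % Q)
        ((seedTop hS seed z + γ) % Q) := by
    intro α β γ
    obtain ⟨a, b, c, h1, h2, h3⟩ := exists_interpolation hB hx hy hz hxy hxz hyz α β γ
    set δ : Memory w S := fun i => BitVec.ofNat w
      (if i.val = 0 then a else if i.val = 1 then b else if i.val = 2 then c else 0) with hδ
    have htr : ∀ (seed : Memory w S) (t ρ : ℕ), (a * t ^ 2 + b * t + c) ≡ ρ * 2 ^ (w / 2) [MOD 2 ^ w] →
        seedTop hS (seed + δ) t = (seedTop hS seed t + ρ) % Q := by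
      intro seed t ρ h
      refine hashTop_shift ?_
      simp only [Pi.add_apply, hδ, BitVec.toNat_add, BitVec.toNat_ofNat, if_true, if_false,
        one_ne_zero, OfNat.ofNat_ne_zero, OfNat.ofNat_ne_one, Nat.add_mod_mod]
      set a₀ := (seed ⟨0, by omega⟩).toNat
      set b₀ := (seed ⟨1, by omega⟩).toNat
      set c₀ := (seed ⟨2, by omega⟩).toNat
      calc _ ≡ (a₀ + a) * t ^ 2 + (b₀ + b) * t + (c₀ + c) [MOD 2 ^ w] :=
            (((Nat.mod_modEq _ _).mul_right _).add ((Nat.mod_modEq _ _).mul_right _)).add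
              (Nat.mod_modEq _ _)
        _ = (a₀ * t ^ 2 + b₀ * t + c₀) + (a * t ^ 2 + b * t + c) := by ring
        _ ≡ _ [MOD 2 ^ w] := h.add_left _
    symm
    refine Fintype.expect_equiv (Equiv.addRight δ) _ _ fun seed => ?_
    simp only [Equiv.coe_addRight]
    rw [htr seed x α h1, htr seed y β h2, htr seed z γ h3]
  calc _ = 𝔼 α ∈ Finset.range Q, 𝔼 β ∈ Finset.range Q, 𝔼 γ ∈ Finset.range Q,
        𝔼 seed : Memory w S, F (seedTop hS seed x) (seedTop hS seed y) (seedTop hS seed z) := by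
          simp only [Finset.expect_const hne]
    _ = 𝔼 α ∈ Finset.range Q, 𝔼 β ∈ Finset.range Q, 𝔼 γ ∈ Finset.range Q,
        𝔼 seed : Memory w S, F ((seedTop hS seed x + α) % Q) ((seedTop hS seed y + β) % Q)
          ((seedTop hS seed z + γ) % Q) := by
          refine Finset.expect_congr rfl fun α _ => Finset.expect_congr rfl fun β _ =>
            Finset.expect_congr rfl fun γ _ => hshift α β γ
    _ = 𝔼 seed : Memory w S, 𝔼 α ∈ Finset.range Q, 𝔼 β ∈ Finset.range Q, 𝔼 γ ∈ Finset.range Q,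
        F ((seedTop hS seed x + α) % Q) ((seedTop hS seed y + β) % Q)
          ((seedTop hS seed z + γ) % Q) := by
          exact expect_comm_triple _ _
    _ = _ := by
          have : ∀ seed : Memory w S, (𝔼 α ∈ Finset.range Q, 𝔼 β ∈ Finset.range Q,
              𝔼 γ ∈ Finset.range Q, F ((seedTop hS seed x + α) % Q) ((seedTop hS seed y + β) % Q)
                ((seedTop hS seed z + γ) % Q)) =
              𝔼 a ∈ Finset.range Q, 𝔼 b ∈ Finset.range Q, 𝔼 c ∈ Finset.range Q, F a b c := by
            intro seed
            rw [expect_rotate fun a => 𝔼 β ∈ Finset.range Q, 𝔼 γ ∈ Finset.range Q,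
              F a ((seedTop hS seed y + β) % Q) ((seedTop hS seed z + γ) % Q)]
            refine Finset.expect_congr rfl fun a _ => ?_
            rw [expect_rotate fun b => 𝔼 γ ∈ Finset.range Q, F a b ((seedTop hS seed z + γ) % Q)]
            refine Finset.expect_congr rfl fun b _ => ?_
            rw [expect_rotate fun c => F a b c]
          simp only [this]
          exact Finset.expect_const Finset.univ_nonempty _

/-- The upper halves of the hash values are three-wise independent: since the values of
the polynomial at three keys can be shifted by multiples of `2 ^ (w / 2)`, all triples of upper
halves are equally likely. -/
theorem seedTop_indep {w S U B : ℕ} (hS : 3 ≤ S) (hB : B * B ≤ 2 ^ (w / 2)) (hU : U ≤ B)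
    (h3 : 3 ≤ B) :
    Indep (fun (seed : Memory w S) (k : Fin U) => seedTop hS seed k) (2 ^ (w - w / 2)) where
  pair x y hxy F := by
    obtain ⟨z, hz, hxz, hyz⟩ : ∃ z < 3, (x : ℕ) ≠ z ∧ (y : ℕ) ≠ z := by
      by_cases h0 : (x : ℕ) ≠ 0 ∧ (y : ℕ) ≠ 0
      · exact ⟨0, by omega, h0⟩
      · by_cases h1 : (x : ℕ) ≠ 1 ∧ (y : ℕ) ≠ 1
        · exact ⟨1, by omega, h1⟩
        · exact ⟨2, by omega, by omega, by omega⟩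
    rw [seedTop_triple hS hB (by omega) (by omega) (by omega) (by omega) hxz hyz fun a b _ => F a b]
    have hne : (Finset.range (2 ^ (w - w / 2))).Nonempty := ⟨0, by simp⟩
    simp only [Finset.expect_const hne]
  triple x y z hxy hxz hyz F :=
    seedTop_triple hS hB (by omega) (by omega) (by omega) (by omega) (by omega) (by omega) F

end OffsetTable

/-! ### The programs for the operations -/

namespace OffsetTable

open WordRAM

/-- The parameters of a structure: the word length, the number of words of the memory, the number of
slots, the number of inner nodes and the degree of the search tree, and the length of a value. -/
structure Par where
  w : ℕ
  S : ℕ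
  M : ℕ
  N : ℕ
  f : ℕ
  v : ℕ

/-- The bit address of the first value: the values come after `16` words of constants and the bits of
the tree, to which `f + 1` zeros are appended. -/
def Par.valueBase (p : Par) : ℕ := 16 * p.w + (p.N + p.M + p.f)

/-- The conditions on the parameters. -/
structure Par.Valid (p : Par) : Prop where
  shape : Shape p.f p.N p.M
  f_lt : p.f * (p.f + 1) < p.w
  v_lt : p.v < p.w
  space : p.valueBase + p.M * p.v + 2 * p.w ≤ p.S * p.w
  small : p.w * (p.S * p.w) < 2 ^ p.w

/-- The constants in the first `16` words of the memory: the coefficients of the hash function and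
the numbers that the programs use. -/
def Par.header (p : Par) (a b c : ℕ) : ℕ → ℕ
  | 0 => a
  | 1 => b
  | 2 => c
  | 3 => p.w
  | 4 => p.M
  | 5 => p.N
  | 6 => p.f
  | 7 => p.w / 2
  | 8 => p.valueBase
  | 9 => p.v
  | 10 => 2 ^ p.v - 1
  | 11 => 2 ^ p.f - 1
  | 12 => (2 ^ (p.f * p.f) - 1) / (2 ^ p.f - 1)
  | 13 => (2 ^ ((p.f + 1) * p.f) - 1) / (2 ^ (p.f + 1) - 1)
  | 14 => 2 ^ (p.f + 1) - 1
  | 15 => 16 * p.w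
  | _ => 0

/-- A bit of the search tree. -/
def Par.treeBit (p : Par) (μ : ℕ → ℕ) (x : ℕ) : Bool :=
  decide (x < p.N + p.M + p.f) && bitAt p.w μ (16 * p.w + x)

/-- The value that is stored in a slot. -/
def Par.value (p : Par) (μ : ℕ → ℕ) (s : ℕ) : ℕ := field p.w μ (p.valueBase + s * p.v) p.v

/-- The memory `μ` represents a structure in which the slots with the property `F` are free. -/
structure Par.Rep (p : Par) (a b c : ℕ) (F : ℕ → Prop) (μ : ℕ → ℕ) : Prop where
  bdd : ∀ i, μ i < 2 ^ p.w
  header : ∀ i < 16, μ i = p.header a b c i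
  bits : Shape.Bits p.f p.N p.M F (p.treeBit μ)

/-- The registers from `10` to `25` hold the constants. -/
def Par.Regs (p : Par) (a b c : ℕ) (s : NatState) : Prop :=
  ∀ i < 16, s.r (10 + i) = p.header a b c i

/-- Whether an instruction leaves the memory as it is. -/
def noStore : Instr → Bool
  | .store _ _ => false
  | _ => true

theorem runBlock_mem (w S : ℕ) (l : List Instr) (s : NatState) (h : l.all noStore = true) :
    (runBlock w S l s).μ = s.μ := by
  induction l generalizing s with
  | nil => rfl
  | cons i l ih =>
    simp only [List.all_cons, Bool.and_eq_true] at h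
    rw [runBlock_cons, ih _ h.2]
    cases i <;> simp_all [Instr.natExec, noStore]

/-- Code that loads the first `n` words of the memory into the registers from `10` on. -/
def loadCode (n : ℕ) : List Instr :=
  (List.range n).flatMap fun i => [.const 9 i, .load (10 + i) 9]

theorem straight_loadCode (n : ℕ) : (loadCode n).all Instr.straight = true := by
  simp [loadCode, Instr.straight]

theorem length_loadCode (n : ℕ) : (loadCode n).length = 2 * n := by
  simp [loadCode, mul_comm]

theorem runBlock_loadCode {w S : ℕ} (s : NatState) (n : ℕ) (hn : n ≤ 2 ^ w) :
    (∀ i < n, (runBlock w S (loadCode n) s).r (10 + i) = s.μ i) ∧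
    (∀ i < 9, (runBlock w S (loadCode n) s).r i = s.r i) ∧
    (runBlock w S (loadCode n) s).μ = s.μ := by
  induction n with
  | zero => exact ⟨fun i hi => absurd hi (by omega), fun i _ => rfl, rfl⟩
  | succ n ih =>
    obtain ⟨h1, h2, h3⟩ := ih (by omega)
    have e : loadCode (n + 1) = loadCode n ++ [.const 9 n, .load (10 + n) 9] := by
      simp [loadCode, List.range_succ]
    rw [e, runBlock_append]
    set t := runBlock w S (loadCode n) s
    refine ⟨fun i hi => ?_, fun i hi => ?_, h3⟩
    · simp only [runBlock, Instr.natExec, List.foldl_cons, List.foldl_nil, Function.update_apply,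
        if_true]
      rw [Nat.mod_eq_of_lt (by omega), h3]
      by_cases hin : i = n
      · simp [hin]
      · rw [if_neg (by omega), if_neg (by omega)]
        exact h1 i (by omega)
    · simp only [runBlock, Instr.natExec, List.foldl_cons, List.foldl_nil, Function.update_apply]
      rw [if_neg (by omega), if_neg (by omega)]
      exact h2 i hi

/-- Code that puts the home of the key in register `0` into register `30`. -/
def homeCode : List Instr :=
  [.op .mul 30 10 0, .op .add 30 30 11, .op .mul 30 30 0, .op .add 30 30 12, .op .shr 30 30 17,
    .op .mod 30 30 14]

namespace Par.Valid

variable {p : Par} {a b c : ℕ}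

theorem sixteen_lt (H : p.Valid) : 20 < p.w := by
  have h1 := H.f_lt
  have h2 := H.shape.four_le
  nlinarith

theorem addr_lt (H : p.Valid) {x : ℕ} (hx : x ≤ 20 * (p.S * p.w)) : x < 2 ^ p.w := by
  have h1 := H.small
  have h2 := H.sixteen_lt
  nlinarith

theorem word_lt (H : p.Valid) {x : ℕ} (hx : x + 2 * p.w ≤ p.S * p.w) : x / p.w + 1 < p.S := by
  have h2 := H.sixteen_lt
  have h3 : x / p.w + 2 ≤ p.S := by
    have : (x + 2 * p.w) / p.w ≤ p.S := Nat.div_le_of_le_mul (by rwa [mul_comm p.w])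
    rwa [Nat.add_mul_div_right _ _ (by omega)] at this
  omega

theorem f_lt_w (H : p.Valid) : p.f < p.w := by
  have h1 := H.f_lt
  nlinarith

theorem tree_le (H : p.Valid) : 16 * p.w + (p.N + p.M + p.f) + 2 * p.w ≤ p.S * p.w := by
  have := H.space
  unfold Par.valueBase at this
  omega

theorem value_le (H : p.Valid) {s : ℕ} (hs : s < p.M) :
    p.valueBase + s * p.v + p.v + 2 * p.w ≤ p.S * p.w := by
  have := H.space
  have : (s + 1) * p.v ≤ p.M * p.v := Nat.mul_le_mul_right _ hs
  rw [Nat.succ_mul] at this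
  omega

/-- The state after the common first part of all operations. -/
theorem prefix_spec (H : p.Valid) {F : ℕ → Prop} {s : NatState} (hR : p.Rep a b c F s.μ) :
    let s' := runBlock p.w p.S (loadCode 16 ++ homeCode) s
    p.Regs a b c s' ∧ s'.r 30 = hashTop p.w a b c (s.r 0) % p.M ∧ (∀ i < 9, s'.r i = s.r i) ∧
      s'.μ = s.μ := by
  have h16 := H.sixteen_lt
  have h2w : p.w < 2 ^ p.w := Nat.lt_two_pow_self
  obtain ⟨h1, h2, h3⟩ := runBlock_loadCode (w := p.w) (S := p.S) s 16 (by omega)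
  intro s'
  have hs' : s' = runBlock p.w p.S homeCode (runBlock p.w p.S (loadCode 16) s) :=
    runBlock_append _ _ _ _ _
  set t := runBlock p.w p.S (loadCode 16) s with ht
  have hreg : ∀ i < 16, t.r (10 + i) = p.header a b c i := fun i hi => by
    rw [h1 i hi, hR.header i hi]
  refine ⟨fun i hi => ?_, ?_, fun i hi => ?_, ?_⟩
  · rw [hs', runBlock_frame _ _ _ _ _ (by simp [homeCode, Instr.dst]; omega)]
    exact hreg i hi
  · have e0 := hreg 0 (by omega)
    have e1 := hreg 1 (by omega)
    have e2 := hreg 2 (by omega)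
    have e4 := hreg 4 (by omega)
    have e7 := hreg 7 (by omega)
    simp only [Nat.reduceAdd, Par.header] at e0 e1 e2 e4 e7
    rw [hs']
    simp only [runBlock, homeCode, Instr.natExec, BinOp.natEval, Function.update_apply,
      List.foldl_cons, List.foldl_nil, Nat.reduceEqDiff, if_true, if_false, e0, e1, e2, e4, e7,
      h2 0 (by omega), hashTop]
  · rw [hs', runBlock_frame _ _ _ _ _ (by simp [homeCode, Instr.dst]; omega)]
    exact h2 i hi
  · rw [hs', runBlock_mem _ _ _ _ (by decide), h3]

end Par.Valid

/-- Code that puts the bit address of the value of the key with the offset in register `1` into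
register `50`. -/
def addressCode : List Instr :=
  [.op .add 31 30 1, .op .mod 31 31 14, .op .mul 50 31 19, .op .add 50 50 18]

/-- The program for queries. -/
def queryCmd : Cmd :=
  .blk (loadCode 16 ++ homeCode ++ (addressCode ++ readCode 20 ++ [.op .or 0 52 52]))

/-- The program for updates. -/
def updateCmd : Cmd :=
  .blk (loadCode 16 ++ homeCode ++ (addressCode ++ [.op .or 59 2 2] ++ writeCode 20))

namespace Par.Valid

variable {p : Par} {a b c : ℕ}

theorem home_lt (H : p.Valid) (x : ℕ) : x % p.M < p.M :=
  Nat.mod_lt _ (by have := H.shape.two_le; omega)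

theorem addressCode_spec (H : p.Valid) {s : NatState} (hs : p.Regs a b c s)
    (hh : s.r 30 < p.M) (ho : s.r 1 < p.M) :
    (runBlock p.w p.S addressCode s).r 50 =
      p.valueBase + (s.r 30 + s.r 1) % p.M * p.v := by
  have e4 : s.r 14 = p.M := hs 4 (by omega)
  have e8 : s.r 18 = p.valueBase := hs 8 (by omega)
  have e9 : s.r 19 = p.v := hs 9 (by omega)
  have h1 := H.value_le (H.home_lt (s.r 30 + s.r 1))
  have h2 := H.tree_le
  have h3 := H.shape.two_le
  simp only [runBlock, addressCode, Instr.natExec, BinOp.natEval, Function.update_apply,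
    List.foldl_cons, List.foldl_nil, Nat.reduceEqDiff, if_true, if_false, e4, e8, e9]
  rw [Nat.mod_eq_of_lt (a := s.r 30 + s.r 1) (H.addr_lt (by omega)),
    Nat.mod_eq_of_lt (a := _ * p.v) (H.addr_lt (by omega)), Nat.mod_eq_of_lt (H.addr_lt (by omega)),
    add_comm]

theorem value_setField (H : p.Valid) {μ μ' : ℕ → ℕ} (hμ : ∀ i, μ i < 2 ^ p.w)
    (hμ' : ∀ i, μ' i < 2 ^ p.w) {t y : ℕ} (hy : y < 2 ^ p.v)
    (h : μ' = setField p.w μ (p.valueBase + t * p.v) p.v y) :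
    p.value μ' t = y ∧ ∀ s, s ≠ t → p.value μ' s = p.value μ s := by
  have hw := H.sixteen_lt
  have hv := H.v_lt
  refine ⟨field_setField_self hμ' hv.le (by omega) hy h, fun s hs => ?_⟩
  refine field_congr hμ' hμ hv.le fun j hj => ?_
  rw [h, bitAt_setField hv.le (by omega) hy, if_neg]
  rintro ⟨h1, h2⟩
  apply hs
  have h3 : t * p.v < (s + 1) * p.v := by rw [Nat.succ_mul]; omega
  have h4 : s * p.v < (t + 1) * p.v := by rw [Nat.succ_mul]; omega
  have := Nat.lt_of_mul_lt_mul_right h3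
  have := Nat.lt_of_mul_lt_mul_right h4
  omega

theorem rep_setField (H : p.Valid) {F : ℕ → Prop} {μ μ' : ℕ → ℕ} (hR : p.Rep a b c F μ)
    (hμ' : ∀ i, μ' i < 2 ^ p.w) {t y : ℕ} (hy : y < 2 ^ p.v)
    (h : μ' = setField p.w μ (p.valueBase + t * p.v) p.v y) : p.Rep a b c F μ' := by
  have hw := H.sixteen_lt
  refine ⟨hμ', fun i hi => ?_, fun x => ?_⟩
  · rw [← hR.header i hi, h]
    refine setField_of_lt ?_
    have : 16 ≤ (p.valueBase + t * p.v) / p.w := by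
      rw [Nat.le_div_iff_mul_le (by omega)]
      unfold Par.valueBase; omega
    omega
  · rw [← hR.bits x]
    unfold Par.treeBit
    by_cases hx : x < p.N + p.M + p.f
    · rw [h, bitAt_setField H.v_lt.le (by omega) hy, if_neg]
      unfold Par.valueBase; omega
    · simp [hx]

theorem query_spec (H : p.Valid) {F : ℕ → Prop} {s : NatState}
    (hR : p.Rep a b c F s.μ) (ho : s.r 1 < p.M) :
    Runs p.w p.S queryCmd s 54 fun s' =>
      s'.r 0 = p.value s.μ ((hashTop p.w a b c (s.r 0) % p.M + s.r 1) % p.M) ∧ s'.μ = s.μ := by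
  refine (Runs.blk (by simp [straight_loadCode]; decide) ?_).mono
    (by simp [length_loadCode]; decide) fun _ h => h
  obtain ⟨h1, h2, h3, h4⟩ := H.prefix_spec hR
  rw [runBlock_append]
  set t := runBlock p.w p.S (loadCode 16 ++ homeCode) s
  rw [runBlock_append, runBlock_append]
  have h5 := H.addressCode_spec h1 (h2 ▸ H.home_lt _) ((h3 1 (by omega)).symm ▸ ho)
  set t' := runBlock p.w p.S addressCode t with ht'
  have hfr : ∀ i, 10 ≤ i → i < 30 → t'.r i = t.r i := fun i hi hi' =>
    runBlock_frame _ _ _ _ _ (by simp [addressCode, Instr.dst]; omega)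
  have hμ : t'.μ = s.μ := by
    rw [ht', runBlock_mem _ _ _ _ (by decide), h4]
  have hv := H.value_le (H.home_lt (t.r 30 + t.r 1))
  have h6 := runBlock_readCode (w := p.w) (S := p.S) (s := t') (mask := 20) (g := p.v) (by omega)
    ((hfr 13 (by omega) (by omega)).trans (h1 3 (by omega))) (by have := H.sixteen_lt; omega)
    ((hfr 20 (by omega) (by omega)).trans (h1 10 (by omega)))
    (by rw [h5]; exact H.addr_lt (by omega))
  set t'' := runBlock p.w p.S (readCode 20) t'
  have h7 : (runBlock p.w p.S [.op .or 0 52 52] t'').r 0 = t''.r 52 := by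
    simp [runBlock, Instr.natExec, BinOp.natEval]
  refine ⟨?_, (runBlock_mem _ _ _ _ (by decide)).trans (h6.2.1.trans hμ)⟩
  rw [h7, h6.1, h5, hμ, h2, h3 1 (by omega)]
  rfl

theorem update_spec (H : p.Valid) {F : ℕ → Prop} {s : NatState} (hs : s.Bdd p.w)
    (hR : p.Rep a b c F s.μ) (ho : s.r 1 < p.M) (hy : s.r 2 < 2 ^ p.v) :
    Runs p.w p.S updateCmd s 62 fun s' =>
      p.Rep a b c F s'.μ ∧
      p.value s'.μ ((hashTop p.w a b c (s.r 0) % p.M + s.r 1) % p.M) = s.r 2 ∧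
      ∀ t, t ≠ (hashTop p.w a b c (s.r 0) % p.M + s.r 1) % p.M → p.value s'.μ t = p.value s.μ t := by
  refine (Runs.blk (by simp [straight_loadCode]; decide) ?_).mono
    (by simp [length_loadCode]; decide) fun _ h => h
  obtain ⟨h1, h2, h3, h4⟩ := H.prefix_spec hR
  have hbdd := hs.runBlock p.S (loadCode 16 ++ homeCode)
  rw [runBlock_append]
  set t := runBlock p.w p.S (loadCode 16 ++ homeCode) s
  rw [runBlock_append, runBlock_append]
  have h5 := H.addressCode_spec h1 (h2 ▸ H.home_lt _) ((h3 1 (by omega)).symm ▸ ho)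
  have hbdd := (hbdd.runBlock p.S addressCode).runBlock p.S [.op .or 59 2 2]
  set t' := runBlock p.w p.S [.op .or 59 2 2] (runBlock p.w p.S addressCode t) with ht'
  have hfr : ∀ i, i < 30 → t'.r i = t.r i := fun i hi' => by
    rw [ht', runBlock_frame _ _ _ _ _ (by simp [Instr.dst]; omega),
      runBlock_frame _ _ _ _ _ (by simp [addressCode, Instr.dst]; omega)]
  have h59 : t'.r 59 = s.r 2 := by
    rw [← h3 2 (by omega), ← hfr 2 (by omega)]
    simp [ht', runBlock, Instr.natExec, BinOp.natEval]
  have h50 : t'.r 50 = p.valueBase + (t.r 30 + t.r 1) % p.M * p.v := by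
    rw [← h5, ht', runBlock_frame _ _ _ _ _ (by simp [Instr.dst])]
  have hμ : t'.μ = s.μ := by
    rw [ht', runBlock_mem _ _ _ _ (by decide), runBlock_mem _ _ _ _ (by decide), h4]
  have hv := H.value_le (H.home_lt (t.r 30 + t.r 1))
  have h6 := runBlock_writeCode (w := p.w) (S := p.S) (s := t') (mask := 20) (g := p.v) (by omega)
    ((hfr 13 (by omega)).trans (h1 3 (by omega))) (by have := H.sixteen_lt; omega)
    ((hfr 20 (by omega)).trans (h1 10 (by omega)))
    (by rw [h50]; exact H.addr_lt (by omega))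
    (by rw [h50]; exact H.word_lt (by omega))
  have hbdd := hbdd.runBlock p.S (writeCode 20)
  have h7 := h6.1
  rw [h50, h59, hμ, h2, h3 1 (by omega)] at h7
  have h8 := H.value_setField hR.bdd hbdd.2 hy h7
  exact ⟨H.rep_setField hR hbdd.2 hy h7, h8.1, h8.2⟩

end Par.Valid

end OffsetTable

/-! ### The program for insertions -/

namespace WordRAM

theorem Exec.bdd {w S : ℕ} {c : Cmd} {s s' : NatState} {t : ℕ}
    (h : Exec w S c s s' t) : s.Bdd w → s'.Bdd w := by
  induction h with
  | blk l s _ => exact fun hs => hs.runBlock S l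
  | seq _ _ ih₁ ih₂ => exact fun hs => ih₂ (ih₁ hs)
  | done _ => exact id
  | loop _ _ _ ih₁ ih₂ => exact fun hs => ih₂ (ih₁ hs)

end WordRAM

namespace OffsetTable

open WordRAM

/-- Preparation of the search from the leaf of the home on. -/
def searchStartCode : List Instr :=
  [.const 40 1, .const 41 0, .op .add 31 15 30, .op .sub 31 31 40, .op .mul 31 31 16, .const 52 0]

/-- Step of the search upwards. -/
def upCode : List Instr := [.op .div 31 31 16, .op .add 50 25 31] ++ readCode 21

/-- Move to the first node with free slots among the `f` nodes from register `31` on. -/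
def pickCode : List Instr := lowCode ++ [.op .add 31 31 60, .op .sub 31 31 40, .op .add 32 31 40]

/-- Step of the search downwards. -/
def downCode : List Instr := [.op .mul 31 32 16, .op .add 50 25 31] ++ readCode 21 ++ pickCode

/-- Computation of the offset, and storing of the value. -/
def placeCode : List Instr :=
  [.op .sub 33 32 15, .op .add 34 33 14, .op .sub 34 34 30, .op .mod 34 34 14, .op .mul 50 33 19,
    .op .add 50 50 18, .op .or 59 1 1] ++ writeCode 20 ++ [.const 52 0]

/-- Clearing of the bit of a full node, and inspection of its siblings. -/
def clearCode : List Instr :=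
  [.op .add 50 25 31, .const 59 0] ++ writeCode 40 ++
    [.op .div 31 31 16, .op .mul 50 31 16, .op .add 50 50 25] ++ readCode 21 ++ [.op .sub 31 31 40]

/-- The program for insertions. Register `30` holds the home of the key, `31` the current node and `32`
its successor, `52` the bits of the `f` nodes that are inspected, `33` and `34` the slot and the
offset, and `40` and `41` the constants `1` and `0`. The first loop ascends until register `52`
is not zero, the second one descends to a leaf, and the third one clears the bits of full nodes. -/
def insertCmd : Cmd :=
  .seq (.blk (loadCode 16 ++ homeCode ++ searchStartCode)) <|
  .seq (.whl false 52 41 (.blk upCode)) <|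
  .seq (.blk pickCode) <|
  .seq (.whl true 32 15 (.blk downCode)) <|
  .seq (.blk placeCode) <|
  .seq (.whl false 52 41 (.blk clearCode)) (.blk [.op .or 0 34 34])

namespace Par.Valid

variable {p : Par} {a b c : ℕ}

theorem Regs.frame {s s' : NatState} (h : p.Regs a b c s)
    (hfr : ∀ i < 31, s'.r i = s.r i) : p.Regs a b c s' := fun i hi => by
  rw [hfr _ (by omega), h i hi]

theorem field_testBit (H : p.Valid) {μ : ℕ → ℕ} (hμ : ∀ i, μ i < 2 ^ p.w) {x i : ℕ}
    (hx : x ≤ p.N + p.M) (hi : i < p.f) :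
    (field p.w μ (16 * p.w + x) p.f).testBit i = p.treeBit μ (x + i) := by
  rw [testBit_field hμ H.f_lt_w.le]
  unfold Par.treeBit
  rw [decide_eq_true hi, decide_eq_true (show x + i < p.N + p.M + p.f by omega), add_assoc]

theorem field_eq_zero_iff (H : p.Valid) {μ : ℕ → ℕ} (hμ : ∀ i, μ i < 2 ^ p.w) {x : ℕ}
    (hx : x ≤ p.N + p.M) :
    field p.w μ (16 * p.w + x) p.f = 0 ↔ ∀ i < p.f, p.treeBit μ (x + i) = false := by
  constructor
  · intro h i hi
    rw [← H.field_testBit hμ hx hi, h, Nat.zero_testBit]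
  · intro h
    refine Nat.eq_of_testBit_eq fun i => ?_
    rw [Nat.zero_testBit]
    by_cases hi : i < p.f
    · rw [H.field_testBit hμ hx hi, h i hi]
    · exact Nat.testBit_lt_two_pow
        (lt_of_lt_of_le (field_lt _ _ _ _) (Nat.pow_le_pow_right two_pos (not_lt.1 hi)))

/-- Reading the `f` bits from the node `x` on. -/
theorem readTree_spec (H : p.Valid) {s : NatState} (hs : p.Regs a b c s) {x : ℕ}
    (hx : x ≤ p.N + p.M) (h50 : s.r 50 = 16 * p.w + x) :
    (runBlock p.w p.S (readCode 21) s).r 52 = field p.w s.μ (16 * p.w + x) p.f ∧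
    (runBlock p.w p.S (readCode 21) s).μ = s.μ ∧
    ∀ i < 50, (runBlock p.w p.S (readCode 21) s).r i = s.r i := by
  have := H.tree_le
  have h := runBlock_readCode (w := p.w) (S := p.S) (s := s) (mask := 21) (g := p.f) (by omega)
    (hs 3 (by omega)) (by have := H.sixteen_lt; omega) (hs 11 (by omega))
    (by rw [h50]; exact H.addr_lt (by omega))
  rwa [h50] at h

theorem upCode_spec (H : p.Valid) {s : NatState} (hs : p.Regs a b c s)
    (hx : s.r 31 / p.f ≤ p.N + p.M) :
    let s' := runBlock p.w p.S upCode s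
    s'.r 31 = s.r 31 / p.f ∧ s'.r 52 = field p.w s.μ (16 * p.w + s.r 31 / p.f) p.f ∧ s'.μ = s.μ ∧
      ∀ i < 50, i ≠ 31 → s'.r i = s.r i := by
  intro s'
  have hs' : s' = runBlock p.w p.S (readCode 21)
    (runBlock p.w p.S [.op .div 31 31 16, .op .add 50 25 31] s) := runBlock_append _ _ _ _ _
  set t := runBlock p.w p.S [.op .div 31 31 16, .op .add 50 25 31] s with ht
  have e6 : s.r 16 = p.f := hs 6 (by omega)
  have e15 : s.r 25 = 16 * p.w := hs 15 (by omega)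
  have htree := H.tree_le
  have h31 : t.r 31 = s.r 31 / p.f := by
    simp [ht, runBlock, Instr.natExec, BinOp.natEval, e6]
  have h50 : t.r 50 = 16 * p.w + s.r 31 / p.f := by
    simp only [ht, runBlock, Instr.natExec, BinOp.natEval, Function.update_apply, List.foldl_cons,
      List.foldl_nil, Nat.reduceEqDiff, if_true, if_false, e6, e15]
    exact Nat.mod_eq_of_lt (H.addr_lt (by omega))
  have hfr : ∀ i < 50, i ≠ 31 → t.r i = s.r i := fun i hi hi' =>
    runBlock_frame _ _ _ _ _ (by simp [Instr.dst]; omega)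
  obtain ⟨h1, h2, h3⟩ := H.readTree_spec (Regs.frame hs fun i hi => hfr i (by omega) (by omega))
    hx h50
  rw [hs']
  exact ⟨by rw [h3 31 (by omega), h31], h1, h2, fun i hi hi' => by rw [h3 i hi, hfr i hi hi']⟩

/-- The search upwards. The number of its steps is bounded by the lengths of the full arcs. -/
theorem up_spec (H : p.Valid) {F : ℕ → Prop} {s₀ : NatState} {h B : ℕ} (hs₀ : p.Regs a b c s₀)
    (hR : p.Rep a b c F s₀.μ) (h41 : s₀.r 41 = 0) (h52 : s₀.r 52 = 0) (hh : h < p.M)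
    (h31 : s₀.r 31 = p.f * (p.N + h - 1)) (hex : ∃ s < p.M, F s) (hB2 : 2 ≤ B)
    (hB : ∀ k, Shape.Arc p.M F h (p.f ^ k) → k + 2 < B) :
    Runs p.w p.S (.whl false 52 41 (.blk upCode)) s₀ (B * (13 + 2) + 2) fun s =>
      s.μ = s₀.μ ∧ (∀ i < 50, i ≠ 31 → s.r i = s₀.r i) ∧
      (∃ P, Shape.Search p.f p.N p.M F h (s.r 31) P) ∧ p.N ≤ p.f ^ B * (s.r 31 + 1) ∧ s.r 52 ≠ 0 ∧
      s.r 52 = field p.w s.μ (16 * p.w + s.r 31) p.f := by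
  have hf := H.shape.four_le
  have hN := H.shape.one_le
  refine Runs.whl B (fun k s => s.μ = s₀.μ ∧ (∀ i < 50, i ≠ 31 → s.r i = s₀.r i) ∧ k ≤ B ∧
    ((k = 0 ∧ s.r 31 = p.f * (p.N + h - 1) ∧ s.r 52 = 0) ∨
      ∃ j P, k = j + 1 ∧ s.r 31 = (p.N + h - 1) / p.f ^ j ∧
        Shape.Search p.f p.N p.M F h (s.r 31) P ∧
        s.r 52 = field p.w s.μ (16 * p.w + s.r 31) p.f)) ?_ ?_ s₀ ?_
  · rintro k s ⟨hμ, hfr, hkB, hI⟩ htest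
    have hregs : p.Regs a b c s := Regs.frame hs₀ fun i hi => hfr i (by omega) (by omega)
    have hz : s.r 52 = 0 := by
      have : s.r 52 = s.r 41 := htest
      rw [this, hfr 41 (by omega) (by omega), h41]
    -- the state after the division
    obtain ⟨hk, P, hs31, hsearch⟩ : k < B ∧ ∃ P, s.r 31 / p.f = (p.N + h - 1) / p.f ^ k ∧
        Shape.Search p.f p.N p.M F h (s.r 31 / p.f) P := by
      rcases hI with ⟨rfl, h1, -⟩ | ⟨j, P, rfl, h1, h2, h3⟩
      · refine ⟨by omega, 0, ?_, ?_⟩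
        · rw [h1, Nat.mul_div_cancel_left _ (by omega)]; simp
        · rw [h1, Nat.mul_div_cancel_left _ (by omega)]
          exact H.shape.search_start F hh
      · have hlt := h2.lt
        have hnone : ∀ x, s.r 31 ≤ x → x < s.r 31 + p.f → x < p.N + p.M - 1 →
            ¬ Shape.Has p.f p.N p.M F x := by
          intro x hx1 hx2 hx3 hx
          have h4 := (H.field_eq_zero_iff (hμ ▸ hR.bdd) (by omega)).1 (h3.symm.trans hz)
            (x - s.r 31) (by omega)
          rw [Nat.add_sub_cancel' hx1, hμ] at h4
          rw [(hR.bits x).2 ⟨hx3, hx⟩] at h4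
          exact absurd h4 (by simp)
        refine ⟨?_, ?_⟩
        · rcases j with _ | j
          · omega
          · exact hB j (h2.arc H.shape hh h1 hnone hex)
        · obtain ⟨P', hP'⟩ := h2.up H.shape hnone
          exact ⟨P', by rw [h1, Nat.div_div_eq_div_mul, ← pow_succ], hP'⟩
    refine ⟨hk, (Runs.blk (by decide) ?_).mono (le_of_eq rfl) fun _ h => h⟩
    obtain ⟨h1, h2, h3, h4⟩ := H.upCode_spec hregs
      (by have := hsearch.lt; omega)
    refine ⟨h3.trans hμ, fun i hi hi' => (h4 i hi hi').trans (hfr i hi hi'), by omega,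
      Or.inr ⟨k, P, rfl, h1.trans hs31, by rw [h1]; exact hsearch, by rw [h1, h3]; exact h2⟩⟩
  · rintro k s ⟨hμ, hfr, hkB, hI⟩ htest
    have hz : s.r 52 ≠ 0 := fun hz => htest (by
      show s.r 52 = s.r 41
      rw [hz, hfr 41 (by omega) (by omega), h41])
    rcases hI with ⟨-, -, h1⟩ | ⟨j, P, rfl, h1, h2, h3⟩
    · exact absurd h1 hz
    · refine ⟨hμ, hfr, ⟨P, h2⟩, ?_, hz, h3⟩
      have h4 : p.N + h - 1 < p.f ^ j * (s.r 31 + 1) := by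
        rw [h1]; exact Nat.lt_mul_div_succ _ (Nat.pow_pos (by omega))
      have h5 : p.f ^ j ≤ p.f ^ B := Nat.pow_le_pow_right (by omega) (by omega)
      have := Nat.mul_le_mul_right (s.r 31 + 1) h5
      omega
  · exact ⟨rfl, fun _ _ _ => rfl, by omega, Or.inl ⟨rfl, h31, h52⟩⟩

theorem pickCode_spec (H : p.Valid) {F : ℕ → Prop} {s : NatState} {h P : ℕ} (hs : p.Regs a b c s)
    (hR : p.Rep a b c F s.μ) (h40 : s.r 40 = 1) (hsearch : Shape.Search p.f p.N p.M F h (s.r 31) P)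
    (hz : s.r 52 ≠ 0) (h52 : s.r 52 = field p.w s.μ (16 * p.w + s.r 31) p.f) :
    let s' := runBlock p.w p.S pickCode s
    s'.μ = s.μ ∧ (∀ i < 50, i ≠ 31 → i ≠ 32 → s'.r i = s.r i) ∧ s.r 31 ≤ s'.r 31 ∧
      s'.r 32 = s'.r 31 + 1 ∧ Shape.Has p.f p.N p.M F (s'.r 31) ∧
      ∃ P', Shape.Search p.f p.N p.M F h (s'.r 31) P' := by
  intro s'
  have hs' : s' = runBlock p.w p.S [.op .add 31 31 60, .op .sub 31 31 40, .op .add 32 31 40]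
    (runBlock p.w p.S lowCode s) := runBlock_append _ _ _ _ _
  have hf := H.shape.four_le
  have hlt := hsearch.lt
  obtain ⟨⟨i, hi, hbit, hlow, h60⟩, hμ, hfr⟩ := runBlock_lowCode (w := p.w) (S := p.S) (f := p.f)
    (s := s) (by omega) (by have := H.f_lt; nlinarith) hz (h52 ▸ field_lt _ _ _ _)
    (hs 12 (by omega)) (hs 13 (by omega)) (hs 14 (by omega))
  set t := runBlock p.w p.S lowCode s
  have hb : ∀ j < p.f, (s.r 52).testBit j = p.treeBit s.μ (s.r 31 + j) := fun j hj => by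
    rw [h52, H.field_testBit hR.bdd (by omega) hj]
  rw [hb i hi, hR.bits] at hbit
  have hnone : ∀ x, s.r 31 ≤ x → x < s.r 31 + i → ¬ Shape.Has p.f p.N p.M F x := by
    intro x hx1 hx2 hx
    have h1 := hlow (x - s.r 31) (by omega)
    rw [hb _ (by omega), Nat.add_sub_cancel' hx1, (hR.bits x).2 ⟨by omega, hx⟩] at h1
    exact absurd h1 (by simp)
  obtain ⟨P', hP'⟩ := hsearch.right H.shape hbit.1 hnone
  have htree := H.tree_le
  have hadd := H.addr_lt (x := s.r 31 + (i + 1)) (by omega)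
  have h31 : s'.r 31 = s.r 31 + i := by
    simp only [hs', runBlock, Instr.natExec, BinOp.natEval, Function.update_apply, List.foldl_cons,
      List.foldl_nil, Nat.reduceEqDiff, if_true, if_false, h60, hfr 31 (by omega),
      hfr 40 (by omega), h40]
    rw [Nat.mod_eq_of_lt hadd, show 2 ^ p.w - 1 + (s.r 31 + (i + 1)) = s.r 31 + i + 2 ^ p.w by omega,
      Nat.add_mod_right, Nat.mod_eq_of_lt (by omega)]
  have h32 : s'.r 32 = s.r 31 + i + 1 := by
    rw [← h31]
    have : s'.r 32 = (s'.r 31 + 1) % 2 ^ p.w := by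
      simp only [hs', runBlock, Instr.natExec, BinOp.natEval, Function.update_apply,
        List.foldl_cons, List.foldl_nil, Nat.reduceEqDiff, if_true, if_false, hfr 40 (by omega), h40]
    rw [this, Nat.mod_eq_of_lt (by omega)]
  refine ⟨?_, fun j hj hj1 hj2 => ?_, by omega, by omega, h31 ▸ hbit.2, P', h31 ▸ hP'⟩
  · rw [hs', runBlock_mem _ _ _ _ (by decide), hμ]
  · rw [hs', runBlock_frame _ _ _ _ _ (by simp [Instr.dst]; omega), hfr j hj]

/-- The search downwards. -/
theorem down_spec (H : p.Valid) {F : ℕ → Prop} {s₀ : NatState} {h B : ℕ} (hs₀ : p.Regs a b c s₀)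
    (hR : p.Rep a b c F s₀.μ) (h40 : s₀.r 40 = 1)
    (hsearch : ∃ P, Shape.Search p.f p.N p.M F h (s₀.r 31) P)
    (hhas : Shape.Has p.f p.N p.M F (s₀.r 31)) (h32 : s₀.r 32 = s₀.r 31 + 1)
    (hB : p.N ≤ p.f ^ B * (s₀.r 31 + 1)) :
    Runs p.w p.S (.whl true 32 15 (.blk downCode)) s₀ (B * (22 + 2) + 2) fun s =>
      s.μ = s₀.μ ∧ (∀ i < 50, i ≠ 31 → i ≠ 32 → s.r i = s₀.r i) ∧
      s.r 32 = s.r 31 + 1 ∧ Shape.Has p.f p.N p.M F (s.r 31) ∧ p.N ≤ s.r 32 ∧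
      ∃ P, Shape.Search p.f p.N p.M F h (s.r 31) P := by
  have hf := H.shape.four_le
  refine Runs.whl B (fun k s => s.μ = s₀.μ ∧ (∀ i < 50, i ≠ 31 → i ≠ 32 → s.r i = s₀.r i) ∧
      s.r 32 = s.r 31 + 1 ∧ Shape.Has p.f p.N p.M F (s.r 31) ∧
      (∃ P, Shape.Search p.f p.N p.M F h (s.r 31) P) ∧
      p.f ^ k * (s₀.r 31 + 1) ≤ s.r 31 + 1) ?_ ?_ s₀ ?_
  · rintro k s ⟨hμ, hfr, hs32, hshas, ⟨P, hP⟩, hk⟩ htest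
    have hregs : p.Regs a b c s := Regs.frame hs₀ fun i hi => hfr i (by omega) (by omega) (by omega)
    have e5 : s.r 15 = p.N := hregs 5 (by omega)
    have e6 : s.r 16 = p.f := hregs 6 (by omega)
    have e15 : s.r 25 = 16 * p.w := hregs 15 (by omega)
    have hcN : s.r 31 + 1 < p.N := by
      have : s.r 32 < s.r 15 := htest
      omega
    refine ⟨?_, (Runs.blk (by decide) ?_).mono (le_of_eq rfl) fun _ h => h⟩
    · by_contra hkB
      have h1 : p.f ^ B ≤ p.f ^ k := Nat.pow_le_pow_right (by omega) (by omega)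
      have := Nat.mul_le_mul_right (s₀.r 31 + 1) h1
      omega
    have hdown := hP.down H.shape hcN
    have hdlt := hdown.lt
    have htree := H.tree_le
    unfold downCode
    rw [runBlock_append, runBlock_append]
    set t := runBlock p.w p.S [.op .mul 31 32 16, .op .add 50 25 31] s with ht
    have h31 : t.r 31 = p.f * (s.r 31 + 1) := by
      simp only [ht, runBlock, Instr.natExec, BinOp.natEval, Function.update_apply, List.foldl_cons,
        List.foldl_nil, Nat.reduceEqDiff, if_true, if_false, e6, hs32]
      rw [Nat.mod_eq_of_lt, mul_comm]
      rw [mul_comm]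
      exact H.addr_lt (by omega)
    have h50 : t.r 50 = 16 * p.w + p.f * (s.r 31 + 1) := by
      have : t.r 50 = (s.r 25 + t.r 31) % 2 ^ p.w := by
        simp only [ht, runBlock, Instr.natExec, BinOp.natEval, Function.update_apply,
          List.foldl_cons, List.foldl_nil, Nat.reduceEqDiff, if_true, if_false]
      rw [this, h31, e15]
      exact Nat.mod_eq_of_lt (H.addr_lt (by omega))
    have htfr : ∀ i < 50, i ≠ 31 → t.r i = s.r i := fun i hi hi' =>
      runBlock_frame _ _ _ _ _ (by simp [Instr.dst]; omega)
    have htregs : p.Regs a b c t := Regs.frame hregs fun i hi => htfr i (by omega) (by omega)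
    have htμ : t.μ = s.μ := runBlock_mem _ _ _ _ (by decide)
    obtain ⟨g1, g2, g3⟩ := H.readTree_spec htregs (by omega) h50
    set t' := runBlock p.w p.S (readCode 21) t
    have hRt : p.Rep a b c F t'.μ := by rw [g2, htμ, hμ]; exact hR
    have ht'31 : t'.r 31 = p.f * (s.r 31 + 1) := by rw [g3 31 (by omega), h31]
    have hz : t'.r 52 ≠ 0 := by
      rw [g1]
      intro hz
      obtain ⟨x, hx1, hx2, hx3, hx4⟩ := (H.shape.has_inner F hcN).1 hshas
      have h4 := (H.field_eq_zero_iff (g2 ▸ hRt.bdd) (by omega)).1 hz (x - p.f * (s.r 31 + 1))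
        (by omega)
      rw [Nat.add_sub_cancel' hx1, ← g2, (hRt.bits x).2 ⟨hx3, hx4⟩] at h4
      exact absurd h4 (by simp)
    obtain ⟨q1, q2, q3, q4, q5, q6⟩ := H.pickCode_spec (s := t')
      (Regs.frame htregs fun i hi => g3 i (by omega)) hRt
      (by rw [g3 40 (by omega), htfr 40 (by omega) (by omega),
        hfr 40 (by omega) (by omega) (by omega), h40])
      (ht'31.symm ▸ hdown) hz (by rw [g1, ht'31, g2])
    refine ⟨by rw [q1, g2, htμ, hμ], fun i hi hi1 hi2 => ?_, q4, q5, q6, ?_⟩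
    · rw [q2 i hi hi1 hi2, g3 i hi, htfr i hi hi1, hfr i hi hi1 hi2]
    · calc p.f ^ (k + 1) * (s₀.r 31 + 1) = p.f * (p.f ^ k * (s₀.r 31 + 1)) := by ring
        _ ≤ p.f * (s.r 31 + 1) := Nat.mul_le_mul_left _ hk
        _ ≤ _ := by rw [← ht'31]; omega
  · rintro k s ⟨hμ, hfr, hs32, hshas, hP, hk⟩ htest
    refine ⟨hμ, hfr, hs32, hshas, ?_, hP⟩
    have h15 : s.r 15 = p.N := by
      rw [hfr 15 (by omega) (by omega) (by omega)]; exact hs₀ 5 (by omega)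
    have : ¬ s.r 32 < s.r 15 := htest
    omega
  · exact ⟨rfl, fun _ _ _ _ => rfl, h32, hhas, hsearch, by simp⟩

/-- What stays the same while the bits of the tree are changed. -/
def SameOutside (p : Par) (μ μ' : ℕ → ℕ) : Prop :=
  (∀ i < 16, μ' i = μ i) ∧ ∀ x, p.valueBase ≤ x → bitAt p.w μ' x = bitAt p.w μ x

theorem SameOutside.value_eq (H : p.Valid) {μ μ' : ℕ → ℕ} (h : SameOutside p μ μ')
    (hμ : ∀ i, μ i < 2 ^ p.w) (hμ' : ∀ i, μ' i < 2 ^ p.w) (s : ℕ) :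
    p.value μ' s = p.value μ s :=
  field_congr hμ' hμ H.v_lt.le fun j _ => h.2 _ (by omega)

theorem clearCode_spec (H : p.Valid) {s : NatState} (hs : p.Regs a b c s)
    (h40 : s.r 40 = 1) (hx : s.r 31 < p.N + p.M - 1) :
    let s' := runBlock p.w p.S clearCode s
    (∀ x, p.treeBit s'.μ x = if x = s.r 31 then false else p.treeBit s.μ x) ∧
      SameOutside p s.μ s'.μ ∧ (∀ i < 50, i ≠ 31 → s'.r i = s.r i) ∧
      s'.r 31 = (2 ^ p.w - 1 + s.r 31 / p.f) % 2 ^ p.w ∧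
      s'.r 52 = field p.w s'.μ (16 * p.w + p.f * (s.r 31 / p.f)) p.f := by
  intro s'
  have hf := H.shape.four_le
  have hw := H.sixteen_lt
  have htree := H.tree_le
  have h16 : 16 * p.w + s.r 31 + 2 * p.w ≤ p.S * p.w := by omega
  have e6 : s.r 16 = p.f := hs 6 (by omega)
  have e15 : s.r 25 = 16 * p.w := hs 15 (by omega)
  set t₁ := runBlock p.w p.S [.op .add 50 25 31, .const 59 0] s with ht₁
  set t₂ := runBlock p.w p.S (writeCode 40) t₁ with ht₂
  set t₃ := runBlock p.w p.S [.op .div 31 31 16, .op .mul 50 31 16, .op .add 50 50 25] t₂ with ht₃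
  set t₄ := runBlock p.w p.S (readCode 21) t₃ with ht₄
  have hs' : s' = runBlock p.w p.S [.op .sub 31 31 40] t₄ := by
    simp only [s', clearCode, runBlock_append, ht₄, ht₃, ht₂, ht₁]
  have fr₁ : ∀ i < 50, t₁.r i = s.r i := fun i hi =>
    runBlock_frame _ _ _ _ _ (by simp [Instr.dst]; omega)
  have h50 : t₁.r 50 = 16 * p.w + s.r 31 := by
    simp only [ht₁, runBlock, Instr.natExec, BinOp.natEval, Function.update_apply, List.foldl_cons,
      List.foldl_nil, Nat.reduceEqDiff, if_true, if_false, e15]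
    exact Nat.mod_eq_of_lt (H.addr_lt (by omega))
  have h59 : t₁.r 59 = 0 := by simp [ht₁, runBlock, Instr.natExec]
  have hμ₁ : t₁.μ = s.μ := runBlock_mem _ _ _ _ (by decide)
  obtain ⟨w1, w2⟩ := runBlock_writeCode (w := p.w) (S := p.S) (s := t₁) (mask := 40) (g := 1)
    (by omega) ((fr₁ 13 (by omega)).trans (hs 3 (by omega))) (by omega)
    (by rw [fr₁ 40 (by omega), h40]; rfl) (by rw [h50]; exact H.addr_lt (by omega))
    (by rw [h50]; exact H.word_lt h16)
  rw [h50, h59, hμ₁] at w1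
  have fr₂ : ∀ i < 50, t₂.r i = s.r i := fun i hi => (w2 i hi).trans (fr₁ i hi)
  have hdiv : p.f * (s.r 31 / p.f) ≤ s.r 31 := Nat.mul_div_le _ _
  have fr₃ : ∀ i < 50, i ≠ 31 → t₃.r i = s.r i := fun i hi hi' => by
    rw [ht₃, runBlock_frame _ _ _ _ _ (by simp [Instr.dst]; omega), fr₂ i hi]
  have h31₃ : t₃.r 31 = s.r 31 / p.f := by
    simp only [ht₃, runBlock, Instr.natExec, BinOp.natEval, Function.update_apply, List.foldl_cons,
      List.foldl_nil, Nat.reduceEqDiff, if_true, if_false, fr₂ 31 (by omega), fr₂ 16 (by omega), e6]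
  have h50₃ : t₃.r 50 = 16 * p.w + p.f * (s.r 31 / p.f) := by
    simp only [ht₃, runBlock, Instr.natExec, BinOp.natEval, Function.update_apply, List.foldl_cons,
      List.foldl_nil, Nat.reduceEqDiff, if_true, if_false, fr₂ 31 (by omega), fr₂ 16 (by omega), e6,
      fr₂ 25 (by omega), e15]
    rw [mul_comm (_ / _), Nat.mod_eq_of_lt (a := p.f * _) (H.addr_lt (by omega)), add_comm]
    exact Nat.mod_eq_of_lt (H.addr_lt (by omega))
  have hμ₃ : t₃.μ = t₂.μ := runBlock_mem _ _ _ _ (by decide)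
  obtain ⟨g1, g2, g3⟩ := H.readTree_spec
    (Regs.frame hs fun i hi => fr₃ i (by omega) (by omega)) (by omega) h50₃
  have hμ' : s'.μ = t₂.μ := by rw [hs', runBlock_mem _ _ _ _ (by decide), g2, hμ₃]
  refine ⟨fun x => ?_, ⟨fun i hi => ?_, fun x hx' => ?_⟩, fun i hi hi' => ?_, ?_, ?_⟩
  · rw [hμ', w1]
    unfold Par.treeBit
    rw [bitAt_setField (by omega) (by omega) (by simp)]
    by_cases h : x = s.r 31
    · subst h; simp
    · rw [if_neg (by omega), if_neg h]
  · rw [hμ', w1]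
    refine setField_of_lt ?_
    have : 16 ≤ (16 * p.w + s.r 31) / p.w := by
      rw [Nat.le_div_iff_mul_le (by omega)]; omega
    omega
  · rw [hμ', w1, bitAt_setField (by omega) (by omega) (by simp), if_neg]
    unfold Par.valueBase at hx'; omega
  · rw [hs', runBlock_frame _ _ _ _ _ (by simp [Instr.dst]; omega), g3 i hi, fr₃ i hi hi']
  · have e40 : t₄.r 40 = 1 := by rw [ht₄, g3 40 (by omega), fr₃ 40 (by omega) (by omega), h40]
    have e31 : t₄.r 31 = s.r 31 / p.f := by rw [ht₄, g3 31 (by omega), h31₃]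
    simp only [hs', runBlock, List.foldl_cons, List.foldl_nil, Instr.natExec, BinOp.natEval,
      Function.update_self, e40, e31]
  · rw [hs', runBlock_frame _ _ _ _ _ (by simp [Instr.dst]), ← hs', hμ', g1, hμ₃]

/-- The update of the tree after the slot at distance `P` from `h` has been occupied. -/
theorem clear_spec (H : p.Valid) {F : ℕ → Prop} {s₀ : NatState} {h P B : ℕ}
    (hs₀ : p.Regs a b c s₀) (hbdd : s₀.Bdd p.w) (h40 : s₀.r 40 = 1) (h41 : s₀.r 41 = 0)
    (h52 : s₀.r 52 = 0) (hh : h < p.M) (hex : ∃ s < p.M, F s)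
    (hP : ∀ r ≤ P, ¬ F ((h + r) % p.M)) (h31 : s₀.r 31 = (h + P) % p.M + p.N - 1)
    (hpend : Shape.Pending p.f p.N p.M F (s₀.r 31) (p.treeBit s₀.μ)) (hB2 : 2 ≤ B)
    (hB : ∀ k, Shape.Arc p.M F h (p.f ^ k) → k + 2 < B) :
    Runs p.w p.S (.whl false 52 41 (.blk clearCode)) s₀ (B * (36 + 2) + 2) fun s =>
      s.Bdd p.w ∧ SameOutside p s₀.μ s.μ ∧ Shape.Bits p.f p.N p.M F (p.treeBit s.μ) ∧
      s.r 34 = s₀.r 34 := by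
  have hf := H.shape.four_le
  have hN := H.shape.one_le
  have hM := H.shape.two_le
  have hslot : (h + P) % p.M < p.M := H.home_lt _
  refine Runs.whl B (fun k s => s.Bdd p.w ∧ SameOutside p s₀.μ s.μ ∧
      (∀ i < 50, i ≠ 31 → s.r i = s₀.r i) ∧
      ((s.r 52 = 0 ∧ s.r 31 < p.N + p.M - 1 ∧ ¬ Shape.Has p.f p.N p.M F (s.r 31) ∧
        Shape.Has p.f p.N p.M (· = (h + P) % p.M) (s.r 31) ∧
        Shape.Pending p.f p.N p.M F (s.r 31) (p.treeBit s.μ) ∧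
        p.f ^ k * (s.r 31 + 1) ≤ p.N + p.M - 1) ∨
      (s.r 52 ≠ 0 ∧ Shape.Bits p.f p.N p.M F (p.treeBit s.μ)))) ?_ ?_ s₀ ?_
  · rintro k s ⟨hb, hsame, hfr, hI⟩ htest
    have hz : s.r 52 = 0 := by
      have : s.r 52 = s.r 41 := htest
      rw [this, hfr 41 (by omega) (by omega), h41]
    obtain ⟨-, hlt, hfull, hunder, hpen, hpow⟩ | hI := hI
    swap
    · exact absurd hz hI.1
    refine ⟨?_, (Runs.blk (by decide) ?_).mono (le_of_eq rfl) fun _ h => h⟩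
    · rcases k with _ | k
      · omega
      · have := hB k (H.shape.arc_of_anc hh hfull hP hunder hpow)
        omega
    have hregs : p.Regs a b c s := Regs.frame hs₀ fun i hi => hfr i (by omega) (by omega)
    obtain ⟨q1, q2, q3, q4, q5⟩ := H.clearCode_spec hregs
      ((hfr 40 (by omega) (by omega)).trans h40) hlt
    have hb' := hb.runBlock p.S clearCode
    set s' := runBlock p.w p.S clearCode s
    have hdiv : p.f * (s.r 31 / p.f) ≤ s.r 31 := Nat.mul_div_le _ _
    have hzero := H.field_eq_zero_iff hb'.2 (x := p.f * (s.r 31 / p.f)) (by omega)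
    rw [← q5] at hzero
    obtain ⟨hc1, hc2⟩ := hpen.clear H.shape hlt hfull q1 hex
    refine ⟨hb', ⟨fun i hi => (q2.1 i hi).trans (hsame.1 i hi),
      fun x hx => (q2.2 x hx).trans (hsame.2 x hx)⟩,
      fun i hi hi' => (q3 i hi hi').trans (hfr i hi hi'), ?_⟩
    by_cases hz' : s'.r 52 = 0
    · left
      obtain ⟨g1, g2, g3⟩ := hc1 (hzero.1 hz')
      have hd1 : 1 ≤ s.r 31 / p.f := (Nat.one_le_div_iff (by omega)).2 g1
      have hd2 : s.r 31 / p.f ≤ s.r 31 := Nat.div_le_self _ _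
      have hlt2 : s.r 31 < 2 ^ p.w := hb.1 31
      have e31 : s'.r 31 = s.r 31 / p.f - 1 := by
        rw [q4, show 2 ^ p.w - 1 + s.r 31 / p.f = (s.r 31 / p.f - 1) + 2 ^ p.w by omega,
          Nat.add_mod_right, Nat.mod_eq_of_lt (by omega)]
      rw [e31]
      refine ⟨hz', by omega, g2, H.shape.has_parent hlt g1 hunder, g3, ?_⟩
      rw [Nat.sub_add_cancel hd1]
      calc p.f ^ (k + 1) * (s.r 31 / p.f) = p.f ^ k * (p.f * (s.r 31 / p.f)) := by ring
        _ ≤ p.f ^ k * (s.r 31 + 1) := Nat.mul_le_mul_left _ (by omega)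
        _ ≤ _ := hpow
    · right
      refine ⟨hz', hc2 ?_⟩
      by_contra hno
      push Not at hno
      exact hz' (hzero.2 fun i hi => by simpa using hno i hi)
  · rintro k s ⟨hb, hsame, hfr, hI⟩ htest
    have hz : s.r 52 ≠ 0 := fun hz => htest (by
      show s.r 52 = s.r 41
      rw [hz, hfr 41 (by omega) (by omega), h41])
    obtain hI | hI := hI
    · exact absurd hI.1 hz
    · exact ⟨hb, hsame, hI.2, hfr 34 (by omega) (by omega)⟩
  · refine ⟨hbdd, ⟨fun _ _ => rfl, fun _ _ => rfl⟩, fun _ _ _ => rfl, Or.inl ⟨h52, ?_, ?_, ?_, hpend, ?_⟩⟩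
    · omega
    · rw [Shape.has_leaf F (by omega) (by omega),
        show s₀.r 31 + 1 - p.N = (h + P) % p.M by omega]
      exact hP P le_rfl
    · rw [Shape.has_leaf _ (by omega) (by omega)]
      omega
    · rw [pow_zero, one_mul]; omega

theorem placeCode_spec (H : p.Valid) {s : NatState} {P : ℕ} (hs : p.Regs a b c s)
    (hh : s.r 30 < p.M) (hP : P < p.M) (h32 : s.r 32 < p.N + p.M)
    (hslot : (s.r 30 + P) % p.M + p.N = s.r 32) :
    let s' := runBlock p.w p.S placeCode s
    s'.r 34 = P ∧ s'.r 52 = 0 ∧ (∀ i < 50, i ≠ 33 → i ≠ 34 → s'.r i = s.r i) ∧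
      s'.μ = setField p.w s.μ (p.valueBase + (s.r 30 + P) % p.M * p.v) p.v (s.r 1) := by
  intro s'
  set σ := (s.r 30 + P) % p.M with hσ
  have hσM : σ < p.M := H.home_lt _
  have htree := H.tree_le
  have hval := H.value_le hσM
  have e4 : s.r 14 = p.M := hs 4 (by omega)
  have e5 : s.r 15 = p.N := hs 5 (by omega)
  have e8 : s.r 18 = p.valueBase := hs 8 (by omega)
  have e9 : s.r 19 = p.v := hs 9 (by omega)
  set t := runBlock p.w p.S [.op .sub 33 32 15, .op .add 34 33 14, .op .sub 34 34 30,
    .op .mod 34 34 14, .op .mul 50 33 19, .op .add 50 50 18, .op .or 59 1 1] s with ht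
  have hs' : s' = runBlock p.w p.S [.const 52 0] (runBlock p.w p.S (writeCode 20) t) := by
    simp only [s', placeCode, runBlock_append, ht]
  have hb1 : p.N + p.M < 2 ^ p.w := H.addr_lt (by omega)
  have hb2 : σ + p.M < 2 ^ p.w := H.addr_lt (by omega)
  have hsub1 : (2 ^ p.w - p.N + s.r 32) % 2 ^ p.w = σ := by
    rw [← hslot, show 2 ^ p.w - p.N + (σ + p.N) = σ + 2 ^ p.w by omega, Nat.add_mod_right,
      Nat.mod_eq_of_lt (by omega)]
  have hsub2 : (2 ^ p.w - s.r 30 + (σ + p.M)) % 2 ^ p.w = σ + p.M - s.r 30 := by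
    rw [show 2 ^ p.w - s.r 30 + (σ + p.M) = (σ + p.M - s.r 30) + 2 ^ p.w by omega,
      Nat.add_mod_right, Nat.mod_eq_of_lt (by omega)]
  have hoff : (σ + p.M - s.r 30) % p.M = P := by
    have h1 : σ + p.M - s.r 30 + s.r 30 ≡ P + s.r 30 [MOD p.M] := by
      rw [Nat.sub_add_cancel (by omega)]
      show (σ + p.M) % p.M = _
      rw [Nat.add_mod_right, hσ, Nat.mod_mod, add_comm]
    have h2 := Nat.ModEq.add_right_cancel' _ h1
    rw [h2, Nat.mod_eq_of_lt hP]
  have hfr : ∀ i < 50, i ≠ 33 → i ≠ 34 → t.r i = s.r i := fun i hi h1 h2 =>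
    runBlock_frame _ _ _ _ _ (by simp [Instr.dst]; omega)
  have h34 : t.r 34 = P := by
    simp only [ht, runBlock, Instr.natExec, BinOp.natEval, Function.update_apply, List.foldl_cons,
      List.foldl_nil, Nat.reduceEqDiff, if_true, if_false, e4, e5, hsub1, Nat.mod_eq_of_lt hb2,
      hsub2, hoff]
  have h50 : t.r 50 = p.valueBase + σ * p.v := by
    simp only [ht, runBlock, Instr.natExec, BinOp.natEval, Function.update_apply, List.foldl_cons,
      List.foldl_nil, Nat.reduceEqDiff, if_true, if_false, e5, e8, e9, hsub1]
    rw [Nat.mod_eq_of_lt (a := σ * p.v) (H.addr_lt (by omega)), add_comm]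
    exact Nat.mod_eq_of_lt (H.addr_lt (by omega))
  have h59 : t.r 59 = s.r 1 := by
    simp [ht, runBlock, Instr.natExec, BinOp.natEval]
  have hμ : t.μ = s.μ := runBlock_mem _ _ _ _ (by decide)
  obtain ⟨w1, w2⟩ := runBlock_writeCode (w := p.w) (S := p.S) (s := t) (mask := 20) (g := p.v)
    (by omega) ((hfr 13 (by omega) (by omega) (by omega)).trans (hs 3 (by omega)))
    (by have := H.sixteen_lt; omega)
    ((hfr 20 (by omega) (by omega) (by omega)).trans (hs 10 (by omega)))
    (by rw [h50]; exact H.addr_lt (by omega)) (by rw [h50]; exact H.word_lt (by omega))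
  rw [h50, h59, hμ] at w1
  refine ⟨?_, ?_, fun i hi h1 h2 => ?_, ?_⟩
  · rw [hs', runBlock_frame _ _ _ _ _ (by simp [Instr.dst]), w2 34 (by omega), h34]
  · rw [hs']; simp [Instr.natExec, runBlock]
  · rw [hs', runBlock_frame _ _ _ _ _ (by simp [Instr.dst]; omega), w2 i hi, hfr i hi h1 h2]
  · rw [hs', runBlock_mem _ _ _ _ (by decide), w1]

/-- The insertion finds the first free slot from the home of the key on. Its time is governed by the
number of scales `f ^ i` at which the home lies on an arc of `f ^ i` slots without free ones. -/
theorem insert_spec (H : p.Valid) {O : Finset ℕ} {s : NatState} (hbdd : s.Bdd p.w)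
    (hR : p.Rep a b c (· ∉ O) s.μ) (hy : s.r 1 < 2 ^ p.v) {h σ B : ℕ}
    (hh : h = hashTop p.w a b c (s.r 0) % p.M) (hσ : σ = (h + disp p.M h O) % p.M)
    (hex : ∃ s < p.M, s ∉ insert σ O) (hB2 : 2 ≤ B)
    (hB : ∀ k, Shape.Arc p.M (· ∉ insert σ O) h (p.f ^ k) → k + 2 < B) :
    Runs p.w p.S insertCmd s (100 * B + 200) fun s' =>
      s'.r 0 = disp p.M h O ∧ p.Rep a b c (· ∉ insert σ O) s'.μ ∧
      p.value s'.μ σ = s.r 1 ∧ ∀ t, t ≠ σ → p.value s'.μ t = p.value s.μ t := by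
  have hN := H.shape.one_le
  have hM := H.shape.two_le
  have hfw := H.f_lt_w
  have htree := H.tree_le
  have hhM : h < p.M := hh ▸ H.home_lt _
  have hex' : ∃ s < p.M, s ∉ O := by
    obtain ⟨s, h1, h2⟩ := hex
    exact ⟨s, h1, fun h3 => h2 (Finset.mem_insert_of_mem h3)⟩
  obtain ⟨hd1, hd2, hd3⟩ := disp_spec (h := h) hex'
  have hB' : ∀ k, Shape.Arc p.M (· ∉ O) h (p.f ^ k) → k + 2 < B := fun k hk =>
    hB k (hk.mono fun s h1 h2 => h1 (Finset.mem_insert_of_mem h2))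
  -- preparation
  have hprep : Runs p.w p.S (.blk (loadCode 16 ++ homeCode ++ searchStartCode)) s 44 fun t =>
      t.Bdd p.w ∧ p.Regs a b c t ∧ t.μ = s.μ ∧ t.r 1 = s.r 1 ∧ t.r 30 = h ∧ t.r 40 = 1 ∧ t.r 41 = 0 ∧
      t.r 52 = 0 ∧ t.r 31 = p.f * (p.N + h - 1) := by
    refine (Runs.blk (by simp [straight_loadCode]; decide) ?_).mono
      (by simp [length_loadCode]; decide) fun _ h => h
    have hb := hbdd.runBlock p.S (loadCode 16 ++ homeCode ++ searchStartCode)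
    obtain ⟨h1, h2, h3, h4⟩ := H.prefix_spec hR
    rw [runBlock_append] at hb ⊢
    set t := runBlock p.w p.S (loadCode 16 ++ homeCode) s
    rw [← hh] at h2
    have e5 : t.r 15 = p.N := h1 5 (by omega)
    have e6 : t.r 16 = p.f := h1 6 (by omega)
    have hone : 1 < 2 ^ p.w := Nat.one_lt_two_pow (by have := H.sixteen_lt; omega)
    have hadd : p.N + h < 2 ^ p.w := H.addr_lt (by omega)
    have hmul : (p.N + h - 1) * p.f < 2 ^ p.w := by
      have := H.small
      have h5 : (p.N + h - 1) * p.f ≤ (p.S * p.w) * p.w :=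
        Nat.mul_le_mul (by omega) hfw.le
      rw [mul_comm (p.S * p.w)] at h5
      omega
    refine ⟨hb, Regs.frame h1 fun i hi => ?_, ?_, ?_, ?_, ?_, ?_, ?_, ?_⟩
    · exact runBlock_frame _ _ _ _ _ (by simp [searchStartCode, Instr.dst]; omega)
    · rw [runBlock_mem _ _ _ _ (by decide), h4]
    · rw [runBlock_frame _ _ _ _ _ (by simp [searchStartCode, Instr.dst]), h3 1 (by omega)]
    · rw [runBlock_frame _ _ _ _ _ (by simp [searchStartCode, Instr.dst]), h2]
    · simp [searchStartCode, runBlock, Instr.natExec, Nat.mod_eq_of_lt hone]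
    · simp [searchStartCode, runBlock, Instr.natExec]
    · simp [searchStartCode, runBlock, Instr.natExec]
    · simp only [searchStartCode, runBlock, Instr.natExec, BinOp.natEval, Function.update_apply,
        List.foldl_cons, List.foldl_nil, Nat.reduceEqDiff, if_true, if_false, e5, e6, h2,
        Nat.mod_eq_of_lt hadd, Nat.mod_eq_of_lt hone]
      rw [show 2 ^ p.w - 1 + (p.N + h) = p.N + h - 1 + 2 ^ p.w by omega, Nat.add_mod_right,
        Nat.mod_eq_of_lt (a := p.N + h - 1) (by omega), Nat.mod_eq_of_lt hmul, mul_comm]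
  obtain ⟨t, T₁, x₁, l₁, t1, t2, t3, t4, t5, t6, t7, t8, t9⟩ := hprep
  obtain ⟨u, T₂, x₂, l₂, u1, u2, ⟨P, u3⟩, u4, u5, u6⟩ :=
    H.up_spec t2 (t3 ▸ hR) t7 t8 hhM t9 hex' hB2 hB'
  have hRu : p.Rep a b c (· ∉ O) u.μ := by rw [u1, t3]; exact hR
  have hregu : p.Regs a b c u := Regs.frame t2 fun i hi => u2 i (by omega) (by omega)
  have u40 : u.r 40 = 1 := (u2 40 (by omega) (by omega)).trans t6
  have x₃ : Exec p.w p.S (.blk pickCode) u _ _ := .blk pickCode u (by decide)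
  obtain ⟨p1, p2, p3, p4, p5, p6⟩ := H.pickCode_spec hregu hRu u40 u3 u5 u6
  set x := runBlock p.w p.S pickCode u
  have hregx : p.Regs a b c x := Regs.frame hregu fun i hi =>
    p2 i (by omega) (by omega) (by omega)
  obtain ⟨y, T₄, x₄, l₄, d1, d2, d3, d4, d5, P, d6⟩ := H.down_spec (B := B) hregx (p1 ▸ hRu)
    ((p2 40 (by omega) (by omega) (by omega)).trans u40) p6 p5 p4
    (u4.trans (Nat.mul_le_mul_left _ (by omega)))
  have hregy : p.Regs a b c y := Regs.frame hregx fun i hi =>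
    d2 i (by omega) (by omega) (by omega)
  have frame : ∀ i < 50, i ≠ 31 → i ≠ 32 → y.r i = t.r i := fun i hi h1 h2 => by
    rw [d2 i hi h1 h2, p2 i hi h1 h2, u2 i hi h1]
  have hyμ : y.μ = s.μ := by rw [d1, p1, u1, t3]
  -- the leaf that has been found is the first free slot
  obtain ⟨f1, f2⟩ := d6.finish (by omega) d4
  have hdisp : disp p.M h O = P := disp_eq f2 fun r hr => by simpa using d6.none r hr
  rw [hdisp] at hσ hd1 hd3 ⊢
  have hylt := d6.lt
  have y30 : y.r 30 = h := (frame 30 (by omega) (by omega) (by omega)).trans t5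
  have y1 : y.r 1 = s.r 1 := (frame 1 (by omega) (by omega) (by omega)).trans t4
  have x₅ : Exec p.w p.S (.blk placeCode) y _ _ := .blk placeCode y (by decide)
  obtain ⟨z1, z2, z3, z4⟩ := H.placeCode_spec hregy (y30 ▸ hhM) hd1 (by omega)
    (by rw [y30, f1]; omega)
  have zb := (x₄.bdd (x₃.bdd (x₂.bdd t1))).runBlock p.S placeCode
  set z := runBlock p.w p.S placeCode y
  rw [y30, y1, hyμ, ← hσ] at z4
  have hRz : p.Rep a b c (· ∉ O) z.μ := H.rep_setField hR zb.2 hy z4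
  obtain ⟨v1, v2⟩ := H.value_setField hR.bdd zb.2 hy z4
  have z31 : z.r 31 = (h + P) % p.M + p.N - 1 := by
    rw [z3 31 (by omega) (by omega) (by omega), f1]; omega
  have hσM : σ < p.M := hσ ▸ H.home_lt _
  have hσO : σ ∉ O := hσ ▸ f2
  obtain ⟨r, T₆, x₆, l₆, r1, r2, r3, r4⟩ := H.clear_spec (F := (· ∉ insert σ O)) (h := h) (P := P)
    (B := B) (Regs.frame hregy fun i hi => z3 i (by omega) (by omega) (by omega)) zb
    (by rw [z3 40 (by omega) (by omega) (by omega), frame 40 (by omega) (by omega) (by omega), t6])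
    (by rw [z3 41 (by omega) (by omega) (by omega), frame 41 (by omega) (by omega) (by omega), t7])
    z2 hhM hex
    (fun r hr => by
      rcases hr.lt_or_eq with hr | rfl
      · simpa using fun _ => hd3 r hr
      · simp [← hσ])
    z31
    (by
      rw [z31, ← hσ]
      refine Shape.Bits.pending H.shape hσM (fun t => ?_) hRz.bits
      by_cases ht : t = σ
      · subst ht; simp [hσO]
      · simp [ht])
    hB2 hB
  have x₇ : Exec p.w p.S (.blk [.op .or 0 34 34]) r _ _ := .blk _ r (by decide)
  set q := runBlock p.w p.S [.op .or 0 34 34] r with hq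
  have q1 : q.r 0 = r.r 34 := by simp [hq, runBlock, Instr.natExec, BinOp.natEval]
  have q2 : q.μ = r.μ := runBlock_mem _ _ _ _ (by decide)
  have e3 : pickCode.length = 9 := by decide
  have e5 : placeCode.length = 27 := by decide
  refine ⟨q, _, .seq x₁ (.seq x₂ (.seq x₃ (.seq x₄ (.seq x₅ (.seq x₆ x₇))))), ?_, ?_, ?_, ?_, ?_⟩
  · simp only [List.length_cons, List.length_nil]
    omega
  · rw [q1, r4, z1]
  · rw [q2]
    exact ⟨r1.2, fun i hi => (r2.1 i hi).trans (hRz.header i hi), r3⟩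
  · rw [q2, r2.value_eq H hRz.bdd r1.2, v1]
  · intro j hj
    rw [q2, r2.value_eq H hRz.bdd r1.2, v2 j hj]

end Par.Valid

end OffsetTable

/-! ### The creation of the structure -/

namespace OffsetTable

open WordRAM

/-- Computation of the number of slots, and preparation of the computation of the degree. -/
def slotsCode : List Instr :=
  [.const 40 1, .op .div 14 1 4, .op .add 14 14 1, .op .add 14 14 40, .op .or 13 4 4,
    .op .or 19 2 2, .const 42 2, .op .div 17 4 42, .const 16 3, .const 43 0]

/-- Test of the next degree: register `43` gets the product of the two numbers that follow it. -/
def degreeCode : List Instr :=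
  [.op .add 16 16 40, .op .add 44 16 40, .op .add 43 44 40, .op .mul 43 43 44]

/-- Computation of the number of inner nodes and of the bit address of the first value. -/
def baseCode : List Instr :=
  [.const 42 2, .op .sub 44 16 40, .op .sub 45 14 42, .op .div 45 45 44, .op .add 15 45 40, .const 42 16,
    .op .mul 25 42 4, .op .add 18 15 14, .op .add 18 18 16, .op .add 18 25 18]

/-- Computation of the masks. -/
def maskCode : List Instr :=
  [.op .shl 20 40 2, .op .sub 20 20 40, .op .shl 21 40 16, .op .sub 21 21 40, .op .add 44 16 40,
    .op .shl 24 40 44, .op .sub 24 24 40, .op .mul 45 16 16, .op .shl 45 40 45, .op .sub 45 45 40,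
    .op .div 22 45 21, .op .mul 45 44 16, .op .shl 45 40 45, .op .sub 45 45 40, .op .div 23 45 24]

/-- Code that stores `n` registers from `13` on in the words from `3` on. -/
def storeCode (n : ℕ) : List Instr :=
  (List.range n).flatMap fun i => [.const 9 (3 + i), .store 9 (13 + i)]

/-- Code that writes register `59` into the bit of the tree that register `31` points to. -/
def fillCode : List Instr := [.op .add 50 25 31] ++ writeCode 40 ++ [.op .add 31 31 40]

/-- The program for the creation of the structure. -/
def initCmd : Cmd :=
  .seq (.blk slotsCode) <|
  .seq (.whl true 43 4 (.blk degreeCode)) <|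
  .seq (.blk (baseCode ++ maskCode ++ storeCode 13 ++
    [.const 31 0, .const 59 0, .op .add 45 15 14, .op .add 45 45 16])) <|
  .seq (.whl true 31 45 (.blk fillCode)) <|
  .seq (.blk [.const 31 0, .const 59 1, .op .sub 45 45 16, .op .sub 45 45 40])
    (.whl true 31 45 (.blk fillCode))

theorem straight_storeCode (n : ℕ) : (storeCode n).all Instr.straight = true := by
  simp [storeCode, Instr.straight]

theorem runBlock_storeCode {w S : ℕ} (s : NatState) (n : ℕ) (hn : 3 + n ≤ 2 ^ w) (hS : 3 + n ≤ S) :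
    (∀ i, (runBlock w S (storeCode n) s).μ i = if 3 ≤ i ∧ i < 3 + n then s.r (10 + i) else s.μ i) ∧
    (∀ i, i ≠ 9 → (runBlock w S (storeCode n) s).r i = s.r i) := by
  induction n with
  | zero => exact ⟨fun i => by rw [if_neg (by omega)]; rfl, fun i _ => rfl⟩
  | succ n ih =>
    obtain ⟨h1, h2⟩ := ih (by omega) (by omega)
    have e : storeCode (n + 1) = storeCode n ++ [.const 9 (3 + n), .store 9 (13 + n)] := by
      simp [storeCode, List.range_succ]
    rw [e, runBlock_append]
    set t := runBlock w S (storeCode n) s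
    refine ⟨fun i => ?_, fun i hi => ?_⟩
    · simp only [runBlock, Instr.natExec, List.foldl_cons, List.foldl_nil, Function.update_apply,
        if_true]
      rw [Nat.mod_eq_of_lt (a := 3 + n) (by omega), if_neg (show 13 + n ≠ 9 by omega),
        h2 _ (by omega), h1]
      by_cases hin : i = 3 + n
      · subst hin
        rw [if_pos ⟨rfl, by omega⟩, if_pos (by omega), show 10 + (3 + n) = 13 + n by omega]
      · rw [if_neg (by omega)]
        by_cases h : 3 ≤ i ∧ i < 3 + n
        · rw [if_pos h, if_pos (by omega)]
        · rw [if_neg h, if_neg (by omega)]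
    · simp only [runBlock, Instr.natExec, List.foldl_cons, List.foldl_nil, Function.update_apply,
        if_neg hi]
      exact h2 i hi

namespace Par.Valid

variable {p : Par}

theorem fill_spec (H : p.Valid) {s₀ : NatState} {E y : ℕ} (hbdd : s₀.Bdd p.w) (hy : y < 2)
    (h13 : s₀.r 13 = p.w) (h25 : s₀.r 25 = 16 * p.w) (h40 : s₀.r 40 = 1) (h31 : s₀.r 31 = 0)
    (h45 : s₀.r 45 = E) (h59 : s₀.r 59 = y) (hE : E ≤ p.N + p.M + p.f) :
    Runs p.w p.S (.whl true 31 45 (.blk fillCode)) s₀ (E * (21 + 2) + 2) fun s =>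
      s.Bdd p.w ∧ (∀ i < 50, i ≠ 31 → s.r i = s₀.r i) ∧ (∀ i < 16, s.μ i = s₀.μ i) ∧
      ∀ x, p.treeBit s.μ x = if x < E then decide (y = 1) else p.treeBit s₀.μ x := by
  have hw := H.sixteen_lt
  have htree := H.tree_le
  refine Runs.whl E (fun k s => s.Bdd p.w ∧ k ≤ E ∧ s.r 31 = k ∧ s.r 59 = y ∧
      (∀ i < 50, i ≠ 31 → s.r i = s₀.r i) ∧ (∀ i < 16, s.μ i = s₀.μ i) ∧
      ∀ x, p.treeBit s.μ x = if x < k then decide (y = 1) else p.treeBit s₀.μ x) ?_ ?_ s₀ ?_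
  · rintro k s ⟨hb, hk, hs31, hs59, hfr, hlow, hbits⟩ htest
    have e45 : s.r 45 = E := by rw [hfr 45 (by omega) (by omega), h45]
    have hkE : k < E := by
      have : s.r 31 < s.r 45 := htest
      omega
    refine ⟨hkE, (Runs.blk (by decide) ?_).mono (le_of_eq rfl) fun _ h => h⟩
    have hb' := hb.runBlock p.S fillCode
    set s' := runBlock p.w p.S fillCode s
    set t := runBlock p.w p.S [.op .add 50 25 31] s with ht
    have hs' : s' = runBlock p.w p.S [.op .add 31 31 40] (runBlock p.w p.S (writeCode 40) t) := by
      simp only [s', fillCode, runBlock_append, ht]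
    have fr : ∀ i, i ≠ 50 → t.r i = s.r i := fun i hi =>
      runBlock_frame _ _ _ _ _ (by simp [Instr.dst]; omega)
    have h50 : t.r 50 = 16 * p.w + k := by
      simp only [ht, runBlock, Instr.natExec, BinOp.natEval, List.foldl_cons,
        List.foldl_nil, Function.update_self, hs31, hfr 25 (by omega) (by omega), h25]
      exact Nat.mod_eq_of_lt (H.addr_lt (by omega))
    have e40 : s.r 40 = 1 := (hfr 40 (by omega) (by omega)).trans h40
    obtain ⟨w1, w2⟩ := runBlock_writeCode (w := p.w) (S := p.S) (s := t) (mask := 40) (g := 1)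
      (by omega) ((fr 13 (by omega)).trans ((hfr 13 (by omega) (by omega)).trans h13)) (by omega)
      (by rw [fr 40 (by omega), e40]; rfl) (by rw [h50]; exact H.addr_lt (by omega))
      (by rw [h50]; exact H.word_lt (by omega))
    rw [h50, fr 59 (by omega), hs59, show t.μ = s.μ from rfl] at w1
    have hμ' : s'.μ = setField p.w s.μ (16 * p.w + k) 1 y := by
      rw [hs', runBlock_mem _ _ _ _ (by decide), w1]
    refine ⟨hb', hkE, ?_, ?_, fun i hi hi' => ?_, fun i hi => ?_, fun x => ?_⟩
    · have : s'.r 31 = (s.r 31 + 1) % 2 ^ p.w := by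
        rw [hs', ← fr 31 (by omega), ← w2 31 (by omega), ← e40, ← fr 40 (by omega),
          ← w2 40 (by omega)]
        simp only [runBlock, List.foldl_cons, List.foldl_nil, Instr.natExec, BinOp.natEval,
          Function.update_self]
      rw [this, hs31, Nat.mod_eq_of_lt (H.addr_lt (by omega))]
    · rw [hs', runBlock_frame _ _ _ _ _ (by simp [Instr.dst]),
        runBlock_frame _ _ _ _ _ (by simp [writeCode, Instr.dst]), fr 59 (by omega), hs59]
    · rw [hs', runBlock_frame _ _ _ _ _ (by simp [Instr.dst]; omega), w2 i hi, fr i (by omega),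
        hfr i hi hi']
    · rw [hμ', ← hlow i hi]
      refine setField_of_lt ?_
      have : 16 ≤ (16 * p.w + k) / p.w := by
        rw [Nat.le_div_iff_mul_le (by omega)]; omega
      omega
    · rw [hμ']
      unfold Par.treeBit
      rw [bitAt_setField (by omega) (by omega) (by omega)]
      by_cases h : x = k
      · subst h
        have : y = 0 ∨ y = 1 := by omega
        rcases this with rfl | rfl <;> simp
        all_goals omega
      · rw [if_neg (by omega)]
        have := hbits x
        unfold Par.treeBit at this
        rw [this]
        by_cases h' : x < k
        · rw [if_pos h', if_pos (by omega)]
        · rw [if_neg h', if_neg (by omega)]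
  · rintro k s ⟨hb, hk, hs31, hs59, hfr, hlow, hbits⟩ htest
    have e45 : s.r 45 = E := by rw [hfr 45 (by omega) (by omega), h45]
    have hkE : k = E := by
      have : ¬ s.r 31 < s.r 45 := htest
      omega
    subst hkE
    exact ⟨hb, hfr, hlow, hbits⟩
  · exact ⟨hbdd, by omega, h31, h59, fun _ _ _ => rfl, fun _ _ => rfl, by simp⟩

theorem degree_spec (H : p.Valid) (hf : p.w ≤ (p.f + 1) * (p.f + 2)) {s₀ : NatState}
    (h4 : s₀.r 4 = p.w) (h40 : s₀.r 40 = 1) (h16 : s₀.r 16 = 3) (h43 : s₀.r 43 = 0) :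
    Runs p.w p.S (.whl true 43 4 (.blk degreeCode)) s₀ (p.f * (4 + 2) + 2) fun s =>
      s.r 16 = p.f ∧ s.μ = s₀.μ ∧ ∀ i < 43, i ≠ 16 → s.r i = s₀.r i := by
  have hw := H.sixteen_lt
  have hlt := H.f_lt
  have hf4 := H.shape.four_le
  have htree := H.tree_le
  have hmono : ∀ j, j ≤ p.f → (j + 1) * (j + 2) < 2 ^ p.w := fun j hj => by
    have : (j + 1) * (j + 2) ≤ (p.f + 1) * (p.f + 2) := Nat.mul_le_mul (by omega) (by omega)
    refine H.addr_lt (this.trans ?_)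
    nlinarith
  refine Runs.whl p.f (fun k s => s.r 16 = 3 + k ∧ 3 + k ≤ p.f ∧
    s.r 43 = (if k = 0 then 0 else (3 + k + 1) * (3 + k + 2)) ∧ s.μ = s₀.μ ∧
    ∀ i < 43, i ≠ 16 → s.r i = s₀.r i) ?_ ?_ s₀ ?_
  · rintro k s ⟨h1, h2, h3, h4', h5⟩ htest
    have hlt' : s.r 43 < p.w := by
      have : s.r 43 < s.r 4 := htest
      rwa [h5 4 (by omega) (by omega), h4] at this
    have hk : 3 + k + 1 ≤ p.f := by
      by_contra hk
      obtain rfl | hk0 := Nat.eq_zero_or_pos k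
      · omega
      · rw [if_neg (by omega), show 3 + k = p.f by omega] at h3
        omega
    refine ⟨by omega, (Runs.blk (by decide) ?_).mono (le_of_eq rfl) fun _ h => h⟩
    have e40 : s.r 40 = 1 := (h5 40 (by omega) (by omega)).trans h40
    have b1 : 3 + k + 1 < 2 ^ p.w := H.addr_lt (by omega)
    have b2 : 3 + k + 1 + 1 < 2 ^ p.w := H.addr_lt (by omega)
    have b3 : 3 + k + 1 + 1 + 1 < 2 ^ p.w := H.addr_lt (by omega)
    refine ⟨?_, by omega, ?_, ?_, fun i hi hi' => ?_⟩
    · simp only [degreeCode, runBlock, Instr.natExec, BinOp.natEval, Function.update_apply,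
        List.foldl_cons, List.foldl_nil, Nat.reduceEqDiff, if_true, if_false, h1, e40,
        Nat.mod_eq_of_lt b1]
      ring
    · simp only [degreeCode, runBlock, Instr.natExec, BinOp.natEval, Function.update_apply,
        List.foldl_cons, List.foldl_nil, Nat.reduceEqDiff, if_true, if_false, h1, e40,
        Nat.mod_eq_of_lt b1, Nat.mod_eq_of_lt b2, Nat.mod_eq_of_lt b3]
      rw [mul_comm (3 + k + 1 + 1 + 1)]
      exact Nat.mod_eq_of_lt (hmono (3 + k + 1) hk)
    · rw [runBlock_mem _ _ _ _ (by decide), h4']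
    · rw [runBlock_frame _ _ _ _ _ (by simp [degreeCode, Instr.dst]; omega), h5 i hi hi']
  · rintro k s ⟨h1, h2, h3, h4', h5⟩ htest
    have hge : p.w ≤ s.r 43 := by
      have : ¬ s.r 43 < s.r 4 := htest
      rw [h5 4 (by omega) (by omega), h4] at this
      omega
    refine ⟨?_, h4', h5⟩
    by_contra hne
    have hk : 3 + k + 1 ≤ p.f := by omega
    split_ifs at h3 with hk0
    · omega
    · have : (3 + k + 1) * (3 + k + 2) ≤ p.f * (p.f + 1) := Nat.mul_le_mul hk (by omega)
      omega
  · exact ⟨by omega, by omega, by simp [h43], rfl, fun _ _ _ => rfl⟩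

theorem slotsCode_spec (H : p.Valid) {s : NatState} {m : ℕ} (hm : p.M = m / p.w + m + 1)
    (h1 : s.r 1 = m) (h2 : s.r 2 = p.v) (h4 : s.r 4 = p.w) :
    let s' := runBlock p.w p.S slotsCode s
    s'.r 13 = p.w ∧ s'.r 14 = p.M ∧ s'.r 16 = 3 ∧ s'.r 17 = p.w / 2 ∧ s'.r 19 = p.v ∧ s'.r 40 = 1 ∧
      s'.r 43 = 0 ∧ ∀ i < 10, s'.r i = s.r i := by
  have htree := H.tree_le
  have hw := H.sixteen_lt
  have b1 : 1 < 2 ^ p.w := H.addr_lt (by omega)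
  have b2 : 2 < 2 ^ p.w := H.addr_lt (by omega)
  have b3 : 3 < 2 ^ p.w := H.addr_lt (by omega)
  have b4 : m / p.w + m < 2 ^ p.w := H.addr_lt (by omega)
  have b5 : m / p.w + m + 1 < 2 ^ p.w := H.addr_lt (by omega)
  intro s'
  refine ⟨?_, ?_, ?_, ?_, ?_, ?_, ?_, fun i hi =>
    runBlock_frame _ _ _ _ _ (by simp [slotsCode, Instr.dst]; omega)⟩
  all_goals
    simp only [s', slotsCode, runBlock, Instr.natExec, BinOp.natEval, Function.update_apply,
      List.foldl_cons, List.foldl_nil, Nat.reduceEqDiff, if_true, if_false, h1, h2, h4,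
      Nat.mod_eq_of_lt b1, Nat.mod_eq_of_lt b2, Nat.mod_eq_of_lt b3, Nat.mod_eq_of_lt b4,
      Nat.mod_eq_of_lt b5, Nat.or_self, Nat.zero_mod, hm]

theorem baseCode_spec (H : p.Valid) {s : NatState} (hN : p.N = (p.M - 2) / (p.f - 1) + 1)
    (h4 : s.r 4 = p.w) (h14 : s.r 14 = p.M) (h16 : s.r 16 = p.f) (h40 : s.r 40 = 1) :
    let s' := runBlock p.w p.S baseCode s
    s'.r 15 = p.N ∧ s'.r 18 = p.valueBase ∧ s'.r 25 = 16 * p.w ∧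
      ∀ i, i ≠ 15 → i ≠ 18 → i ≠ 25 → i ≠ 42 → i ≠ 44 → i ≠ 45 → s'.r i = s.r i := by
  have htree := H.tree_le
  have hw := H.sixteen_lt
  have hf := H.shape.four_le
  have hM := H.shape.two_le
  have b2 : 2 < 2 ^ p.w := H.addr_lt (by omega)
  have b3 : 16 < 2 ^ p.w := H.addr_lt (by omega)
  have b4 : p.N < 2 ^ p.w := H.addr_lt (by omega)
  have b5 : 16 * p.w < 2 ^ p.w := H.addr_lt (by omega)
  have b6 : p.N + p.M < 2 ^ p.w := H.addr_lt (by omega)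
  have b7 : p.N + p.M + p.f < 2 ^ p.w := H.addr_lt (by omega)
  have b8 : 16 * p.w + (p.N + p.M + p.f) < 2 ^ p.w := H.addr_lt (by omega)
  have e1 : (2 ^ p.w - 1 + p.f) % 2 ^ p.w = p.f - 1 := by
    rw [show 2 ^ p.w - 1 + p.f = p.f - 1 + 2 ^ p.w by omega, Nat.add_mod_right,
      Nat.mod_eq_of_lt (by omega)]
  have e2 : (2 ^ p.w - 2 + p.M) % 2 ^ p.w = p.M - 2 := by
    rw [show 2 ^ p.w - 2 + p.M = p.M - 2 + 2 ^ p.w by omega, Nat.add_mod_right,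
      Nat.mod_eq_of_lt (by omega)]
  intro s'
  refine ⟨?_, ?_, ?_, fun i _ _ _ _ _ _ =>
    runBlock_frame _ _ _ _ _ (by simp [baseCode, Instr.dst]; omega)⟩
  all_goals
    simp only [s', baseCode, runBlock, Instr.natExec, BinOp.natEval, Function.update_apply,
      List.foldl_cons, List.foldl_nil, Nat.reduceEqDiff, if_true, if_false, h4, h14, h16, h40,
      e1, e2, ← hN, Nat.mod_eq_of_lt b2, Nat.mod_eq_of_lt b3, Nat.mod_eq_of_lt b4,
      Nat.mod_eq_of_lt b5, Nat.mod_eq_of_lt b6, Nat.mod_eq_of_lt b7, Nat.mod_eq_of_lt b8,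
      Par.valueBase]

theorem maskCode_spec (H : p.Valid) {s : NatState} (h2 : s.r 2 = p.v) (h16 : s.r 16 = p.f)
    (h40 : s.r 40 = 1) :
    let s' := runBlock p.w p.S maskCode s
    s'.r 20 = 2 ^ p.v - 1 ∧ s'.r 21 = 2 ^ p.f - 1 ∧
      s'.r 22 = (2 ^ (p.f * p.f) - 1) / (2 ^ p.f - 1) ∧
      s'.r 23 = (2 ^ ((p.f + 1) * p.f) - 1) / (2 ^ (p.f + 1) - 1) ∧ s'.r 24 = 2 ^ (p.f + 1) - 1 ∧
      ∀ i, (i < 20 ∨ i = 25 ∨ i = 40) → s'.r i = s.r i := by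
  have htree := H.tree_le
  have hw := H.sixteen_lt
  have hf := H.f_lt
  have hf' : (p.f + 1) * p.f < p.w := by rwa [mul_comm]
  have hff : p.f * p.f < p.w := by nlinarith
  have hf1 : p.f + 1 < p.w := by have := H.shape.four_le; nlinarith
  have b1 : p.f + 1 < 2 ^ p.w := H.addr_lt (by omega)
  have b2 : p.f * p.f < 2 ^ p.w := H.addr_lt (by omega)
  have b3 : (p.f + 1) * p.f < 2 ^ p.w := H.addr_lt (by omega)
  have hshl : ∀ g, g < p.w → (1 <<< g) % 2 ^ p.w = 2 ^ g := fun g hg => by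
    rw [Nat.one_shiftLeft, Nat.mod_eq_of_lt (Nat.pow_lt_pow_right (by omega) hg)]
  have hsub : ∀ g, g < p.w → (2 ^ p.w - 1 + 2 ^ g) % 2 ^ p.w = 2 ^ g - 1 := fun g hg => by
    have h1 : 2 ^ g < 2 ^ p.w := Nat.pow_lt_pow_right (by omega) hg
    have h2 : 0 < 2 ^ g := by positivity
    rw [show 2 ^ p.w - 1 + 2 ^ g = 2 ^ g - 1 + 2 ^ p.w by omega, Nat.add_mod_right,
      Nat.mod_eq_of_lt (by omega)]
  intro s'
  refine ⟨?_, ?_, ?_, ?_, ?_, fun i hi =>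
    runBlock_frame _ _ _ _ _ (by simp [maskCode, Instr.dst]; omega)⟩
  all_goals
    simp only [s', maskCode, runBlock, Instr.natExec, BinOp.natEval, Function.update_apply,
      List.foldl_cons, List.foldl_nil, Nat.reduceEqDiff, if_true, if_false, h2, h16, h40,
      Nat.mod_eq_of_lt b1, Nat.mod_eq_of_lt b2, Nat.mod_eq_of_lt b3, hshl _ H.v_lt, hsub _ H.v_lt,
      hshl _ H.f_lt_w, hsub _ H.f_lt_w, hshl _ hf1, hsub _ hf1, hshl _ hff, hsub _ hff, hshl _ hf',
      hsub _ hf']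

/-- The creation produces an empty structure. The first three words of the memory are not touched,
so that their random content becomes the hash function. -/
theorem init_spec (H : p.Valid) {s : NatState} {m : ℕ} (hbdd : s.Bdd p.w)
    (hm : p.M = m / p.w + m + 1) (hN : p.N = (p.M - 2) / (p.f - 1) + 1)
    (hf : p.w ≤ (p.f + 1) * (p.f + 2)) (h1 : s.r 1 = m) (h2 : s.r 2 = p.v) (h4 : s.r 4 = p.w) :
    ∃ T, Runs p.w p.S initCmd s T fun s' =>
      p.Rep (s.μ 0) (s.μ 1) (s.μ 2) (· ∉ (∅ : Finset ℕ)) s'.μ := by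
  have htree := H.tree_le
  have hw := H.sixteen_lt
  have hfw := H.f_lt_w
  have hS : 18 ≤ p.S := by
    by_contra hS
    have : p.S * p.w ≤ 17 * p.w := Nat.mul_le_mul_right _ (by omega)
    omega
  have x₁ : Exec p.w p.S (.blk slotsCode) s _ _ := .blk _ s (by decide)
  obtain ⟨a13, a14, a16, a17, a19, a40, a43, afr⟩ := H.slotsCode_spec hm h1 h2 h4
  have aμ : (runBlock p.w p.S slotsCode s).μ = s.μ := runBlock_mem _ _ _ _ (by decide)
  set t := runBlock p.w p.S slotsCode s
  obtain ⟨u, T₂, x₂, -, u16, uμ, ufr⟩ :=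
    H.degree_spec hf ((afr 4 (by omega)).trans h4) a40 a16 a43
  have x₃ : Exec p.w p.S (.blk (baseCode ++ maskCode ++ storeCode 13 ++
    [.const 31 0, .const 59 0, .op .add 45 15 14, .op .add 45 45 16])) u _ _ :=
    .blk _ u (by simp [straight_storeCode]; decide)
  obtain ⟨b15, b18, b25, bfr⟩ := H.baseCode_spec (s := u) hN
    (by rw [ufr 4 (by omega) (by omega), afr 4 (by omega), h4])
    (by rw [ufr 14 (by omega) (by omega), a14]) u16 (by rw [ufr 40 (by omega) (by omega), a40])
  rw [runBlock_append, runBlock_append, runBlock_append] at x₃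
  have bμ : (runBlock p.w p.S baseCode u).μ = u.μ := runBlock_mem _ _ _ _ (by decide)
  set x := runBlock p.w p.S baseCode u
  have xfr : ∀ i < 43, i ≠ 15 → i ≠ 16 → i ≠ 18 → i ≠ 25 → i ≠ 42 → x.r i = t.r i :=
    fun i g1 g2 g3 g4 g5 g6 => by
      rw [bfr i g2 g4 g5 g6 (by omega) (by omega), ufr i g1 g3]
  obtain ⟨c20, c21, c22, c23, c24, cfr⟩ := H.maskCode_spec (s := x)
    (by rw [xfr 2, afr 2, h2] <;> omega)
    (by rw [bfr 16 (by omega) (by omega) (by omega) (by omega) (by omega) (by omega), u16])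
    (by rw [xfr 40, a40] <;> omega)
  have cμ : (runBlock p.w p.S maskCode x).μ = x.μ := runBlock_mem _ _ _ _ (by decide)
  set y := runBlock p.w p.S maskCode x
  obtain ⟨dμ, dfr⟩ := runBlock_storeCode (w := p.w) (S := p.S) y 13
    (by have := H.addr_lt (x := 16) (by omega); omega) (by omega)
  set z := runBlock p.w p.S (storeCode 13) y
  have e13 : y.r 13 = p.w := by rw [cfr 13, xfr 13, a13] <;> omega
  have e14 : y.r 14 = p.M := by rw [cfr 14, xfr 14, a14] <;> omega
  have e15 : y.r 15 = p.N := by rw [cfr 15, b15]; omega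
  have e16 : y.r 16 = p.f := by
    rw [cfr 16 (by omega), bfr 16 (by omega) (by omega) (by omega) (by omega) (by omega) (by omega),
      u16]
  have e17 : y.r 17 = p.w / 2 := by rw [cfr 17, xfr 17, a17] <;> omega
  have e18 : y.r 18 = p.valueBase := by rw [cfr 18, b18]; omega
  have e19 : y.r 19 = p.v := by rw [cfr 19, xfr 19, a19] <;> omega
  have e25 : y.r 25 = 16 * p.w := by rw [cfr 25, b25]; omega
  have e40 : y.r 40 = 1 := by rw [cfr 40, xfr 40, a40] <;> omega
  have hheader : ∀ i < 16, z.μ i = p.header (s.μ 0) (s.μ 1) (s.μ 2) i := by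
    intro i hi
    rw [dμ]
    have : y.μ = s.μ := by rw [cμ, bμ, uμ, aμ]
    rw [this]
    interval_cases i <;> simp [Par.header, *]
  -- both loops work on the tree only
  have wfr : ∀ i, i ≠ 31 → i ≠ 45 → i ≠ 59 → (runBlock p.w p.S [.const 31 0, .const 59 0,
      .op .add 45 15 14, .op .add 45 45 16] z).r i = z.r i := fun i g1 g2 g3 =>
    runBlock_frame _ _ _ _ _ (by simp [Instr.dst]; omega)
  have wb := ((x₃.bdd (x₂.bdd (x₁.bdd hbdd))))
  have b6 : p.N + p.M < 2 ^ p.w := H.addr_lt (by omega)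
  have b7 : p.N + p.M + p.f < 2 ^ p.w := H.addr_lt (by omega)
  have b1 : 1 < 2 ^ p.w := H.addr_lt (by omega)
  have w31 : (runBlock p.w p.S [.const 31 0, .const 59 0, .op .add 45 15 14,
      .op .add 45 45 16] z).r 31 = 0 := by simp [runBlock, Instr.natExec]
  have w59 : (runBlock p.w p.S [.const 31 0, .const 59 0, .op .add 45 15 14,
      .op .add 45 45 16] z).r 59 = 0 := by simp [runBlock, Instr.natExec]
  have w45 : (runBlock p.w p.S [.const 31 0, .const 59 0, .op .add 45 15 14,
      .op .add 45 45 16] z).r 45 = p.N + p.M + p.f := by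
    simp only [runBlock, Instr.natExec, BinOp.natEval, Function.update_apply, List.foldl_cons,
      List.foldl_nil, Nat.reduceEqDiff, if_true, if_false, dfr 15 (by omega), dfr 14 (by omega),
      dfr 16 (by omega), e14, e15, e16, Nat.mod_eq_of_lt b6, Nat.mod_eq_of_lt b7]
  have wμ : (runBlock p.w p.S [.const 31 0, .const 59 0, .op .add 45 15 14,
      .op .add 45 45 16] z).μ = z.μ := runBlock_mem _ _ _ _ (by decide)
  set q := runBlock p.w p.S [.const 31 0, .const 59 0, .op .add 45 15 14, .op .add 45 45 16] z
  obtain ⟨q', T₄, x₄, -, f1, f2, f3, f4⟩ := H.fill_spec wb (y := 0) (by omega)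
    (by rw [wfr 13, dfr 13, e13] <;> omega) (by rw [wfr 25, dfr 25, e25] <;> omega)
    (by rw [wfr 40, dfr 40, e40] <;> omega) w31 w45 w59 le_rfl
  have x₅ : Exec p.w p.S (.blk [.const 31 0, .const 59 1, .op .sub 45 45 16, .op .sub 45 45 40])
    q' _ _ := .blk _ q' (by decide)
  have g45 : (runBlock p.w p.S [.const 31 0, .const 59 1, .op .sub 45 45 16,
      .op .sub 45 45 40] q').r 45 = p.N + p.M - 1 := by
    simp only [runBlock, Instr.natExec, BinOp.natEval, Function.update_apply, List.foldl_cons,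
      List.foldl_nil, Nat.reduceEqDiff, if_true, if_false, f2 45 (by omega) (by omega),
      f2 40 (by omega) (by omega), f2 16 (by omega) (by omega), w45,
      wfr 16 (by omega) (by omega) (by omega), wfr 40 (by omega) (by omega) (by omega),
      dfr 16 (by omega), dfr 40 (by omega), e16, e40]
    have := H.shape.one_le
    rw [show 2 ^ p.w - p.f + (p.N + p.M + p.f) = p.N + p.M + 2 ^ p.w by omega, Nat.add_mod_right,
      Nat.mod_eq_of_lt b6, show 2 ^ p.w - 1 + (p.N + p.M) = p.N + p.M - 1 + 2 ^ p.w by omega,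
      Nat.add_mod_right, Nat.mod_eq_of_lt (by omega)]
  have g31 : (runBlock p.w p.S [.const 31 0, .const 59 1, .op .sub 45 45 16,
      .op .sub 45 45 40] q').r 31 = 0 := by simp [runBlock, Instr.natExec]
  have g59 : (runBlock p.w p.S [.const 31 0, .const 59 1, .op .sub 45 45 16,
      .op .sub 45 45 40] q').r 59 = 1 := by simp [runBlock, Instr.natExec, Nat.mod_eq_of_lt b1]
  have gfr : ∀ i, i ≠ 31 → i ≠ 45 → i ≠ 59 → (runBlock p.w p.S [.const 31 0, .const 59 1,
      .op .sub 45 45 16, .op .sub 45 45 40] q').r i = q'.r i := fun i g1 g2 g3 =>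
    runBlock_frame _ _ _ _ _ (by simp [Instr.dst]; omega)
  have gμ : (runBlock p.w p.S [.const 31 0, .const 59 1, .op .sub 45 45 16,
      .op .sub 45 45 40] q').μ = q'.μ := runBlock_mem _ _ _ _ (by decide)
  have gb := x₅.bdd f1
  set g := runBlock p.w p.S [.const 31 0, .const 59 1, .op .sub 45 45 16, .op .sub 45 45 40] q'
  obtain ⟨s', T₆, x₆, -, h1', h2', h3', h4'⟩ := H.fill_spec gb (y := 1) (by omega)
    (by rw [gfr 13, f2 13, wfr 13, dfr 13, e13] <;> omega)
    (by rw [gfr 25, f2 25, wfr 25, dfr 25, e25] <;> omega)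
    (by rw [gfr 40, f2 40, wfr 40, dfr 40, e40] <;> omega) g31 g45 g59 (by omega)
  refine ⟨_, s', _, .seq x₁ (.seq x₂ (.seq x₃ (.seq x₄ (.seq x₅ x₆)))), le_rfl, h1'.2,
    fun i hi => ?_, fun x => ?_⟩
  · rw [h3' i hi, gμ, f3 i hi, wμ, hheader i hi]
  · rw [h4' x, gμ, f4 x]
    by_cases hx : x < p.N + p.M - 1
    · simp only [hx, if_true, decide_true, true_and, true_iff]
      exact ⟨0, H.shape.cnt_pos x, by simp⟩
    · simp only [hx, if_false, false_and, iff_false]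
      split_ifs with hx'
      · simp
      · unfold Par.treeBit; simp [hx']

end Par.Valid
end OffsetTable

/-! ### Sessions -/

namespace WordRAM

theorem Runs.final {w S : ℕ} {c : Cmd} {σ : Config w S} {T : ℕ} {Q : NatState → Prop}
    (h : Runs w S c σ.nat T Q) (hpc : σ.pc = 0) :
    Halts (c.compile 0) σ ∧ time (c.compile 0) σ ≤ T ∧ Q (WordRAM.final (c.compile 0) σ).nat := by
  obtain ⟨s', t, he, ht, hq⟩ := h
  obtain ⟨h1, h2, h3⟩ := he.final hpc
  exact ⟨h1, h2.trans ht, h3 ▸ hq⟩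

/-- The content of a memory as a sequence of numbers. -/
def natMem {w S : ℕ} (μ : Memory w S) (a : ℕ) : ℕ := if h : a < S then (μ ⟨a, h⟩).toNat else 0

theorem nat_start_r {w S : ℕ} (μ : Memory w S) (args : List ℕ) (i : ℕ) :
    (start μ args).nat.r i = args.getD i 0 % 2 ^ w := by
  simp [start, Config.nat]

end WordRAM

namespace OffsetTable

open WordRAM

/-- The data structure. -/
def code : Code where
  init := initCmd.compile 0
  insert := insertCmd.compile 0
  update := updateCmd.compile 0
  query := queryCmd.compile 0

/-- The inserted keys, the last one first. -/
def insertions {U v : ℕ} : List (Op U v) → List (Fin U)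
  | [] => []
  | .insert k _ :: h => k :: insertions h
  | .update _ _ :: h => insertions h
  | .query _ :: h => insertions h

section
variable {U v m : ℕ}

theorem mem_keys {h : List (Op U v)} {k : Fin U} : k ∈ keys h ↔ (contents h k).isSome := by
  simp [keys]

theorem keys_insert (h : List (Op U v)) (k : Fin U) (y : Fin (2 ^ v)) :
    keys (.insert k y :: h) = insert k (keys h) := by
  ext k'
  rw [Finset.mem_insert, mem_keys, mem_keys, contents]
  by_cases hk : k' = k
  · subst hk; simp
  · simp [hk]

theorem keys_update {h : List (Op U v)} {k : Fin U} (hk : k ∈ keys h) (y : Fin (2 ^ v)) :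
    keys (.update k y :: h) = keys h := by
  ext k'
  rw [mem_keys, mem_keys, contents]
  by_cases hk' : k' = k
  · subst hk'; simpa [mem_keys] using hk
  · simp [hk']

theorem keys_query (h : List (Op U v)) (k : Fin U) : keys (.query k :: h) = keys h := by
  ext k'
  rw [mem_keys, mem_keys, contents]

theorem toFinset_insertions {h : List (Op U v)} (hl : Legal m h) :
    (insertions h).toFinset = keys h := by
  induction h with
  | nil => ext k; simp [insertions, mem_keys, contents]
  | cons o h ih =>
    cases o with
    | insert k y => rw [keys_insert, insertions, List.toFinset_cons, ih hl.1]
    | update k y => rw [keys_update hl.2, insertions, ih hl.1]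
    | query k => rw [keys_query, insertions, ih hl.1]

theorem nodup_insertions {h : List (Op U v)} (hl : Legal m h) : (insertions h).Nodup := by
  induction h with
  | nil => exact List.nodup_nil
  | cons o h ih =>
    cases o with
    | insert k y =>
      refine List.nodup_cons.2 ⟨fun hk => hl.2.1 ?_, ih hl.1⟩
      rw [← toFinset_insertions hl.1]
      simpa using hk
    | update k y => exact ih hl.1
    | query k => exact ih hl.1

theorem mem_insertions {h : List (Op U v)} (hl : Legal m h) {k : Fin U} :
    k ∈ insertions h ↔ k ∈ keys h := by
  rw [← toFinset_insertions hl, List.mem_toFinset]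

theorem length_insertions {h : List (Op U v)} (hl : Legal m h) :
    (insertions h).length = (keys h).card := by
  rw [← toFinset_insertions hl, List.toFinset_card_of_nodup (nodup_insertions hl)]

theorem card_keys_le {h : List (Op U v)} (hl : Legal m h) : (keys h).card ≤ m := by
  induction h with
  | nil => simp [show keys ([] : List (Op U v)) = ∅ by ext k; simp [mem_keys, contents]]
  | cons o h ih =>
    cases o with
    | insert k y =>
      rw [keys_insert, Finset.card_insert_of_notMem hl.2.1]
      exact hl.2.2
    | update k y => rw [keys_update hl.2]; exact ih hl.1
    | query k => rw [keys_query]; exact ih hl.1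

end

/-- The number of the scales `f ^ i` at which the home of `k` lies on an overfull arc. -/
noncomputable def scales {κ : Type*} [DecidableEq κ] (f M : ℕ) (home : κ → ℕ) (k : κ)
    (A : Finset κ) : ℕ :=
  open scoped Classical in ((Finset.range M).filter fun i => Overfull M home k A (f ^ i)).card

section
variable {κ : Type*} [DecidableEq κ] {M : ℕ} {home : κ → ℕ} {k : κ} {ks : List κ}

theorem overfull_of_arc (hnd : (k :: ks).Nodup) (hks : ks.length + 1 < M) (hh : home k < M) {l : ℕ}
    (ha : Shape.Arc M (· ∉ occ M home (k :: ks)) (home k) l) :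
    Overfull M home k ks.toFinset l := by
  have : Nonempty κ := ⟨k⟩
  obtain ⟨u, s, h1, h2, h3, h4⟩ := ha.overfull hnd (by simpa using hks) hh
  refine ⟨u, s, h1, h2, h3, ?_⟩
  unfold arcCount
  rwa [List.toFinset_cons] at h4

/-- A large displacement is caused by an overfull arc. -/
theorem overfull_of_le_disp (hnd : (k :: ks).Nodup) (hks : ks.length + 1 < M) (hh : home k < M)
    {l : ℕ} (hl : l ≤ disp M (home k) (occ M home ks) + 1) :
    Overfull M home k ks.toFinset l := by
  refine overfull_of_arc hnd hks hh
    ⟨home k, 0, disp M (home k) (occ M home ks) + 1, hl, by omega, Nat.mod_eq_of_lt hh, ?_⟩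
  intro r hr
  rw [not_not, occ, Finset.mem_insert]
  rcases (Nat.lt_succ_iff.1 hr).lt_or_eq with hr | rfl
  · exact Or.inr ((disp_spec (exists_free (by omega))).2.2 r hr)
  · exact Or.inl rfl

theorem lt_scales_of_arc {f : ℕ} (hf : 2 ≤ f) (hnd : (k :: ks).Nodup) (hks : ks.length + 1 < M)
    (hh : home k < M) {i : ℕ} (ha : Shape.Arc M (· ∉ occ M home (k :: ks)) (home k) (f ^ i)) :
    i < scales f M home k ks.toFinset := by
  classical
  unfold scales
  rw [Nat.lt_iff_add_one_le, ← Finset.card_range (i + 1)]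
  refine Finset.card_le_card fun j hj => ?_
  have hji : j ≤ i := Nat.lt_succ_iff.1 (Finset.mem_range.1 hj)
  have h1 := overfull_of_arc hnd hks hh (ha.anti (Nat.pow_le_pow_right (by omega) hji))
  rw [Finset.mem_filter, Finset.mem_range]
  obtain ⟨u, s, h2, h3, h4, -⟩ := id h1
  exact ⟨lt_of_lt_of_le (Nat.lt_pow_self hf) (h2.trans h4.le), by convert h1⟩

end

/-- What holds between two operations: the memory represents the occupied slots, and the value of
every key is stored at the slot that the home and the offset of the key determine. -/
structure Invariant {U : ℕ} (p : Par) (a b c : ℕ) (home : Fin U → ℕ) (h : List (Op U p.v))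
    (σ : Session U p.w p.S) : Prop where
  rep : p.Rep a b c (· ∉ occ p.M home (insertions h)) (natMem σ.mem)
  offset_lt : ∀ k ∈ insertions h, (σ.offset k).toNat < p.M
  mem_occ : ∀ k ∈ insertions h, (home k + (σ.offset k).toNat) % p.M ∈ occ p.M home (insertions h)
  inj : ∀ k ∈ insertions h, ∀ k' ∈ insertions h,
    (home k + (σ.offset k).toNat) % p.M = (home k' + (σ.offset k').toNat) % p.M → k = k'
  value : ∀ k y, contents h k = some y →
    p.value (natMem σ.mem) ((home k + (σ.offset k).toNat) % p.M) = y.val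

namespace Invariant

variable {U m : ℕ} {p : Par} {a b c : ℕ} {home : Fin U → ℕ} {h : List (Op U p.v)}
  {σ : Session U p.w p.S}

theorem query (hI : Invariant p a b c home h σ) (H : p.Valid) (hU : U ≤ 2 ^ p.w)
    (hhome : ∀ k : Fin U, home k = hashTop p.w a b c k % p.M) {k : Fin U}
    (hl : Legal m (.query k :: h)) :
    Halts (code.program (.query k : Op U p.v)) (σ.start (.query k : Op U p.v)) ∧
    time (code.program (.query k : Op U p.v)) (σ.start (.query k : Op U p.v)) ≤ 54 ∧
    (∀ y, contents h k = some y → (σ.answer code (.query k : Op U p.v)).toNat = y.val) ∧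
    Invariant p a b c home (.query k :: h) (σ.perform code (.query k : Op U p.v)) := by
  have hk : k ∈ insertions h := (mem_insertions hl.1).2 hl.2
  have r0 : (σ.start (.query k : Op U p.v)).nat.r 0 = k := by
    rw [Session.start, nat_start_r]
    exact Nat.mod_eq_of_lt (lt_of_lt_of_le k.2 hU)
  have r1 : (σ.start (.query k : Op U p.v)).nat.r 1 = (σ.offset k).toNat := by
    rw [Session.start, nat_start_r]
    exact Nat.mod_eq_of_lt (σ.offset k).isLt
  obtain ⟨h1, h2, h3, h4⟩ := (H.query_spec (s := (σ.start (.query k : Op U p.v)).nat) hI.rep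
    (by rw [r1]; exact hI.offset_lt k hk)).final rfl
  rw [r0, r1, ← hhome] at h3
  refine ⟨h1, h2, fun y hy => (h3.trans (hI.value k y hy) :), ?_⟩
  have hmem : natMem (σ.perform code (.query k : Op U p.v)).mem = natMem σ.mem := h4
  exact ⟨hmem ▸ hI.rep, hI.offset_lt, hI.mem_occ, hI.inj, fun k' y hy => by
    rw [hmem]; exact hI.value k' y hy⟩

theorem update (hI : Invariant p a b c home h σ) (H : p.Valid) (hU : U ≤ 2 ^ p.w)
    (hhome : ∀ k : Fin U, home k = hashTop p.w a b c k % p.M) {k : Fin U} {y : Fin (2 ^ p.v)}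
    (hl : Legal m (.update k y :: h)) :
    Halts (code.program (.update k y)) (σ.start (.update k y)) ∧
    time (code.program (.update k y)) (σ.start (.update k y)) ≤ 62 ∧
    Invariant p a b c home (.update k y :: h) (σ.perform code (.update k y)) := by
  have hk : k ∈ insertions h := (mem_insertions hl.1).2 hl.2
  have r0 : (σ.start (.update k y)).nat.r 0 = k := by
    rw [Session.start, nat_start_r]
    exact Nat.mod_eq_of_lt (lt_of_lt_of_le k.2 hU)
  have r1 : (σ.start (.update k y)).nat.r 1 = (σ.offset k).toNat := by
    rw [Session.start, nat_start_r]
    exact Nat.mod_eq_of_lt (σ.offset k).isLt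
  have r2 : (σ.start (.update k y)).nat.r 2 = y := by
    rw [Session.start, nat_start_r]
    exact Nat.mod_eq_of_lt (lt_of_lt_of_le y.2 (Nat.pow_le_pow_right two_pos H.v_lt.le))
  obtain ⟨h1, h2, h3, h4, h5⟩ := (H.update_spec (s := (σ.start (.update k y)).nat)
    (Config.nat_bdd _) hI.rep (by rw [r1]; exact hI.offset_lt k hk)
    (by rw [r2]; exact y.2)).final rfl
  rw [r0, r1, ← hhome, r2] at h4
  rw [r0, r1, ← hhome] at h5
  refine ⟨h1, h2, h3, hI.offset_lt, hI.mem_occ, hI.inj, fun k' y' hy => ?_⟩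
  rw [contents] at hy
  by_cases hkk : k' = k
  · subst hkk
    rw [Function.update_self, Option.some_inj] at hy
    rw [← hy]
    exact h4
  · rw [Function.update_of_ne hkk] at hy
    have hk' : k' ∈ insertions h := by
      rw [mem_insertions hl.1, mem_keys, hy]; rfl
    rw [← hI.value k' y' hy]
    exact h5 _ fun he => hkk (hI.inj _ hk' _ hk he)

theorem insert (hI : Invariant p a b c home h σ) (H : p.Valid) (hU : U ≤ 2 ^ p.w)
    (hhome : ∀ k : Fin U, home k = hashTop p.w a b c k % p.M) (hm : m < p.M) {k : Fin U}
    {y : Fin (2 ^ p.v)} (hl : Legal m (.insert k y :: h)) :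
    Halts (code.program (.insert k y)) (σ.start (.insert k y)) ∧
    time (code.program (.insert k y)) (σ.start (.insert k y)) ≤
      100 * (2 + scales p.f p.M home k (keys h)) + 200 ∧
    (σ.answer code (.insert k y)).toNat = disp p.M (home k) (occ p.M home (insertions h)) ∧
    Invariant p a b c home (.insert k y :: h) (σ.perform code (.insert k y)) := by
  have hk : k ∉ insertions h := fun hk => hl.2.1 ((mem_insertions hl.1).1 hk)
  have hnd : (k :: insertions h).Nodup := nodup_insertions hl
  have hlen : (insertions h).length + 1 < p.M := by
    have := hl.2.2
    rw [length_insertions hl.1]; omega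
  have hhM : home k < p.M := hhome k ▸ H.home_lt _
  have r0 : (σ.start (.insert k y)).nat.r 0 = k := by
    rw [Session.start, nat_start_r]
    exact Nat.mod_eq_of_lt (lt_of_lt_of_le k.2 hU)
  have r1 : (σ.start (.insert k y)).nat.r 1 = y := by
    rw [Session.start, nat_start_r]
    exact Nat.mod_eq_of_lt (lt_of_lt_of_le y.2 (Nat.pow_le_pow_right two_pos H.v_lt.le))
  obtain ⟨d1, d2, -⟩ := disp_spec (M := p.M) (h := home k) (O := occ p.M home (insertions h))
    (exists_free (by omega))
  set O := occ p.M home (insertions h) with hO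
  set P := disp p.M (home k) O with hP
  set s := (home k + P) % p.M with hs
  have hocc : occ p.M home (insertions (.insert k y :: h)) = Insert.insert s O := rfl
  obtain ⟨h1, h2, h3, h4, h5, h6⟩ := (H.insert_spec (s := (σ.start (.insert k y)).nat)
    (O := O) (B := 2 + scales p.f p.M home k (keys h)) (Config.nat_bdd _) hI.rep
    (by rw [r1]; exact y.2) (h := home k) (σ := s) (by rw [r0, hhome]) rfl
    (by rw [← hocc]; exact exists_free (by simpa [insertions] using hlen)) (by omega)
    (fun i hi => by
      rw [← toFinset_insertions hl.1]
      have := lt_scales_of_arc (by have := H.shape.four_le; omega) hnd hlen hhM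
        (i := i) (f := p.f) hi
      omega)).final rfl
  have hoff : ∀ k', ((σ.perform code (.insert k y)).offset k').toNat =
      if k' = k then P else (σ.offset k').toNat := fun k' => by
    simp only [Session.perform, Function.update_apply]
    split_ifs with hkk
    · exact h3
    · rfl
  have hne : ∀ k' ∈ insertions h, k' ≠ k := fun k' hk' he => hk (he ▸ hk')
  have hmem : ∀ k', k' ∈ insertions (.insert k y :: h) ↔ k' = k ∨ k' ∈ insertions h :=
    fun k' => List.mem_cons
  refine ⟨h1, h2, h3, h4, fun k' hk' => ?_, fun k' hk' => ?_, fun k₁ hk₁ k₂ hk₂ he => ?_,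
    fun k' y' hy => ?_⟩
  · rw [hoff]
    split_ifs with hkk
    · exact d1
    · exact hI.offset_lt _ (((hmem k').1 hk').resolve_left hkk)
  · rw [hoff, hocc, Finset.mem_insert]
    split_ifs with hkk
    · subst hkk; exact Or.inl rfl
    · exact Or.inr (hI.mem_occ _ (((hmem k').1 hk').resolve_left hkk))
  · rw [hoff, hoff] at he
    rcases (hmem k₁).1 hk₁ with rfl | g1 <;> rcases (hmem k₂).1 hk₂ with rfl | g2
    · rfl
    · rw [if_pos rfl, if_neg (hne _ g2), ← hs] at he
      exact absurd (he ▸ hI.mem_occ _ g2) d2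
    · rw [if_pos rfl, if_neg (hne _ g1), ← hs] at he
      exact absurd (he ▸ hI.mem_occ _ g1) d2
    · rw [if_neg (hne _ g1), if_neg (hne _ g2)] at he
      exact hI.inj _ g1 _ g2 he
  · rw [contents] at hy
    rw [hoff]
    by_cases hkk : k' = k
    · subst hkk
      rw [Function.update_self, Option.some_inj] at hy
      rw [if_pos rfl, ← hs, ← hy, ← r1]
      exact h5
    · rw [Function.update_of_ne hkk] at hy
      have hk' : k' ∈ insertions h := by
        rw [mem_insertions hl.1, mem_keys, hy]; rfl
      rw [if_neg hkk, ← hI.value k' y' hy]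
      refine h6 _ fun he => d2 ?_
      rw [← he]
      exact hI.mem_occ _ hk'

end Invariant

/-- The home of a key, if the memory is filled with the random words `seed` at the beginning. -/
def seedHome {U : ℕ} (p : Par) (hS : 3 ≤ p.S) (seed : Memory p.w p.S) (k : Fin U) : ℕ :=
  seedTop hS seed k % p.M

section
variable {U n m : ℕ} {p : Par}

theorem lt_slots {M w : ℕ} (hm : M = m / w + m + 1) : m < M :=
  hm ▸ Nat.lt_succ_of_le (Nat.le_add_left _ _)

theorem init_halts_and_invariant (H : p.Valid) (hS : 3 ≤ p.S) (hm : p.M = m / p.w + m + 1)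
    (hN : p.N = (p.M - 2) / (p.f - 1) + 1) (hf : p.w ≤ (p.f + 1) * (p.f + 2))
    (seed : Memory p.w p.S) :
    Halts code.init (initStart n m p.v U seed) ∧
    Invariant p (natMem seed 0) (natMem seed 1) (natMem seed 2) (seedHome p hS seed)
      ([] : List (Op U p.v)) (session code n m seed ([] : List (Op U p.v))) := by
  have htree := H.tree_le
  have hv := H.v_lt
  have hmM := lt_slots hm
  obtain ⟨T, hT⟩ := H.init_spec (s := (initStart n m p.v U seed).nat) (m := m) (Config.nat_bdd _) hm
    hN hf
    (by rw [initStart, nat_start_r]; exact Nat.mod_eq_of_lt (H.addr_lt (by show m ≤ _; omega)))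
    (by rw [initStart, nat_start_r]; exact Nat.mod_eq_of_lt (H.addr_lt (by show p.v ≤ _; omega)))
    (by rw [initStart, nat_start_r]; exact Nat.mod_eq_of_lt (H.addr_lt (by show p.w ≤ _; omega)))
  obtain ⟨h1, -, h3⟩ := hT.final rfl
  refine ⟨h1, h3, ?_, ?_, ?_, ?_⟩
  all_goals simp [insertions, contents]

theorem seedHome_eq (hS : 3 ≤ p.S) (seed : Memory p.w p.S) (k : Fin U) :
    seedHome p hS seed k =
      hashTop p.w (natMem seed 0) (natMem seed 1) (natMem seed 2) k % p.M := by
  unfold natMem seedHome seedTop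
  rw [dif_pos (by omega), dif_pos (by omega), dif_pos (by omega)]

theorem session_invariant (H : p.Valid) (hS : 3 ≤ p.S) (hm : p.M = m / p.w + m + 1)
    (hN : p.N = (p.M - 2) / (p.f - 1) + 1) (hf : p.w ≤ (p.f + 1) * (p.f + 2)) (hU : U ≤ 2 ^ p.w)
    (seed : Memory p.w p.S) {h : List (Op U p.v)} (hl : Legal m h) :
    Invariant p (natMem seed 0) (natMem seed 1) (natMem seed 2) (seedHome p hS seed) h
      (session code n m seed h) := by
  induction h with
  | nil => exact (init_halts_and_invariant H hS hm hN hf seed).2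
  | cons o h ih =>
    cases o with
    | insert k y => exact ((ih hl.1).insert H hU (seedHome_eq hS seed) (lt_slots hm) hl).2.2.2
    | update k y => exact ((ih hl.1).update H hU (seedHome_eq hS seed) hl).2.2
    | query k => exact ((ih hl.1).query H hU (seedHome_eq hS seed) hl).2.2.2

/-- The offsets of the earlier keys stay the same, and the new key gets its displacement. -/
theorem offset_insert (H : p.Valid) (hS : 3 ≤ p.S) (hm : p.M = m / p.w + m + 1)
    (hN : p.N = (p.M - 2) / (p.f - 1) + 1) (hf : p.w ≤ (p.f + 1) * (p.f + 2)) (hU : U ≤ 2 ^ p.w)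
    (seed : Memory p.w p.S) {h : List (Op U p.v)} {k : Fin U} {y : Fin (2 ^ p.v)}
    (hl : Legal m (.insert k y :: h)) (k' : Fin U) :
    offset code n m seed (.insert k y :: h) k' = if k' = k then
      disp p.M (seedHome p hS seed k) (occ p.M (seedHome p hS seed) (insertions h))
      else offset code n m seed h k' := by
  have h1 := ((session_invariant (n := n) H hS hm hN hf hU seed hl.1).insert H hU
    (seedHome_eq hS seed) (lt_slots hm) hl).2.2.1
  simp only [offset, session, Session.perform, Function.update_apply]
  split_ifs with hkk
  · exact h1
  · rfl

end

end OffsetTable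

/-! ### Expected times and offsets -/

namespace OffsetTable

open WordRAM

/-- A sum of probabilities that decay geometrically after `c` steps. -/
theorem sum_le_add_of_geometric {x : ℕ → ℝ} {a : ℝ} (n c : ℕ) (h0 : ∀ i, 0 ≤ x i)
    (h1 : ∀ i, x i ≤ 1) (ha : 0 ≤ a) (hx : ∀ i, x (c + i) ≤ a / 2 ^ i) :
    ∑ i ∈ Finset.range n, x i ≤ c + 2 * a := by
  calc ∑ i ∈ Finset.range n, x i ≤ ∑ i ∈ Finset.range (c + n), x i :=
        Finset.sum_le_sum_of_subset_of_nonneg (Finset.range_mono (by omega)) fun i _ _ => h0 i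
    _ = ∑ i ∈ Finset.range c, x i + ∑ i ∈ Finset.range n, x (c + i) := Finset.sum_range_add _ _ _
    _ ≤ ∑ i ∈ Finset.range c, 1 + ∑ i ∈ Finset.range n, a * (1 / 2 ^ i) := by
        refine add_le_add (Finset.sum_le_sum fun i _ => h1 i) (Finset.sum_le_sum fun i _ => ?_)
        rw [mul_one_div]; exact hx i
    _ ≤ c + 2 * a := by
        rw [← Finset.mul_sum, Finset.sum_const, Finset.card_range, nsmul_one]
        have := sum_inv_two_pow_le 0 n
        rw [pow_zero, div_one, ← Finset.range_eq_Ico] at this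
        nlinarith

theorem expect_card_filter {Ω : Type*} [Fintype Ω] (n : ℕ) (q : Ω → ℕ → Prop)
    [∀ ω, DecidablePred (q ω)] :
    𝔼 ω, (((Finset.range n).filter (q ω)).card : ℝ) =
      ∑ i ∈ Finset.range n, prob fun ω => q ω i := by
  classical
  unfold prob
  rw [← Finset.expect_sum_comm]
  refine Finset.expect_congr rfl fun ω _ => ?_
  rw [Finset.card_filter]
  push_cast
  exact Finset.sum_congr rfl fun i _ => by congr

theorem logb_natCast_le_card {x M : ℕ} (hx : 0 < x) (hM : x ≤ M) :
    Real.logb 2 x ≤ ((Finset.range M).filter fun i => 2 ^ i ≤ x).card := by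
  have h1 : Finset.range (Nat.log 2 x + 1) ⊆ (Finset.range M).filter fun i => 2 ^ i ≤ x := by
    intro i hi
    have hi' : 2 ^ i ≤ x := (Nat.pow_le_pow_right two_pos
      (Nat.lt_succ_iff.1 (Finset.mem_range.1 hi))).trans (Nat.pow_log_le_self 2 hx.ne')
    rw [Finset.mem_filter, Finset.mem_range]
    exact ⟨lt_of_lt_of_le Nat.lt_two_pow_self (hi'.trans hM), hi'⟩
  have h2 := Finset.card_le_card h1
  rw [Finset.card_range] at h2
  calc Real.logb 2 x ≤ (Nat.log 2 x + 1 : ℕ) := by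
        rw [Real.logb_le_iff_le_rpow one_lt_two (by exact_mod_cast hx), Real.rpow_natCast]
        exact_mod_cast (Nat.lt_pow_succ_log_self one_lt_two x).le
    _ ≤ _ := by exact_mod_cast h2

/-- The logarithm of `M ^ m / (M * (M - 1) * ⋯ * (M - m + 1))` is linear. -/
theorem sum_logb_le {m M : ℕ} (hm : m ≤ M) :
    ∑ t ∈ Finset.range m, Real.logb 2 (M / (M - t)) ≤ 2 * M := by
  have hpos : ∀ t ∈ Finset.range M, (0 : ℝ) < M - t := fun t ht => by
    have : (t : ℝ) < M := by exact_mod_cast Finset.mem_range.1 ht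
    linarith
  have hprod : ∏ t ∈ Finset.range M, ((M : ℝ) / (M - t)) = M ^ M / M.factorial := by
    rw [Finset.prod_div_distrib, Finset.prod_const, Finset.card_range, ← Nat.descFactorial_self,
      Nat.descFactorial_eq_prod_range]
    push_cast
    congr 1
    exact Finset.prod_congr rfl fun t ht => (Nat.cast_sub (Finset.mem_range.1 ht).le).symm
  have hdiv : ∀ t ∈ Finset.range M, (1 : ℝ) ≤ M / (M - t) := fun t ht => by
    rw [one_le_div (hpos t ht)]
    linarith [show (0 : ℝ) ≤ t from Nat.cast_nonneg _]
  calc ∑ t ∈ Finset.range m, Real.logb 2 (M / (M - t))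
      ≤ ∑ t ∈ Finset.range M, Real.logb 2 (M / (M - t)) :=
        Finset.sum_le_sum_of_subset_of_nonneg (Finset.range_mono hm) fun t ht _ =>
          Real.logb_nonneg one_lt_two (hdiv t ht)
    _ = Real.log (M ^ M / M.factorial) / Real.log 2 := by
        rw [← hprod, Real.log_prod fun t ht => (zero_lt_one.trans_le (hdiv t ht)).ne',
          Finset.sum_div]
        rfl
    _ ≤ M / Real.log 2 := by
        refine div_le_div_of_nonneg_right ?_ (Real.log_nonneg one_le_two)
        have h1 := Finset.prod_pos fun t ht => zero_lt_one.trans_le (hdiv t ht)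
        rw [hprod] at h1
        rw [Real.log_le_iff_le_exp h1]
        exact Real.pow_div_factorial_le_exp _ (Nat.cast_nonneg _) _
    _ ≤ 2 * M := by
        have := Real.log_two_gt_d9
        rw [div_le_iff₀ (by linarith)]
        nlinarith [show (0 : ℝ) ≤ M from Nat.cast_nonneg _]

/-- What the parameters must satisfy besides `Par.Valid`: the sizes that the programs compute, and a
word length that is large enough for the hash function. -/
structure Par.Good (p : Par) (m U : ℕ) : Prop where
  valid : p.Valid
  size : 3 ≤ p.S
  slots : p.M = m / p.w + m + 1
  nodes : p.N = (p.M - 2) / (p.f - 1) + 1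
  le_degree : p.w ≤ (p.f + 1) * (p.f + 2)
  keys_sq : (U + 3) * (U + 3) ≤ 2 ^ (p.w / 2)
  slots_sq : 2 * p.M ^ 2 ≤ 2 ^ (p.w - p.w / 2)

namespace Par.Good

variable {p : Par} {m U n : ℕ}

theorem lt_slots (G : p.Good m U) : m < p.M := OffsetTable.lt_slots G.slots

theorem keys_le (G : p.Good m U) : U ≤ 2 ^ p.w := by
  have h1 := G.keys_sq
  have h2 : 2 ^ (p.w / 2) ≤ 2 ^ p.w := Nat.pow_le_pow_right two_pos (Nat.div_le_self _ _)
  nlinarith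

/-- The fraction of free slots is never smaller than about `1 / w`. -/
theorem free_fraction (G : p.Good m U) {t : ℕ} (ht : t ≤ m) :
    (1 : ℝ) / (p.w + 1) ≤ (p.M - t) / p.M := by
  have hw := G.valid.sixteen_lt
  have hM : 0 < p.M := by have := G.lt_slots; omega
  rw [div_le_div_iff₀ (by positivity) (by exact_mod_cast hM)]
  have h1 : m < p.w * (m / p.w + 1) := Nat.lt_mul_div_succ m (by omega)
  have h2 : p.M ≤ (p.w + 1) * (m / p.w + 1) := by rw [G.slots]; nlinarith
  have h3 : ((m / p.w + 1 : ℕ) : ℝ) ≤ p.M - t := by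
    rw [G.slots]
    have : (t : ℝ) ≤ m := by exact_mod_cast ht
    push_cast
    linarith
  have h4 : (p.M : ℝ) ≤ (p.w + 1) * (m / p.w + 1 : ℕ) := by exact_mod_cast h2
  nlinarith [show (0 : ℝ) ≤ p.w from Nat.cast_nonneg _]

theorem prob_overfull (G : p.Good m U) {A : Finset (Fin U)} {k : Fin U} (hk : k ∉ A)
    (hA : A.card < m) {l : ℕ} (hl : 1 ≤ l) :
    prob (fun seed => Overfull p.M (seedHome p G.size seed) k A l) ≤
      2560000 / (((p.M - A.card : ℝ) / p.M) ^ 4 * l) :=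
  (seedTop_indep G.size G.keys_sq (by omega) (by omega)).prob_overfull_le hk
    (hA.trans G.lt_slots) G.slots_sq hl

theorem prob_overfull_le_of_le (G : p.Good m U) {A : Finset (Fin U)} {k : Fin U} (hk : k ∉ A)
    (hA : A.card < m) {l : ℝ} (hl : 0 < l) {l' : ℕ} (hl' : l ≤ l') :
    prob (fun seed => Overfull p.M (seedHome p G.size seed) k A l') ≤
      2560000 * (p.w + 1) ^ 4 / l := by
  have h0 : (0 : ℝ) < l' := hl.trans_le hl'
  refine (G.prob_overfull hk hA (by exact_mod_cast h0)).trans ?_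
  have h1 := G.free_fraction hA.le
  have hw : (0 : ℝ) < p.w + 1 := by positivity
  have h2 : ((1 : ℝ) / (p.w + 1)) ^ 4 * l ≤ (((p.M - A.card : ℝ) / p.M) ^ 4 * l') := by
    gcongr
  calc (2560000 : ℝ) / (((p.M - A.card : ℝ) / p.M) ^ 4 * l')
      ≤ 2560000 / (((1 : ℝ) / (p.w + 1)) ^ 4 * l) := by gcongr
    _ = _ := by field_simp

/-- Only a bounded number of scales is expected to be overfull. -/
theorem expect_scales (G : p.Good m U) {A : Finset (Fin U)} {k : Fin U} (hk : k ∉ A)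
    (hA : A.card < m) :
    𝔼 seed, (scales p.f p.M (seedHome p G.size seed) k A : ℝ) ≤ 81920008 := by
  classical
  have hf := G.valid.shape.four_le
  have hfr : (4 : ℝ) ≤ p.f := by exact_mod_cast hf
  have hwf : (p.w : ℝ) + 1 ≤ 2 * p.f ^ 2 := by
    have h1 : (p.w : ℝ) ≤ (p.f + 1) * (p.f + 2) := by exact_mod_cast G.le_degree
    nlinarith
  have hw0 : (0 : ℝ) ≤ p.w := Nat.cast_nonneg _
  have key : 𝔼 seed, (scales p.f p.M (seedHome p G.size seed) k A : ℝ) =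
      ∑ i ∈ Finset.range p.M,
        prob fun seed => Overfull p.M (seedHome p G.size seed) k A (p.f ^ i) := by
    rw [← expect_card_filter]
    rfl
  rw [key]
  refine (sum_le_add_of_geometric p.M 8 (a := 40960000) (fun i => prob_nonneg _)
    (fun i => prob_le_one _) (by norm_num) fun i => ?_).trans (by norm_num)
  refine (G.prob_overfull_le_of_le hk hA (l := (p.f : ℝ) ^ (8 + i)) (by positivity)
    (by push_cast; rfl)).trans ?_
  rw [div_le_div_iff₀ (by positivity) (by positivity), pow_add]
  have h1 : ((p.w : ℝ) + 1) ^ 4 ≤ (2 * p.f ^ 2) ^ 4 := by gcongr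
  have h2 : (2 : ℝ) ^ i ≤ p.f ^ i := by gcongr; linarith
  calc (2560000 : ℝ) * (p.w + 1) ^ 4 * 2 ^ i ≤ 2560000 * (2 * p.f ^ 2) ^ 4 * p.f ^ i := by gcongr
    _ = _ := by ring

/-- The expected time of every operation is bounded. -/
theorem expect_time (G : p.Good m U) {h : List (Op U p.v)} {o : Op U p.v}
    (hl : Legal m (o :: h)) :
    𝔼 seed : Memory p.w p.S,
      (time (code.program o) ((session code n m seed h).start o) : ℝ) ≤ 10 ^ 10 := by
  have hinv := fun seed {h : List (Op U p.v)} (hl : Legal m h) =>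
    session_invariant (n := n) G.valid G.size G.slots G.nodes G.le_degree G.keys_le seed hl
  have hconst : ∀ {X : Memory p.w p.S → ℕ} {c : ℕ}, (∀ seed, X seed ≤ c) →
      𝔼 seed, (X seed : ℝ) ≤ c := fun {X c} hX =>
    (Finset.expect_le_expect fun seed _ => show (X seed : ℝ) ≤ c by exact_mod_cast hX seed).trans
      (Finset.expect_const Finset.univ_nonempty _).le
  cases o with
  | insert k y =>
    have h1 : ∀ seed : Memory p.w p.S, (time (code.program (.insert k y))
        ((session code n m seed h).start (.insert k y)) : ℝ) ≤
        400 + 100 * (scales p.f p.M (seedHome p G.size seed) k (keys h) : ℝ) := fun seed => by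
      have := ((hinv seed hl.1).insert G.valid G.keys_le (seedHome_eq G.size seed) G.lt_slots hl).2.1
      have : (time (code.program (.insert k y))
        ((session code n m seed h).start (.insert k y)) : ℝ) ≤
        ((100 * (2 + scales p.f p.M (seedHome p G.size seed) k (keys h)) + 200 : ℕ) : ℝ) := by
        exact_mod_cast this
      push_cast at this
      linarith
    refine (Finset.expect_le_expect fun seed _ => h1 seed).trans ?_
    rw [Finset.expect_add_distrib, Finset.expect_const Finset.univ_nonempty, ← Finset.mul_expect]
    have := G.expect_scales hl.2.1 hl.2.2
    norm_num
    linarith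
  | update k y =>
    refine (hconst fun seed => ((hinv seed hl.1).update G.valid G.keys_le
      (seedHome_eq G.size seed) hl).2.1).trans (by norm_num)
  | query k =>
    refine (hconst fun seed => ((hinv seed hl.1).query G.valid G.keys_le
      (seedHome_eq G.size seed) hl).2.1).trans (by norm_num)

/-- Sums over the inserted keys are estimated insertion by insertion. -/
theorem expect_sum_offset (G : p.Good m U) {g : ℕ → ℝ} {b : ℕ → ℝ}
    (hb : ∀ (ks : List (Fin U)) (k : Fin U), (k :: ks).Nodup → ks.length < m →
      𝔼 seed, g (disp p.M (seedHome p G.size seed k) (occ p.M (seedHome p G.size seed) ks)) ≤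
        b ks.length)
    {h : List (Op U p.v)} (hl : Legal m h) :
    𝔼 seed : Memory p.w p.S, ∑ k ∈ keys h, g (offset code n m seed h k) ≤
      ∑ t ∈ Finset.range (keys h).card, b t := by
  induction h with
  | nil =>
    simp [show keys ([] : List (Op U p.v)) = ∅ by ext k; simp [mem_keys, contents]]
  | cons o h ih =>
    cases o with
    | insert k y =>
      have h1 : ∀ seed : Memory p.w p.S,
          ∑ k' ∈ keys (.insert k y :: h), g (offset code n m seed (.insert k y :: h) k') =
          g (disp p.M (seedHome p G.size seed k) (occ p.M (seedHome p G.size seed) (insertions h)))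
            + ∑ k' ∈ keys h, g (offset code n m seed h k') := fun seed => by
        have hoff := offset_insert (n := n) G.valid G.size G.slots G.nodes G.le_degree G.keys_le
          seed hl
        rw [keys_insert, Finset.sum_insert hl.2.1, hoff, if_pos rfl]
        congr 1
        refine Finset.sum_congr rfl fun k' hk' => ?_
        have hne : k' ≠ k := fun he => hl.2.1 (he ▸ hk')
        rw [hoff, if_neg hne]
      simp only [h1]
      rw [Finset.expect_add_distrib, keys_insert, Finset.card_insert_of_notMem hl.2.1,
        Finset.sum_range_succ, add_comm]
      have h2 := hb (insertions h) k (nodup_insertions hl)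
        (by rw [length_insertions hl.1]; exact hl.2.2)
      rw [length_insertions hl.1] at h2
      exact add_le_add (ih hl.1) h2
    | update k y => rw [keys_update hl.2]; exact ih hl.1
    | query k => rw [keys_query]; exact ih hl.1

theorem expect_logb_disp (G : p.Good m U) {ks : List (Fin U)} {k : Fin U} (hnd : (k :: ks).Nodup)
    (hks : ks.length < m) :
    𝔼 seed, Real.logb 2 (1 + (disp p.M (seedHome p G.size seed k)
        (occ p.M (seedHome p G.size seed) ks) : ℕ)) ≤
      4 * Real.logb 2 (p.M / (p.M - ks.length)) + 5120001 := by
  classical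
  have hmM := G.lt_slots
  have hcard : ks.toFinset.card = ks.length :=
    List.toFinset_card_of_nodup (List.nodup_cons.1 hnd).2
  have hk : k ∉ ks.toFinset := by simpa using (List.nodup_cons.1 hnd).1
  have hη : (0 : ℝ) < (p.M - ks.length) / p.M := by
    rw [← hcard]
    refine lt_of_lt_of_le ?_ (G.free_fraction (by omega))
    positivity
  set η : ℝ := (p.M - ks.length) / p.M with hηd
  have hηinv : (p.M : ℝ) / (p.M - ks.length) = η⁻¹ := by rw [hηd, inv_div]
  rw [hηinv]
  have hη1 : 1 ≤ η⁻¹ := by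
    rw [one_le_inv₀ hη, hηd]
    refine div_le_one_of_le₀ ?_ (Nat.cast_nonneg _)
    linarith [show (0 : ℝ) ≤ ks.length from Nat.cast_nonneg _]
  have hlog : 0 ≤ Real.logb 2 η⁻¹ := Real.logb_nonneg one_lt_two hη1
  set c : ℕ := ⌈4 * Real.logb 2 η⁻¹⌉₊ with hc
  have hc1 : (c : ℝ) ≤ 4 * Real.logb 2 η⁻¹ + 1 := (Nat.ceil_lt_add_one (by linarith)).le
  have hc2 : (η ^ 4)⁻¹ ≤ 2 ^ c := by
    rw [← inv_pow, ← Real.rpow_natCast 2 c]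
    rw [← Real.logb_le_iff_le_rpow one_lt_two (by positivity), Real.logb_pow]
    exact_mod_cast Nat.le_ceil _
  have h1 : ∀ seed : Memory p.w p.S, Real.logb 2 (1 + (disp p.M (seedHome p G.size seed k)
      (occ p.M (seedHome p G.size seed) ks) : ℕ)) ≤ (((Finset.range p.M).filter fun i =>
        Overfull p.M (seedHome p G.size seed) k ks.toFinset (2 ^ i)).card : ℝ) := fun seed => by
    have hd := (disp_spec (h := seedHome p G.size seed k)
      (exists_free (M := p.M) (home := seedHome p G.size seed) (ks := ks) (by omega))).1
    have h2 := logb_natCast_le_card (M := p.M) (x := 1 + disp p.M (seedHome p G.size seed k)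
      (occ p.M (seedHome p G.size seed) ks)) (by omega) (by omega)
    push_cast at h2 ⊢
    refine h2.trans ?_
    norm_cast
    refine Finset.card_le_card (Finset.monotone_filter_right _ fun i _ hi => ?_)
    exact overfull_of_le_disp hnd (by omega) (G.valid.home_lt _) (by omega)
  refine (Finset.expect_le_expect fun seed _ => h1 seed).trans ?_
  rw [expect_card_filter]
  refine (sum_le_add_of_geometric p.M c (a := 2560000) (fun i => prob_nonneg _)
    (fun i => prob_le_one _) (by norm_num) fun i => ?_).trans (by linarith)
  refine (G.prob_overfull hk (by omega) Nat.one_le_two_pow).trans ?_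
  rw [hcard, ← hηd]
  push_cast
  rw [pow_add, ← mul_assoc]
  have h2 : 1 ≤ η ^ 4 * 2 ^ c := by
    rw [inv_le_iff_one_le_mul₀ (by positivity)] at hc2
    linarith
  gcongr
  nlinarith [show (0 : ℝ) < 2 ^ i by positivity]

/-- The offsets have a linear expected total length. -/
theorem expect_logb_offset (G : p.Good m U) (hm : 1 ≤ m) {h : List (Op U p.v)} (hl : Legal m h) :
    𝔼 seed : Memory p.w p.S, ∑ k ∈ keys h, Real.logb 2 (1 + (offset code n m seed h k : ℝ)) ≤
      10 ^ 10 * m := by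
  have hmM := G.lt_slots
  have h1 := G.expect_sum_offset (n := n) (g := fun P => Real.logb 2 (1 + (P : ℝ)))
    (b := fun t => 4 * Real.logb 2 (p.M / (p.M - t)) + 5120001)
    (fun ks k hnd hks => G.expect_logb_disp hnd hks) hl
  refine h1.trans ?_
  have hcm := card_keys_le hl
  rw [Finset.sum_add_distrib, ← Finset.mul_sum, Finset.sum_const, Finset.card_range, nsmul_eq_mul]
  have h2 := sum_logb_le (hcm.trans hmM.le)
  have h3 : (p.M : ℝ) ≤ 3 * m := by
    have : p.M ≤ 3 * m := by
      have := Nat.div_le_self m p.w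
      rw [G.slots]; omega
    exact_mod_cast this
  have h4 : ((keys h).card : ℝ) ≤ m := by exact_mod_cast hcm
  have h5 : (0 : ℝ) ≤ m := Nat.cast_nonneg _
  linarith

/-- Few offsets are large. -/
theorem expect_card_offset (G : p.Good m U) {l : ℝ} (h0 : 0 < l) {h : List (Op U p.v)}
    (hl : Legal m h) :
    𝔼 seed : Memory p.w p.S,
        (((keys h).filter fun k => l < (offset code n m seed h k : ℝ)).card : ℝ) ≤
      m * (2560000 * (p.w + 1) ^ 4 / l) := by
  classical
  have hmM := G.lt_slots
  have h1 := G.expect_sum_offset (n := n) (g := fun P => if l < (P : ℝ) then 1 else 0)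
    (b := fun _ => 2560000 * (p.w + 1) ^ 4 / l) (fun ks k hnd hks => ?_) hl
  · simp only [Finset.card_filter]
    push_cast
    refine h1.trans ?_
    rw [Finset.sum_const, Finset.card_range, nsmul_eq_mul]
    have : ((keys h).card : ℝ) ≤ m := by exact_mod_cast card_keys_le hl
    gcongr
  · have hcard : ks.toFinset.card = ks.length :=
      List.toFinset_card_of_nodup (List.nodup_cons.1 hnd).2
    have hk : k ∉ ks.toFinset := by simpa using (List.nodup_cons.1 hnd).1
    have hprob : ∀ (q : Memory p.w p.S → Prop) [DecidablePred q],
        𝔼 seed, (if q seed then (1 : ℝ) else 0) = prob q := fun q _ =>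
      Finset.expect_congr rfl fun seed _ => by congr
    refine (hprob _).le.trans ((prob_mono fun seed hlt => ?_).trans
      (G.prob_overfull_le_of_le hk (by omega) h0 (Nat.le_ceil l)))
    exact overfull_of_le_disp hnd (by omega) (G.valid.home_lt _)
      ((Nat.ceil_le.2 hlt.le).trans (Nat.le_succ _))

end Par.Good

end OffsetTable

/-! ### The choice of the parameters -/

namespace OffsetTable

open WordRAM

theorem pow_le_two_pow {n k x : ℕ} (hn : 2 ≤ n) (h : k * Real.logb 2 n ≤ x) : n ^ k ≤ 2 ^ x := by
  have hn0 : (0 : ℝ) < n := by positivity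
  rw [← Real.logb_pow, Real.logb_le_iff_le_rpow one_lt_two (by positivity),
    Real.rpow_natCast] at h
  exact_mod_cast h

theorem mul_sq_lt_two_pow {x : ℕ} (hx : 32 ≤ x) : 20 * (2 * x + 1) ^ 2 < 2 ^ x := by
  induction x, hx using Nat.le_induction with
  | base => norm_num
  | succ x hx ih => rw [pow_succ 2 x]; nlinarith

/-- The search tree gets the largest degree `f` with `f * (f + 1) < w`. -/
theorem exists_degree {w : ℕ} (hw : 20 < w) :
    ∃ f, 4 ≤ f ∧ f * (f + 1) < w ∧ w ≤ (f + 1) * (f + 2) := by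
  have hex : ∃ f, w ≤ (f + 1) * (f + 2) := ⟨w, by nlinarith⟩
  classical
  have h1 := Nat.find_spec hex
  have h2 : 4 ≤ Nat.find hex := by
    by_contra h
    have : (Nat.find hex + 1) * (Nat.find hex + 2) ≤ 4 * 5 := Nat.mul_le_mul (by omega) (by omega)
    omega
  refine ⟨Nat.find hex, h2, ?_, h1⟩
  have h3 := Nat.find_min hex (m := Nat.find hex - 1) (by omega)
  rw [not_le, show Nat.find hex - 1 + 1 = Nat.find hex by omega,
    show Nat.find hex - 1 + 2 = Nat.find hex + 1 by omega] at h3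
  exact h3

theorem shape_of_slots {f M : ℕ} (hf : 4 ≤ f) (hM : 2 ≤ M) : Shape f ((M - 2) / (f - 1) + 1) M := by
  obtain ⟨g, rfl⟩ : ∃ g, f = g + 1 := ⟨f - 1, by omega⟩
  obtain ⟨M, rfl⟩ : ∃ M', M = M' + 2 := ⟨M - 2, by omega⟩
  simp only [Nat.add_sub_cancel]
  have h1 := Nat.mul_div_le M g
  have h2 := Nat.lt_mul_div_succ M (show 0 < g by omega)
  generalize M / g = N at *
  refine ⟨hf, by omega, hM, ?_, ?_⟩
  · have : (g + 1) * (N + 1) = g * (N + 1) + (N + 1) := by ring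
    omega
  · have : (g + 1) * (N + 1 - 1) = g * N + N := by rw [Nat.add_sub_cancel]; ring
    omega

/-- Parameters that need only `m * v + O(m)` bits. -/
theorem exists_par {d L n m v U w : ℕ} (hn : 2 ≤ n) (hm : Real.logb 2 n ≤ m) (hmn : m ≤ n)
    (hv : (v : ℝ) ≤ Real.logb 2 n) (hU : U ≤ n ^ d)
    (hw : (4 * d + 64 : ℕ) * Real.logb 2 n ≤ w) (hwL : w ≤ L * Real.logb 2 n) :
    ∃ S M N f : ℕ, Par.Good ⟨w, S, M, N, f, v⟩ m U ∧
      S * w ≤ m * v + (7 + 22 * L) * m := by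
  have hlog : 1 ≤ Real.logb 2 n := by
    rw [Real.le_logb_iff_rpow_le one_lt_two (by positivity), Real.rpow_one]
    exact_mod_cast hn
  have hm1 : 1 ≤ m := by exact_mod_cast hlog.trans hm
  have hw64 : 4 * d + 64 ≤ w := by
    have : ((4 * d + 64 : ℕ) : ℝ) ≤ w := by nlinarith [show (0 : ℝ) ≤ (4 * d + 64 : ℕ) by positivity]
    exact_mod_cast this
  have hvw : v < w := by
    have : (v : ℝ) < w := by
      push_cast at hw
      have hd : (0 : ℝ) ≤ d * Real.logb 2 n := by positivity
      nlinarith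
    exact_mod_cast this
  have hwm : w ≤ L * m := by
    have : (w : ℝ) ≤ L * m := hwL.trans (by gcongr)
    exact_mod_cast this
  -- half of a word is enough for `n ^ (2 * d + 31)`
  have hpow : n ^ (2 * d + 31) ≤ 2 ^ (w / 2) := by
    refine pow_le_two_pow hn ?_
    have h1 : (w : ℝ) ≤ 2 * (w / 2 : ℕ) + 1 := by
      have : w ≤ 2 * (w / 2) + 1 := by omega
      exact_mod_cast this
    push_cast at hw h1 ⊢
    nlinarith
  obtain ⟨f, hf4, hfw, hwf⟩ := exists_degree (w := w) (by omega)
  set M := m / w + m + 1 with hM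
  set N := (M - 2) / (f - 1) + 1 with hN
  set X := 16 * w + (N + M + f) + M * v with hX
  have hdivm : m / w ≤ m := Nat.div_le_self _ _
  have hdiv0 := Nat.zero_le (m / w)
  have hM2 : 2 ≤ M := by omega
  have hM3 : M ≤ 3 * m := by omega
  have hNM : N ≤ M := by
    have : (M - 2) / (f - 1) ≤ M - 2 := Nat.div_le_self _ _
    omega
  have hfw' : f ≤ w := by nlinarith
  have hXw := Nat.mul_div_le X w
  have hXw' := Nat.lt_mul_div_succ X (show 0 < w by omega)
  have hSw : (X / w + 3) * w = w * (X / w) + 3 * w := by ring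
  have hSw' : w * (X / w + 1) = w * (X / w) + w := by ring
  have hMv : M * v ≤ m * v + m + v := by
    have h1 : m / w * v ≤ m := (Nat.mul_le_mul_left _ hvw.le).trans (Nat.div_mul_le_self m w)
    have h2 : M * v = m / w * v + m * v + v := by rw [hM]; ring
    omega
  refine ⟨X / w + 3, M, N, f, ⟨⟨shape_of_slots hf4 hM2, hfw, hvw, ?_, ?_⟩, by simp, rfl, rfl, hwf,
    ?_, ?_⟩, ?_⟩
  · show 16 * w + (N + M + f) + M * v + 2 * w ≤ (X / w + 3) * w
    omega
  · show w * ((X / w + 3) * w) < 2 ^ w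
    have h1 : (X / w + 3) * w ≤ 20 * n * w := by
      have h2 : M * v ≤ 3 * n * w := Nat.mul_le_mul (by omega) hvw.le
      have h3 : 2 * w ≤ n * w := Nat.mul_le_mul_right _ hn
      have h4 : n * 64 ≤ n * w := Nat.mul_le_mul_left _ (by omega)
      have h5 : 20 * n * w = 20 * (n * w) := by ring
      have h6 : 3 * n * w = 3 * (n * w) := by ring
      omega
    have h2 : 20 * w ^ 2 < 2 ^ (w / 2) := by
      refine lt_of_le_of_lt ?_ (mul_sq_lt_two_pow (x := w / 2) (by omega))
      gcongr
      omega
    have h3 : n ≤ 2 ^ (w / 2) := (Nat.le_self_pow (by omega) n).trans hpow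
    calc w * ((X / w + 3) * w) ≤ w * (20 * n * w) := Nat.mul_le_mul_left _ h1
      _ = n * (20 * w ^ 2) := by ring
      _ < n * 2 ^ (w / 2) := Nat.mul_lt_mul_of_pos_left h2 (by omega)
      _ ≤ 2 ^ (w / 2) * 2 ^ (w / 2) := Nat.mul_le_mul_right _ h3
      _ = 2 ^ (w / 2 + w / 2) := (pow_add _ _ _).symm
      _ ≤ 2 ^ w := Nat.pow_le_pow_right two_pos (by omega)
  · show (U + 3) * (U + 3) ≤ 2 ^ (w / 2)
    have h1 : U + 3 ≤ n ^ (d + 2) := by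
      have h2 : 1 ≤ n ^ d := Nat.one_le_pow _ _ (by omega)
      have h3 : n ^ d * 4 ≤ n ^ d * n ^ 2 := Nat.mul_le_mul_left _ (by nlinarith)
      rw [pow_add]
      omega
    calc (U + 3) * (U + 3) ≤ n ^ (d + 2) * n ^ (d + 2) := Nat.mul_le_mul h1 h1
      _ = n ^ (2 * d + 4) := by rw [← pow_add]; congr 1; ring
      _ ≤ n ^ (2 * d + 31) := Nat.pow_le_pow_right (by omega) (by omega)
      _ ≤ _ := hpow
  · show 2 * M ^ 2 ≤ 2 ^ (w - w / 2)
    have h1 : M ≤ n ^ 3 := by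
      have : n * 3 ≤ n * n ^ 2 := Nat.mul_le_mul_left _ (by nlinarith)
      rw [pow_succ' n 2]
      omega
    calc 2 * M ^ 2 ≤ n * (n ^ 3) ^ 2 := Nat.mul_le_mul hn (Nat.pow_le_pow_left h1 2)
      _ = n ^ 7 := by ring
      _ ≤ n ^ (2 * d + 31) := Nat.pow_le_pow_right (by omega) (by omega)
      _ ≤ 2 ^ (w / 2) := hpow
      _ ≤ _ := Nat.pow_le_pow_right two_pos (by omega)
  · have h1 : (7 + 22 * L) * m = 7 * m + 22 * (L * m) := by ring
    omega

end OffsetTable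

theorem mainTheorem5 (d : ℕ) :
    ∃ K : ℕ, ∀ L : ℕ, ∃ (D : OffsetTable.Code) (C : ℕ),
      ∀ n m v U w : ℕ, 2 ≤ n →
        Real.logb 2 n ≤ m → m ≤ n → (v : ℝ) ≤ Real.logb 2 n → U ≤ n ^ d →
        K * Real.logb 2 n ≤ w → w ≤ L * Real.logb 2 n →
        ∃ S : ℕ,
          -- space
          S * w ≤ m * v + C * m ∧
          -- creation
          (∀ seed : WordRAM.Memory w S,
            WordRAM.Halts D.init (OffsetTable.initStart n m v U seed)) ∧
          -- every operation `o`, requested after the operations `h`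
          (∀ (h : List (OffsetTable.Op U v)) (o : OffsetTable.Op U v),
            OffsetTable.Legal m (o :: h) →
              (∀ seed : WordRAM.Memory w S,
                WordRAM.Halts (D.program o) ((OffsetTable.session D n m seed h).start o)) ∧
              (∀ seed : WordRAM.Memory w S, ∀ k y,
                o = .query k → OffsetTable.contents h k = some y →
                ((OffsetTable.session D n m seed h).answer D o).toNat = y.val) ∧
              (𝔼 seed : WordRAM.Memory w S,
                (WordRAM.time (D.program o) ((OffsetTable.session D n m seed h).start o) : ℝ))
                ≤ C) ∧
          -- offsets
          (∀ h : List (OffsetTable.Op U v), OffsetTable.Legal m h →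
            (𝔼 seed : WordRAM.Memory w S, ∑ k ∈ OffsetTable.keys h,
              Real.logb 2 (1 + (OffsetTable.offset D n m seed h k : ℝ))) ≤ C * m ∧
            (𝔼 seed : WordRAM.Memory w S, (((OffsetTable.keys h).filter fun k =>
              Real.logb 2 n ^ 100 < (OffsetTable.offset D n m seed h k : ℝ)).card : ℝ))
              ≤ C * (m / Real.logb 2 n ^ 95)) := by
  refine ⟨4 * d + 64, fun L => ⟨OffsetTable.code, 10 ^ 10 * (L + 1) ^ 4, ?_⟩⟩
  intro n m v U w hn hm hmn hv hU hw hwL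
  obtain ⟨S, M, N, f, G, hspace⟩ := OffsetTable.exists_par hn hm hmn hv hU hw hwL
  have hlog : 1 ≤ Real.logb 2 n := by
    rw [Real.le_logb_iff_rpow_le one_lt_two (by positivity), Real.rpow_one]
    exact_mod_cast hn
  have hm1 : 1 ≤ m := by exact_mod_cast hlog.trans hm
  have hL : (1 : ℝ) ≤ (L + 1) ^ 4 := one_le_pow₀ (by linarith [show (0 : ℝ) ≤ L from L.cast_nonneg])
  have hinv := fun (seed : WordRAM.Memory w S) {h : List (OffsetTable.Op U v)}
      (hl : OffsetTable.Legal m h) =>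
    OffsetTable.session_invariant (n := n) G.valid G.size G.slots G.nodes G.le_degree G.keys_le
      seed hl
  refine ⟨S, hspace.trans ?_, fun seed => ?_, fun h o hl => ⟨fun seed => ?_,
    fun seed k y ho hy => ?_, ?_⟩, fun h hl => ⟨?_, ?_⟩⟩
  · gcongr
    have : L + 1 ≤ (L + 1) ^ 4 := Nat.le_self_pow (by omega) _
    omega
  · exact (OffsetTable.init_halts_and_invariant G.valid G.size G.slots G.nodes G.le_degree seed).1
  · cases o with
    | insert k y => exact ((hinv seed hl.1).insert G.valid G.keys_le
        (OffsetTable.seedHome_eq G.size seed) G.lt_slots hl).1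
    | update k y => exact ((hinv seed hl.1).update G.valid G.keys_le
        (OffsetTable.seedHome_eq G.size seed) hl).1
    | query k => exact ((hinv seed hl.1).query G.valid G.keys_le
        (OffsetTable.seedHome_eq G.size seed) hl).1
  · subst ho
    exact ((hinv seed hl.1).query G.valid G.keys_le
      (OffsetTable.seedHome_eq G.size seed) hl).2.2.1 y hy
  · refine (G.expect_time (n := n) hl).trans ?_
    push_cast
    linarith
  · refine (G.expect_logb_offset (n := n) hm1 hl).trans ?_
    push_cast
    gcongr
    linarith
  · refine (G.expect_card_offset (n := n) (by positivity) hl).trans ?_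
    have hw1 : (w : ℝ) + 1 ≤ (L + 1) * Real.logb 2 n := by linarith
    calc (m : ℝ) * (2560000 * (w + 1) ^ 4 / Real.logb 2 n ^ 100)
        ≤ m * (2560000 * ((L + 1) * Real.logb 2 n) ^ 4 / Real.logb 2 n ^ 100) := by gcongr
      _ = 2560000 * (L + 1) ^ 4 * (m / Real.logb 2 n ^ 96) := by field_simp
      _ ≤ 10 ^ 10 * (L + 1) ^ 4 * (m / Real.logb 2 n ^ 95) := by gcongr <;> norm_num
      _ = _ := by push_cast; ring
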